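/- **Conventions.** For $n\ge 2$ let $\mathcal O_n$ be the Cuntz algebra with canonical generators $s^{(n)}_1,\dots,s^{(n)}_n$, i.e. the universal unital C*-algebra with the relations $(s^{(n)}_i)^*s^{(n)}_j=\delta_{ij}I$ and $\sum_i s^{(n)}_i(s^{(n)}_i)^*=I$; let $\mathcal O_1=\mathbf C$ with $s^{(1)}_1=1$. All tensor products of C*-algebras are minimal, and tensor products and direct sums of Hilbert spaces are Hilbert space tensor products and direct sums. For $n,m\ge 1$ let $\varphi_{n,m}:\mathcal O_{nm}\to\mathcal O_n\otimes\mathcal O_m$ be the unital $*$-homomorphism with $$\varphi_{n,m}\bigl(s^{(nm)}_{m(i-1)+j}\bigr)=s^{(n)}_i\otimes s^{(m)}_j\qquad(1\le i\le n,\ 1\le j\le m).$$ Let $\mathcal O_*=\bigoplus_{n\ge 1}\mathcal O_n$ be the $c_0$-direct sum, with the comultiplication $\Delta_\varphi:\mathcal O_*\to\mathcal O_*\otimes\mathcal O_*$ which on $\mathcal O_k$ is $\Delta_\varphi(x)=\sum_{nm=k}\varphi_{n,m}(x)$. A *covariant representation* of $(\mathcal O_*,\Delta_\varphi)$ is a triple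 $(\mathcal H,\pi,W)$ of a Hilbert space $\mathcal H$, a $*$-representation $\pi$ of $\mathcal O_*$ on $\mathcal H$ and a nonzero partial isometry $W$ on $\mathcal H\otimes\mathcal H$ with $W^*$ isometric, such that $$W(\pi(a)\otimes I)=\{(\pi\otimes\pi)\circ\Delta_\varphi\}(a)\,W\qquad(a\in\mathcal O_*).$$ It is *pentagonal* if $W_{12}W_{13}W_{23}=W_{23}W_{12}$ on $\mathcal H\otimes\mathcal H\otimes\mathcal H$ (leg numbering notation). For $z\in\mathbf C^n$ and $y\in\mathbf C^m$ let $z\boxtimes y\in\mathbf C^{nm}$ be given by $(z\boxtimes y)_{m(i-1)+j}=z_iy_j$. Call a sequence $(z^{(n)})_{n\ge 1}$ *multiplicative* if each $z^{(n)}$ is a unit vector of $\mathbf C^n$ and $z^{(n)}\boxtimes z^{(m)}=z^{(nm)}$ for all $n,m\ge 1$. For a unit vector $z\in\mathbf C^n$ (with $z=1$ if $n=1$), the *Cuntz state* $\varrho_z$ is the state of $\mathcal O_n$ with $$\varrho_z(s_{j_1}\cdots s_{j_a}s_{k_b}^*\cdots s_{k_1}^*)=\overline{z_{j_1}}\cdots\overline{z_{j_a}}\,z_{k_b}\cdots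 z_{k_1}$$ for all $a,b\ge 1$ and all indices $j_1,\dots,j_a,k_1,\dots,k_b\in\{1,\dots,n\}$, where $s_i=s_i^{(n)}$. **Theorem.** Let $(z^{(n)})_{n\ge 1}$ be a multiplicative sequence. (i) For every $n$ the state $\varrho_{z^{(n)}}$ of $\mathcal O_n$ exists and is unique. Let $(\mathcal H_n,\pi_n,\Omega_n)$ be a GNS triple of $\varrho_{z^{(n)}}$ for each $n$ (such triples exist), and put $\mathcal H=\bigoplus_n\mathcal H_n$ and $\pi=\bigoplus_n\pi_n$. Then there is a bounded operator $W$ on $\mathcal H\otimes\mathcal H$ with $$W\bigl(\pi_{nm}(x)\Omega_{nm}\otimes v\bigr)=(\pi_n\otimes\pi_m)(\varphi_{n,m}(x))\bigl(\Omega_n\otimes\langle\Omega_m,v\rangle\,\Omega_m\bigr)\qquad(n,m\ge 1,\ x\in\mathcal O_{nm},\ v\in\mathcal H_m),$$ where the inner product is linear in the second variable, and with $W=0$ on $\mathcal H_k\otimes\mathcal H_m$ whenever $m\nmid k$; and $(\mathcal H,\pi,W)$ is a pentagonal covariant representation of $(\mathcal O_*,\Delta_\varphi)$. (ii) Let $(y^{(n)})_{n\ge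 1}$ be another multiplicative sequence, and let $(\mathcal H',\pi')$ be formed in the same way from any GNS triples of the states $\varrho_{y^{(n)}}$. If $(y^{(n)})_{n\ge 1}\ne(z^{(n)})_{n\ge 1}$, then the representations $(\mathcal H,\pi)$ and $(\mathcal H',\pi')$ of $\mathcal O_*$ are not unitarily equivalent. -/

import Mathlib

noncomputable section

set_option linter.unusedSectionVars false

open UniformSpace

/-! ### Completion of a `*`-algebra in a C⋆-seminorm -/

section CStarCompletion

/-- A C⋆-seminorm on a complex `*`-algebra. -/
structure CStarSeminorm (F : Type*) [NonUnitalRing F] [StarRing F] [Module ℂ F] where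
  toFun : F → ℝ
  nonneg : ∀ x, 0 ≤ toFun x
  add_le : ∀ x y, toFun (x + y) ≤ toFun x + toFun y
  smul_eq : ∀ (c : ℂ) x, toFun (c • x) = ‖c‖ * toFun x
  mul_le : ∀ x y, toFun (x * y) ≤ toFun x * toFun y
  star_mul_self : ∀ x, toFun (star x * x) = toFun x * toFun x

namespace CStarSeminorm

section NonUnital

variable {F : Type*} [NonUnitalRing F] [StarRing F] [Module ℂ F]

protected lemma map_zero (p : CStarSeminorm F) : p.toFun 0 = 0 := by
  have := p.smul_eq 0 0
  simpa using this

protected lemma map_neg (p : CStarSeminorm F) (x : F) : p.toFun (-x) = p.toFun x := by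
  have := p.smul_eq (-1) x
  simpa using this

lemma le_star (p : CStarSeminorm F) (x : F) : p.toFun x ≤ p.toFun (star x) := by
  have h := p.star_mul_self x ▸ p.mul_le (star x) x
  rcases (p.nonneg x).eq_or_lt with h0 | h0
  · rw [← h0]; exact p.nonneg _
  · exact le_of_mul_le_mul_right h h0

protected lemma map_star (p : CStarSeminorm F) (x : F) : p.toFun (star x) = p.toFun x :=
  le_antisymm (by simpa using p.le_star (star x)) (p.le_star x)

/-- The `*`-algebra `F`, regarded as a seminormed algebra via `p`. -/
def Carrier (_p : CStarSeminorm F) : Type _ := F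

instance (p : CStarSeminorm F) : NonUnitalRing p.Carrier := inferInstanceAs (NonUnitalRing F)
instance (p : CStarSeminorm F) : StarRing p.Carrier := inferInstanceAs (StarRing F)
instance (p : CStarSeminorm F) : Module ℂ p.Carrier := inferInstanceAs (Module ℂ F)

instance (p : CStarSeminorm F) : Norm p.Carrier := ⟨p.toFun⟩

instance (p : CStarSeminorm F) : SeminormedAddCommGroup p.Carrier :=
  SeminormedAddCommGroup.ofCore (𝕜 := ℂ)
    { norm_nonneg := p.nonneg
      norm_smul := p.smul_eq
      norm_triangle := p.add_le }

instance (p : CStarSeminorm F) : NonUnitalSeminormedRing p.Carrier where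
  __ : SeminormedAddCommGroup p.Carrier := inferInstance
  __ : NonUnitalRing p.Carrier := inferInstance
  norm_mul_le := p.mul_le

instance (p : CStarSeminorm F) : NormedSpace ℂ p.Carrier where
  norm_smul_le c x := (p.smul_eq c x).le

instance (p : CStarSeminorm F) : NormedStarGroup p.Carrier where
  norm_star_le x := (p.map_star x).le

/-- The (separated) completion of `F` in the C⋆-seminorm `p`. -/
def Completion (p : CStarSeminorm F) : Type _ := UniformSpace.Completion p.Carrier

instance (p : CStarSeminorm F) : NormedAddCommGroup p.Completion :=
  inferInstanceAs (NormedAddCommGroup (UniformSpace.Completion p.Carrier))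
instance (p : CStarSeminorm F) : NormedSpace ℂ p.Completion :=
  inferInstanceAs (NormedSpace ℂ (UniformSpace.Completion p.Carrier))
instance (p : CStarSeminorm F) : CompleteSpace p.Completion :=
  inferInstanceAs (CompleteSpace (UniformSpace.Completion p.Carrier))

/-- The canonical map from `F` to its completion, as a linear isometry. -/
def coeₗᵢ (p : CStarSeminorm F) : p.Carrier →ₗᵢ[ℂ] p.Completion :=
  UniformSpace.Completion.toComplₗᵢ

/-- The canonical map from `F` to its completion. -/
def coe (p : CStarSeminorm F) (x : F) : p.Completion := p.coeₗᵢ x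

lemma norm_coe (p : CStarSeminorm F) (x : F) : ‖p.coe x‖ = p.toFun x := p.coeₗᵢ.norm_map x

lemma coe_add (p : CStarSeminorm F) (x y : F) : p.coe (x + y) = p.coe x + p.coe y :=
  p.coeₗᵢ.map_add x y

lemma coe_zero (p : CStarSeminorm F) : p.coe 0 = 0 := p.coeₗᵢ.map_zero

lemma coe_smul (p : CStarSeminorm F) (c : ℂ) (x : F) : p.coe (c • x) = c • p.coe x :=
  p.coeₗᵢ.map_smul c x

lemma isDenseInducing_coe (p : CStarSeminorm F) : IsDenseInducing (p.coeₗᵢ) :=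
  UniformSpace.Completion.isDenseInducing_coe

lemma denseRange_coe (p : CStarSeminorm F) : DenseRange p.coe := p.isDenseInducing_coe.dense

lemma induction_on {p : CStarSeminorm F} {P : p.Completion → Prop} (x : p.Completion)
    (hc : IsClosed {x | P x}) (h : ∀ x : F, P (p.coe x)) : P x :=
  UniformSpace.Completion.induction_on x hc h

lemma induction_on₂ {p : CStarSeminorm F} {P : p.Completion → p.Completion → Prop}
    (x y : p.Completion) (hc : IsClosed {x : p.Completion × p.Completion | P x.1 x.2})
    (h : ∀ x y : F, P (p.coe x) (p.coe y)) : P x y :=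
  UniformSpace.Completion.induction_on₂ x y hc h

lemma induction_on₃ {p : CStarSeminorm F} {P : p.Completion → p.Completion → p.Completion → Prop}
    (x y z : p.Completion)
    (hc : IsClosed {x : p.Completion × p.Completion × p.Completion | P x.1 x.2.1 x.2.2})
    (h : ∀ x y z : F, P (p.coe x) (p.coe y) (p.coe z)) : P x y z :=
  UniformSpace.Completion.induction_on₃ x y z hc h

instance (p : CStarSeminorm F) : Mul p.Completion where
  mul x y := (p.isDenseInducing_coe.prodMap p.isDenseInducing_coe).extend
    (fun q : p.Carrier × p.Carrier => p.coe (q.1 * q.2)) (x, y)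

lemma coe_mul (p : CStarSeminorm F) (x y : F) : p.coe (x * y) = p.coe x * p.coe y :=
  ((p.isDenseInducing_coe.prodMap p.isDenseInducing_coe).extend_eq
      (f := fun q : p.Carrier × p.Carrier => p.coe (q.1 * q.2))
      (p.coeₗᵢ.continuous.comp (continuous_mul (M := p.Carrier))) (x, y)).symm

instance (p : CStarSeminorm F) : ContinuousMul p.Completion where
  continuous_mul := by
    let m : p.Carrier →+ p.Carrier →+ p.Completion :=
      (AddMonoidHom.mul : p.Carrier →+ p.Carrier →+ p.Carrier).compr₂
        p.coeₗᵢ.toLinearMap.toAddMonoidHom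
    have : Continuous fun q : p.Carrier × p.Carrier => m q.1 q.2 :=
      p.coeₗᵢ.continuous.comp continuous_mul
    have di : IsDenseInducing (p.coeₗᵢ.toLinearMap.toAddMonoidHom) := p.isDenseInducing_coe
    exact (di.extend_Z_bilin di this :)

lemma norm_mul_le' (p : CStarSeminorm F) (a b : p.Completion) : ‖a * b‖ ≤ ‖a‖ * ‖b‖ :=
  by
    induction a, b using induction_on₂ with
    | hc => exact isClosed_le (by fun_prop) (by fun_prop)
    | h a b => rw [← coe_mul, norm_coe, norm_coe, norm_coe]; exact p.mul_le a b

instance (p : CStarSeminorm F) : NonUnitalNormedRing p.Completion where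
  __ : NormedAddCommGroup p.Completion := inferInstance
  __ : Mul p.Completion := inferInstance
  zero_mul a := by
    induction a using induction_on with
    | hc => exact isClosed_eq (by fun_prop) (by fun_prop)
    | h a => rw [← coe_zero, ← coe_mul, zero_mul]
  mul_zero a := by
    induction a using induction_on with
    | hc => exact isClosed_eq (by fun_prop) (by fun_prop)
    | h a => rw [← coe_zero, ← coe_mul, mul_zero]
  mul_assoc a b c := by
    induction a, b, c using induction_on₃ with
    | hc => exact isClosed_eq (by fun_prop) (by fun_prop)
    | h a b c => rw [← coe_mul, ← coe_mul, ← coe_mul, ← coe_mul, mul_assoc]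
  left_distrib a b c := by
    induction a, b, c using induction_on₃ with
    | hc => exact isClosed_eq (by fun_prop) (by fun_prop)
    | h a b c => rw [← coe_add, ← coe_mul, ← coe_mul, ← coe_mul, ← coe_add, mul_add]
  right_distrib a b c := by
    induction a, b, c using induction_on₃ with
    | hc => exact isClosed_eq (by fun_prop) (by fun_prop)
    | h a b c => rw [← coe_add, ← coe_mul, ← coe_mul, ← coe_mul, ← coe_add, add_mul]
  norm_mul_le := p.norm_mul_le'

instance (p : CStarSeminorm F) : Star p.Completion where
  star x := UniformSpace.Completion.map (star : p.Carrier → p.Carrier) x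

lemma uniformContinuous_star (p : CStarSeminorm F) :
    UniformContinuous (star : p.Carrier → p.Carrier) :=
  (starNormedAddGroupHom (E := p.Carrier)).uniformContinuous

lemma coe_star (p : CStarSeminorm F) (x : F) : p.coe (star x) = star (p.coe x) :=
  (UniformSpace.Completion.map_coe p.uniformContinuous_star x).symm

instance (p : CStarSeminorm F) : ContinuousStar p.Completion where
  continuous_star := UniformSpace.Completion.continuous_map

instance (p : CStarSeminorm F) : StarRing p.Completion where
  star_involutive a := by
    induction a using induction_on with
    | hc => exact isClosed_eq (by fun_prop) (by fun_prop)
    | h a => rw [← coe_star, ← coe_star, star_star]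
  star_mul a b := by
    induction a, b using induction_on₂ with
    | hc => exact isClosed_eq (by fun_prop) (by fun_prop)
    | h a b => rw [← coe_star, ← coe_star, ← coe_mul, ← coe_mul, ← coe_star, star_mul]
  star_add a b := by
    induction a, b using induction_on₂ with
    | hc => exact isClosed_eq (by fun_prop) (by fun_prop)
    | h a b => rw [← coe_star, ← coe_star, ← coe_add, ← coe_add, ← coe_star, star_add]

instance (p : CStarSeminorm F) : CStarRing p.Completion where
  norm_mul_self_le a := by
    induction a using induction_on with
    | hc => exact isClosed_le (by fun_prop) (by fun_prop)
    | h a => rw [← coe_star, ← coe_mul, norm_coe, norm_coe, p.star_mul_self]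

/-- The C⋆-seminorm `x ↦ sup_i ‖f_i x‖` of a pointwise bounded family of `*`-homomorphisms
`f_i` into C⋆-algebras. -/
def ofHoms {ι : Type*} {B : ι → Type*} [∀ i, NonUnitalCStarAlgebra (B i)]
    (f : ∀ i, F →⋆ₙₐ[ℂ] B i) (hf : ∀ x, ∃ C : ℝ, ∀ i, ‖f i x‖ ≤ C) : CStarSeminorm F :=
  have hb : ∀ x, BddAbove (Set.range fun i => ‖f i x‖) := fun x => by
    obtain ⟨C, hC⟩ := hf x
    exact ⟨C, by rintro _ ⟨i, rfl⟩; exact hC i⟩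
  have h0 : ∀ x, 0 ≤ ⨆ i, ‖f i x‖ := fun x => Real.iSup_nonneg fun i => norm_nonneg _
  { toFun := fun x => ⨆ i, ‖f i x‖
    nonneg := h0
    add_le := fun x y => Real.iSup_le (fun i => by
      rw [map_add]
      exact (norm_add_le _ _).trans (add_le_add (le_ciSup (hb x) i) (le_ciSup (hb y) i)))
      (add_nonneg (h0 x) (h0 y))
    smul_eq := fun c x => by
      simp_rw [map_smul, norm_smul]
      exact (Real.mul_iSup_of_nonneg (norm_nonneg c) _).symm
    mul_le := fun x y => Real.iSup_le (fun i => by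
      rw [map_mul]
      exact (norm_mul_le _ _).trans
        (mul_le_mul (le_ciSup (hb x) i) (le_ciSup (hb y) i) (norm_nonneg _) (h0 x)))
      (mul_nonneg (h0 x) (h0 y))
    star_mul_self := fun x => by
      have h : ∀ i, ‖f i (star x * x)‖ = ‖f i x‖ * ‖f i x‖ := fun i => by
        rw [map_mul, map_star, CStarRing.norm_star_mul_self]
      simp_rw [h]
      refine le_antisymm (Real.iSup_le (fun i => mul_le_mul (le_ciSup (hb x) i)
        (le_ciSup (hb x) i) (norm_nonneg _) (h0 x)) (mul_nonneg (h0 x) (h0 x))) ?_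
      have hs : 0 ≤ ⨆ i, ‖f i x‖ * ‖f i x‖ :=
        Real.iSup_nonneg fun i => mul_self_nonneg _
      have hb' : BddAbove (Set.range fun i => ‖f i x‖ * ‖f i x‖) := by
        simp_rw [← h]; exact hb _
      have hle : ⨆ i, ‖f i x‖ ≤ √(⨆ i, ‖f i x‖ * ‖f i x‖) :=
        Real.iSup_le (fun i => Real.le_sqrt_of_sq_le (by
          rw [sq]; exact le_ciSup hb' i)) (Real.sqrt_nonneg _)
      calc _ ≤ √(⨆ i, ‖f i x‖ * ‖f i x‖) * √(⨆ i, ‖f i x‖ * ‖f i x‖) :=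
            mul_le_mul hle hle (h0 x) (Real.sqrt_nonneg _)
        _ = _ := Real.mul_self_sqrt hs }

lemma le_ofHoms {ι : Type*} {B : ι → Type*} [∀ i, NonUnitalCStarAlgebra (B i)]
    (f : ∀ i, F →⋆ₙₐ[ℂ] B i) (hf : ∀ x, ∃ C : ℝ, ∀ i, ‖f i x‖ ≤ C) (i : ι) (x : F) :
    ‖f i x‖ ≤ (ofHoms f hf).toFun x := by
  obtain ⟨C, hC⟩ := hf x
  exact le_ciSup (f := fun i => ‖f i x‖) ⟨C, by rintro _ ⟨i, rfl⟩; exact hC i⟩ i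

variable [IsScalarTower ℂ F F] [SMulCommClass ℂ F F] [StarModule ℂ F]

instance (p : CStarSeminorm F) : IsScalarTower ℂ p.Completion p.Completion where
  smul_assoc c a b := by
    induction a, b using induction_on₂ with
    | hc => exact isClosed_eq ((continuous_fst.const_smul c).mul continuous_snd)
              ((continuous_fst.mul continuous_snd).const_smul c)
    | h a b =>
      rw [smul_eq_mul, smul_eq_mul, ← coe_smul, ← coe_mul, ← coe_mul, ← coe_smul, smul_mul_assoc]

instance (p : CStarSeminorm F) : SMulCommClass ℂ p.Completion p.Completion where
  smul_comm c a b := by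
    induction a, b using induction_on₂ with
    | hc => exact isClosed_eq ((continuous_fst.mul continuous_snd).const_smul c)
              (continuous_fst.mul (continuous_snd.const_smul c))
    | h a b =>
      rw [smul_eq_mul, smul_eq_mul, ← coe_smul, ← coe_mul, ← coe_mul, ← coe_smul, mul_smul_comm]

instance (p : CStarSeminorm F) : StarModule ℂ p.Completion where
  star_smul c a := by
    induction a using induction_on with
    | hc => exact isClosed_eq (continuous_id.const_smul c).star (continuous_star.const_smul (star c))
    | h a => rw [← coe_smul, ← coe_star, ← coe_star, ← coe_smul, star_smul]

instance (p : CStarSeminorm F) : NonUnitalCStarAlgebra p.Completion where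

/-- The canonical map from `F` to its completion, as a `*`-homomorphism. -/
def coeHom (p : CStarSeminorm F) : F →⋆ₙₐ[ℂ] p.Completion where
  toFun := p.coe
  map_smul' := p.coe_smul
  map_zero' := p.coe_zero
  map_add' := p.coe_add
  map_mul' := p.coe_mul
  map_star' := p.coe_star

/-- The extension by continuity to the completion of a `*`-homomorphism dominated by `p`,
as a continuous linear map. -/
def extendL (p : CStarSeminorm F) {B : Type*} [NonUnitalCStarAlgebra B] (f : F →⋆ₙₐ[ℂ] B)
    (hf : ∀ x, ‖f x‖ ≤ p.toFun x) : p.Completion →L[ℂ] B :=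
  ContinuousLinearMap.fromCompletion (α := p.Carrier) <| LinearMap.mkContinuous
    { toFun := fun x : F => f x, map_add' := fun x y => map_add f x y,
      map_smul' := fun c x => map_smul f c x } 1
    (fun x => by rw [one_mul]; exact hf x)

lemma extendL_coe (p : CStarSeminorm F) {B : Type*} [NonUnitalCStarAlgebra B] (f : F →⋆ₙₐ[ℂ] B)
    (hf : ∀ x, ‖f x‖ ≤ p.toFun x) (x : F) : p.extendL f hf (p.coe x) = f x :=
  ContinuousLinearMap.fromCompletion_apply_coe (α := p.Carrier) _ x

/-- The extension by continuity to the completion of a `*`-homomorphism dominated by `p`. -/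
def extend (p : CStarSeminorm F) {B : Type*} [NonUnitalCStarAlgebra B] (f : F →⋆ₙₐ[ℂ] B)
    (hf : ∀ x, ‖f x‖ ≤ p.toFun x) : p.Completion →⋆ₙₐ[ℂ] B where
  toFun := p.extendL f hf
  map_smul' := (p.extendL f hf).map_smul
  map_zero' := (p.extendL f hf).map_zero
  map_add' := (p.extendL f hf).map_add
  map_mul' a b := by
    induction a, b using induction_on₂ with
    | hc => exact isClosed_eq (by fun_prop) (by fun_prop)
    | h a b => rw [← coe_mul, extendL_coe, extendL_coe, extendL_coe, map_mul]
  map_star' a := by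
    induction a using induction_on with
    | hc => exact isClosed_eq (by fun_prop) (by fun_prop)
    | h a => rw [← coe_star, extendL_coe, extendL_coe, map_star]

lemma extend_coe (p : CStarSeminorm F) {B : Type*} [NonUnitalCStarAlgebra B] (f : F →⋆ₙₐ[ℂ] B)
    (hf : ∀ x, ‖f x‖ ≤ p.toFun x) (x : F) : p.extend f hf (p.coe x) = f x :=
  p.extendL_coe f hf x

end NonUnital

section Unital

variable {F : Type*} [Ring F] [StarRing F] [Algebra ℂ F] [StarModule ℂ F]

instance (p : CStarSeminorm F) : One p.Completion := ⟨p.coe 1⟩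

lemma coe_one (p : CStarSeminorm F) : p.coe 1 = 1 := rfl

instance (p : CStarSeminorm F) : NormedRing p.Completion where
  __ : NonUnitalNormedRing p.Completion := inferInstance
  one_mul a := by
    induction a using induction_on with
    | hc => exact isClosed_eq (by fun_prop) (by fun_prop)
    | h a => rw [← coe_one, ← coe_mul, one_mul]
  mul_one a := by
    induction a using induction_on with
    | hc => exact isClosed_eq (by fun_prop) (by fun_prop)
    | h a => rw [← coe_one, ← coe_mul, mul_one]

instance (p : CStarSeminorm F) : Algebra ℂ p.Completion :=
  Algebra.ofModule smul_mul_assoc mul_smul_comm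

instance (p : CStarSeminorm F) : CStarAlgebra p.Completion where
  norm_smul_le := norm_smul_le

end Unital

end CStarSeminorm

end CStarCompletion

/-! ### The Cuntz algebras -/

section Cuntz

/-- A Cuntz family of size `n` in a unital C⋆-algebra: isometries `S_1, …, S_n` with
`S_i^* S_j = δ_{ij} 1` and `∑ S_i S_i^* = 1`.  By convention the single generator is the unit when
`n = 1`, so that `𝒪_1 = ℂ`. -/
structure IsCuntzFamily {n : ℕ} {B : Type*} [CStarAlgebra B] (S : Fin n → B) : Prop where
  star_mul : ∀ i j, star (S i) * S j = if i = j then 1 else 0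
  sum_mul_star : ∑ i, S i * star (S i) = 1
  eq_one : n = 1 → ∀ i, S i = 1

lemma norm_one_le_one (B : Type*) [CStarAlgebra B] : ‖(1 : B)‖ ≤ 1 := by
  rcases subsingleton_or_nontrivial B with h | h
  · simp [Subsingleton.elim (1 : B) 0]
  · simp

lemma IsCuntzFamily.norm_le_one {n : ℕ} {B : Type*} [CStarAlgebra B] {S : Fin n → B}
    (hS : IsCuntzFamily S) (i : Fin n) : ‖S i‖ ≤ 1 := by
  have h := CStarRing.norm_star_mul_self (x := S i)
  rw [hS.star_mul, if_pos rfl] at h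
  have h1 := norm_one_le_one B
  nlinarith [norm_nonneg (S i)]

/-- The free unital `*`-algebra on `n` generators: the monoid algebra of words in the letters
`inl i` (standing for `s_i`) and `inr i` (standing for `s_i^*`). -/
def FreeStarAlg (n : ℕ) : Type := MonoidAlgebra ℂ (FreeMonoid (Fin n ⊕ Fin n))

namespace FreeStarAlg

variable {n : ℕ}

instance : Ring (FreeStarAlg n) :=
  inferInstanceAs (Ring (MonoidAlgebra ℂ (FreeMonoid (Fin n ⊕ Fin n))))

instance : Algebra ℂ (FreeStarAlg n) :=
  inferInstanceAs (Algebra ℂ (MonoidAlgebra ℂ (FreeMonoid (Fin n ⊕ Fin n))))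

/-- The element of the free `*`-algebra given by a word. -/
def word : FreeMonoid (Fin n ⊕ Fin n) →* FreeStarAlg n :=
  MonoidAlgebra.of ℂ (FreeMonoid (Fin n ⊕ Fin n))

lemma induction_on {P : FreeStarAlg n → Prop} (x : FreeStarAlg n) (word : ∀ w, P (word w))
    (add : ∀ x y, P x → P y → P (x + y)) (smul : ∀ (c : ℂ) x, P x → P (c • x)) : P x :=
  MonoidAlgebra.induction_on x word add smul

/-- Reversal of words with exchange of `s_i` and `s_i^*`. -/
def starWord : FreeMonoid (Fin n ⊕ Fin n) →* (FreeStarAlg n)ᵐᵒᵖ :=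
  FreeMonoid.lift fun a => MulOpposite.op (word (FreeMonoid.of a.swap))

lemma commute_starWord (c : ℂ) (w : FreeMonoid (Fin n ⊕ Fin n)) :
    Commute (((algebraMap ℂ (FreeStarAlg n)ᵐᵒᵖ).comp (starRingEnd ℂ)) c) (starWord w) :=
  Algebra.commutes (starRingEnd ℂ c) (starWord w)

/-- The involution of the free `*`-algebra: it conjugates the coefficients, reverses words, and
exchanges `s_i` and `s_i^*`. -/
def starHom : FreeStarAlg n →+* (FreeStarAlg n)ᵐᵒᵖ :=
  MonoidAlgebra.liftNCRingHom ((algebraMap ℂ (FreeStarAlg n)ᵐᵒᵖ).comp (starRingEnd ℂ)) starWord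
    commute_starWord

instance : Star (FreeStarAlg n) := ⟨fun x => (starHom x).unop⟩

lemma star_def (x : FreeStarAlg n) : star x = (starHom x).unop := rfl

lemma starHom_single (c : ℂ) (w : FreeMonoid (Fin n ⊕ Fin n)) :
    starHom (n := n) (MonoidAlgebra.single w c) =
      algebraMap ℂ (FreeStarAlg n)ᵐᵒᵖ (starRingEnd ℂ c) * starWord w :=
  MonoidAlgebra.liftNCRingHom_single _ _ commute_starWord _ _

lemma starHom_smul (c : ℂ) (x : FreeStarAlg n) :
    starHom (c • x) = (starRingEnd ℂ c) • starHom x := by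
  have h : starHom (algebraMap ℂ (FreeStarAlg n) c) =
      algebraMap ℂ (FreeStarAlg n)ᵐᵒᵖ (starRingEnd ℂ c) := by
    have := starHom_single (n := n) c 1
    rwa [map_one, mul_one] at this
  rw [Algebra.smul_def, map_mul, h, ← Algebra.smul_def]

lemma starHom_word (w : FreeMonoid (Fin n ⊕ Fin n)) : starHom (word w) = starWord w := by
  have := starHom_single (n := n) 1 w
  rwa [map_one, map_one, one_mul] at this

lemma star_smul' (c : ℂ) (x : FreeStarAlg n) : star (c • x) = star c • star x := by
  rw [star_def, starHom_smul, MulOpposite.unop_smul]; rfl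

lemma star_mul' (x y : FreeStarAlg n) : star (x * y) = star y * star x := by
  rw [star_def, map_mul, MulOpposite.unop_mul]; rfl

lemma star_add' (x y : FreeStarAlg n) : star (x + y) = star x + star y := by
  rw [star_def, map_add, MulOpposite.unop_add]; rfl

lemma star_word_of (a : Fin n ⊕ Fin n) :
    star (word (FreeMonoid.of a)) = word (FreeMonoid.of a.swap) := by
  rw [star_def, starHom_word, starWord, FreeMonoid.lift_eval_of, MulOpposite.unop_op]

lemma star_one' : star (1 : FreeStarAlg n) = 1 := by
  rw [star_def, map_one, MulOpposite.unop_one]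

instance : StarRing (FreeStarAlg n) where
  star_involutive x := by
    induction x using induction_on with
    | word w =>
      induction w using FreeMonoid.inductionOn' with
      | one => rw [map_one, star_one', star_one']
      | of_mul a w ih =>
        rw [map_mul, star_mul', star_mul', ih, star_word_of, star_word_of, Sum.swap_swap]
    | add x y hx hy => rw [star_add', star_add', hx, hy]
    | smul c x hx => rw [star_smul', star_smul', hx, star_star]
  star_mul := star_mul'
  star_add := star_add'

instance : StarModule ℂ (FreeStarAlg n) where
  star_smul := star_smul'

/-- Evaluation of a `*`-polynomial at a tuple `S` in a unital C⋆-algebra, as an algebra map. -/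
def evalAlgHom {B : Type*} [CStarAlgebra B] (S : Fin n → B) : FreeStarAlg n →ₐ[ℂ] B :=
  MonoidAlgebra.lift ℂ B (FreeMonoid (Fin n ⊕ Fin n))
    (FreeMonoid.lift (Sum.elim S fun i => star (S i)))

lemma evalAlgHom_word {B : Type*} [CStarAlgebra B] (S : Fin n → B)
    (w : FreeMonoid (Fin n ⊕ Fin n)) :
    evalAlgHom S (word w) = FreeMonoid.lift (Sum.elim S fun i => star (S i)) w :=
  MonoidAlgebra.lift_of _ _

/-- Evaluation of a `*`-polynomial at a tuple `S` in a unital C⋆-algebra. -/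
def eval {B : Type*} [CStarAlgebra B] (S : Fin n → B) : FreeStarAlg n →⋆ₐ[ℂ] B where
  __ := evalAlgHom S
  map_star' x := by
    change evalAlgHom S (star x) = star (evalAlgHom S x)
    induction x using induction_on with
    | word w =>
      induction w using FreeMonoid.inductionOn' with
      | one => rw [map_one, star_one, map_one, star_one]
      | of_mul a w ih =>
        rw [map_mul, star_mul, map_mul, map_mul, star_mul, ih, star_word_of,
          evalAlgHom_word S (FreeMonoid.of a.swap), evalAlgHom_word S (FreeMonoid.of a),
          FreeMonoid.lift_eval_of, FreeMonoid.lift_eval_of]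
        cases a <;> simp
    | add x y hx hy => rw [star_add, map_add, map_add, hx, hy, star_add]
    | smul c x hx => rw [star_smul, map_smul, map_smul, hx, star_smul]

lemma eval_word {B : Type*} [CStarAlgebra B] (S : Fin n → B) (w : FreeMonoid (Fin n ⊕ Fin n)) :
    eval S (word w) = FreeMonoid.lift (Sum.elim S fun i => star (S i)) w :=
  evalAlgHom_word S w

end FreeStarAlg

/-- A unital C⋆-algebra together with a Cuntz family of size `n` in it. -/
structure CuntzModel (n : ℕ) where
  B : Type
  [inst : CStarAlgebra B]
  S : Fin n → B
  isCuntzFamily : IsCuntzFamily S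

attribute [instance] CuntzModel.inst

lemma cuntz_bound (n : ℕ) (x : FreeStarAlg n) :
    ∃ C : ℝ, ∀ M : CuntzModel n, ‖FreeStarAlg.eval M.S x‖ ≤ C := by
  induction x using FreeStarAlg.induction_on with
  | word w =>
    refine ⟨1, fun M => ?_⟩
    induction w using FreeMonoid.inductionOn' with
    | one => rw [map_one, map_one]; exact norm_one_le_one _
    | of_mul a w ih =>
      rw [map_mul, map_mul]
      refine (norm_mul_le _ _).trans (mul_le_one₀ ?_ (norm_nonneg _) ih)
      rw [FreeStarAlg.eval_word, FreeMonoid.lift_eval_of]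
      cases a with
      | inl i => exact M.isCuntzFamily.norm_le_one i
      | inr i => exact (norm_star _).trans_le (M.isCuntzFamily.norm_le_one i)
  | add x y hx hy =>
    obtain ⟨C, hC⟩ := hx
    obtain ⟨D, hD⟩ := hy
    exact ⟨C + D, fun M => by
      rw [map_add]; exact (norm_add_le _ _).trans (add_le_add (hC M) (hD M))⟩
  | smul c x hx =>
    obtain ⟨C, hC⟩ := hx
    exact ⟨‖c‖ * C, fun M => by
      rw [map_smul, norm_smul]; exact mul_le_mul_of_nonneg_left (hC M) (norm_nonneg _)⟩

/-- The largest C⋆-seminorm on the free `*`-algebra which comes from Cuntz families. -/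
def cuntzSeminorm (n : ℕ) : CStarSeminorm (FreeStarAlg n) :=
  CStarSeminorm.ofHoms
    (fun M : CuntzModel n => (FreeStarAlg.eval M.S : FreeStarAlg n →⋆ₙₐ[ℂ] M.B)) (cuntz_bound n)

/-- The Cuntz algebra `𝒪_n`, the universal unital C⋆-algebra generated by a Cuntz family of
size `n`; moreover `𝒪_1 = ℂ`. -/
def CuntzAlg (n : ℕ) : Type := (cuntzSeminorm n).Completion

instance (n : ℕ) : CStarAlgebra (CuntzAlg n) :=
  inferInstanceAs (CStarAlgebra (cuntzSeminorm n).Completion)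

namespace CuntzAlg

variable {n : ℕ}

/-- The canonical map from `*`-polynomials in the generators to `𝒪_n`. -/
def ofFree (n : ℕ) (x : FreeStarAlg n) : CuntzAlg n := (cuntzSeminorm n).coe x

/-- The canonical generators of `𝒪_n`. -/
def s (i : Fin n) : CuntzAlg n := ofFree n (FreeStarAlg.word (FreeMonoid.of (Sum.inl i)))

lemma norm_eval_le {B : Type} [CStarAlgebra B] (S : Fin n → B) (hS : IsCuntzFamily S)
    (x : FreeStarAlg n) :
    ‖(FreeStarAlg.eval S : FreeStarAlg n →⋆ₙₐ[ℂ] B) x‖ ≤ (cuntzSeminorm n).toFun x :=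
  CStarSeminorm.le_ofHoms
    (fun M : CuntzModel n => (FreeStarAlg.eval M.S : FreeStarAlg n →⋆ₙₐ[ℂ] M.B))
    (cuntz_bound n) (CuntzModel.mk B S hS) x

/-- The universal property of `𝒪_n`, as a homomorphism of non-unital `*`-algebras. -/
def liftₙ {B : Type} [CStarAlgebra B] (S : Fin n → B) (hS : IsCuntzFamily S) :
    CuntzAlg n →⋆ₙₐ[ℂ] B :=
  (cuntzSeminorm n).extend (FreeStarAlg.eval S : FreeStarAlg n →⋆ₙₐ[ℂ] B) (norm_eval_le S hS)

lemma liftₙ_ofFree {B : Type} [CStarAlgebra B] (S : Fin n → B) (hS : IsCuntzFamily S)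
    (x : FreeStarAlg n) : liftₙ S hS (ofFree n x) = FreeStarAlg.eval S x :=
  (cuntzSeminorm n).extend_coe (FreeStarAlg.eval S : FreeStarAlg n →⋆ₙₐ[ℂ] B) _ x

lemma liftₙ_one {B : Type} [CStarAlgebra B] (S : Fin n → B) (hS : IsCuntzFamily S) :
    liftₙ S hS 1 = 1 :=
  (liftₙ_ofFree S hS 1).trans (map_one (FreeStarAlg.eval S))

/-- The universal property of `𝒪_n`: a Cuntz family `S` in `B` gives a unital
`*`-homomorphism `𝒪_n → B` which maps the generators to `S`. -/
def lift {B : Type} [CStarAlgebra B] (S : Fin n → B) (hS : IsCuntzFamily S) :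
    CuntzAlg n →⋆ₐ[ℂ] B where
  toFun := liftₙ S hS
  map_one' := liftₙ_one S hS
  map_mul' := map_mul _
  map_zero' := map_zero _
  map_add' := map_add _
  commutes' c := by
    rw [Algebra.algebraMap_eq_smul_one, Algebra.algebraMap_eq_smul_one, map_smul, liftₙ_one]
  map_star' := map_star _

lemma lift_s {B : Type} [CStarAlgebra B] (S : Fin n → B) (hS : IsCuntzFamily S) (i : Fin n) :
    lift S hS (s i) = S i :=
  (liftₙ_ofFree S hS _).trans <|
    (FreeStarAlg.eval_word S _).trans <| FreeMonoid.lift_eval_of _ _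

lemma ofFree_add (x y : FreeStarAlg n) : ofFree n (x + y) = ofFree n x + ofFree n y :=
  (cuntzSeminorm n).coe_add x y

lemma ofFree_mul (x y : FreeStarAlg n) : ofFree n (x * y) = ofFree n x * ofFree n y :=
  (cuntzSeminorm n).coe_mul x y

lemma ofFree_star (x : FreeStarAlg n) : ofFree n (star x) = star (ofFree n x) :=
  (cuntzSeminorm n).coe_star x

lemma ofFree_one : ofFree n 1 = 1 := rfl

lemma ofFree_zero : ofFree n 0 = 0 := (cuntzSeminorm n).coe_zero

lemma denseRange_ofFree : DenseRange (ofFree n) := (cuntzSeminorm n).denseRange_coe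

/-- A `*`-polynomial relation which holds for all Cuntz families holds in `𝒪_n`. -/
lemma ofFree_eq {x y : FreeStarAlg n}
    (h : ∀ M : CuntzModel n, FreeStarAlg.eval M.S x = FreeStarAlg.eval M.S y) :
    ofFree n x = ofFree n y := by
  have h0 : ‖ofFree n (x - y)‖ = 0 := by
    refine ((cuntzSeminorm n).norm_coe _).trans ?_
    refine le_antisymm (Real.iSup_le (fun M => ?_) le_rfl) ((cuntzSeminorm n).nonneg _)
    refine (congrArg norm (?_ : FreeStarAlg.eval M.S (x - y) = 0)).trans_le (by simp)
    rw [map_sub, h, sub_self]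
  have h1 : ofFree n x = ofFree n (x - y) + ofFree n y := by rw [← ofFree_add, sub_add_cancel]
  rw [h1, norm_eq_zero.mp h0, zero_add]

/-- The generators of `𝒪_n` form a Cuntz family. -/
lemma isCuntzFamily_s (n : ℕ) : IsCuntzFamily (s : Fin n → CuntzAlg n) where
  star_mul i j := by
    have h : ofFree n (star (FreeStarAlg.word (FreeMonoid.of (Sum.inl i))) *
        FreeStarAlg.word (FreeMonoid.of (Sum.inl j))) = ofFree n (if i = j then 1 else 0) := by
      refine ofFree_eq fun M => ?_
      rw [map_mul, map_star, FreeStarAlg.eval_word, FreeStarAlg.eval_word,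
        FreeMonoid.lift_eval_of, FreeMonoid.lift_eval_of]
      refine (M.isCuntzFamily.star_mul i j).trans ?_
      split_ifs
      · exact (map_one _).symm
      · exact (map_zero _).symm
    rw [ofFree_mul, ofFree_star] at h
    refine h.trans ?_
    split_ifs
    · exact ofFree_one
    · exact ofFree_zero
  sum_mul_star := by
    have h : ofFree n (∑ i, FreeStarAlg.word (FreeMonoid.of (Sum.inl i)) *
        star (FreeStarAlg.word (FreeMonoid.of (Sum.inl i)))) = ofFree n 1 := by
      refine ofFree_eq fun M => ?_
      rw [map_sum, map_one]
      refine (Finset.sum_congr rfl fun i _ => ?_).trans M.isCuntzFamily.sum_mul_star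
      rw [map_mul, map_star, FreeStarAlg.eval_word, FreeMonoid.lift_eval_of]
      rfl
    have hs : ∀ (t : Finset (Fin n)) (f : Fin n → FreeStarAlg n),
        ofFree n (∑ i ∈ t, f i) = ∑ i ∈ t, ofFree n (f i) := fun t f =>
      map_sum (AddMonoidHom.mk' (ofFree n) ofFree_add) f t
    rw [hs] at h
    refine (Finset.sum_congr rfl fun i _ => ?_).trans (h.trans ofFree_one)
    rw [ofFree_mul, ofFree_star]; rfl
  eq_one hn i := by
    refine (ofFree_eq fun M => ?_).trans ofFree_one
    rw [FreeStarAlg.eval_word, FreeMonoid.lift_eval_of, map_one]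
    exact M.isCuntzFamily.eq_one hn i

end CuntzAlg

end Cuntz

/-! ### Hilbert space tensor products -/

section HilbertTensor

open scoped TensorProduct

/-- The Hilbert space tensor product: the completion of the algebraic tensor product with its
inner product `⟪x ⊗ y, x' ⊗ y'⟫ = ⟪x, x'⟫ ⟪y, y'⟫`. -/
def HTensor (H K : Type*) [NormedAddCommGroup H] [InnerProductSpace ℂ H]
    [NormedAddCommGroup K] [InnerProductSpace ℂ K] : Type _ :=
  UniformSpace.Completion (H ⊗[ℂ] K)

instance (H K : Type*) [NormedAddCommGroup H] [InnerProductSpace ℂ H]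
    [NormedAddCommGroup K] [InnerProductSpace ℂ K] : NormedAddCommGroup (HTensor H K) :=
  inferInstanceAs (NormedAddCommGroup (UniformSpace.Completion (H ⊗[ℂ] K)))

instance (H K : Type*) [NormedAddCommGroup H] [InnerProductSpace ℂ H]
    [NormedAddCommGroup K] [InnerProductSpace ℂ K] : InnerProductSpace ℂ (HTensor H K) :=
  inferInstanceAs (InnerProductSpace ℂ (UniformSpace.Completion (H ⊗[ℂ] K)))

instance (H K : Type*) [NormedAddCommGroup H] [InnerProductSpace ℂ H]
    [NormedAddCommGroup K] [InnerProductSpace ℂ K] : CompleteSpace (HTensor H K) :=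
  inferInstanceAs (CompleteSpace (UniformSpace.Completion (H ⊗[ℂ] K)))

namespace HTensor

variable {E F G H K L : Type*}
  [NormedAddCommGroup E] [InnerProductSpace ℂ E] [NormedAddCommGroup F] [InnerProductSpace ℂ F]
  [NormedAddCommGroup G] [InnerProductSpace ℂ G] [NormedAddCommGroup H] [InnerProductSpace ℂ H]
  [NormedAddCommGroup K] [InnerProductSpace ℂ K] [NormedAddCommGroup L] [InnerProductSpace ℂ L]

/-- The canonical embedding of the algebraic tensor product. -/
def ofAlg : H ⊗[ℂ] K →ₗᵢ[ℂ] HTensor H K :=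
  UniformSpace.Completion.toComplₗᵢ

lemma denseRange_ofAlg : DenseRange (ofAlg : H ⊗[ℂ] K →ₗᵢ[ℂ] HTensor H K) :=
  UniformSpace.Completion.denseRange_coe

lemma induction_on {P : HTensor H K → Prop} (x : HTensor H K) (hc : IsClosed {x | P x})
    (h : ∀ x : H ⊗[ℂ] K, P (ofAlg x)) : P x :=
  UniformSpace.Completion.induction_on x hc h

lemma induction_on₂ {P : HTensor H K → HTensor E F → Prop} (x : HTensor H K) (y : HTensor E F)
    (hc : IsClosed {x : HTensor H K × HTensor E F | P x.1 x.2})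
    (h : ∀ (x : H ⊗[ℂ] K) (y : E ⊗[ℂ] F), P (ofAlg x) (ofAlg y)) : P x y :=
  UniformSpace.Completion.induction_on₂ x y hc h

/-- The elementary tensor `x ⊗ y`. -/
def tmul (x : H) (y : K) : HTensor H K := ofAlg (x ⊗ₜ[ℂ] y)

/-- The tensor product `S ⊗ T` of bounded operators. -/
def map (S : E →L[ℂ] G) (T : F →L[ℂ] H) : HTensor E F →L[ℂ] HTensor G H :=
  (TensorProduct.mapL S T).completion

lemma map_ofAlg (S : E →L[ℂ] G) (T : F →L[ℂ] H) (x : E ⊗[ℂ] F) :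
    map S T (ofAlg x) = ofAlg (TensorProduct.mapL S T x) :=
  ContinuousLinearMap.completion_apply_coe _ _

@[simp] lemma map_tmul (S : E →L[ℂ] G) (T : F →L[ℂ] H) (x : E) (y : F) :
    map S T (tmul x y) = tmul (S x) (T y) := by
  rw [tmul, map_ofAlg, TensorProduct.mapL_tmul, tmul]

lemma add_tmul (x x' : E) (y : F) : tmul (x + x') y = tmul x y + tmul x' y := by
  rw [tmul, TensorProduct.add_tmul, _root_.map_add, tmul, tmul]

lemma tmul_add (x : E) (y y' : F) : tmul x (y + y') = tmul x y + tmul x y' := by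
  rw [tmul, TensorProduct.tmul_add, _root_.map_add, tmul, tmul]

lemma smul_tmul (c : ℂ) (x : E) (y : F) : tmul (c • x) y = c • tmul x y := by
  rw [tmul, ← TensorProduct.smul_tmul', LinearIsometry.map_smul, tmul]

lemma tmul_smul (c : ℂ) (x : E) (y : F) : tmul x (c • y) = c • tmul x y := by
  rw [tmul, TensorProduct.tmul_smul, LinearIsometry.map_smul, tmul]

/-- Bounded operators on a Hilbert tensor product agree if they agree on elementary tensors. -/
lemma ext {V : Type*} [NormedAddCommGroup V] [NormedSpace ℂ V] {S T : HTensor E F →L[ℂ] V}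
    (h : ∀ x y, S (tmul x y) = T (tmul x y)) : S = T := by
  ext x
  induction x using induction_on with
  | hc => exact isClosed_eq S.continuous T.continuous
  | h x =>
    induction x using TensorProduct.induction_on with
    | zero => rw [LinearIsometry.map_zero, map_zero, map_zero]
    | tmul x y => exact h x y
    | add x y hx hy => rw [LinearIsometry.map_add, map_add, map_add, hx, hy]

lemma inner_tmul (x x' : E) (y y' : F) :
    inner ℂ (tmul x y) (tmul x' y') = inner ℂ x x' * inner ℂ y y' := by
  rw [tmul, tmul, LinearIsometry.inner_map_map, TensorProduct.inner_tmul]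

lemma norm_map_le (S : E →L[ℂ] G) (T : F →L[ℂ] H) : ‖map S T‖ ≤ ‖S‖ * ‖T‖ := by
  refine ContinuousLinearMap.opNorm_le_bound _ (by positivity) fun x => ?_
  induction x using induction_on with
  | hc => exact isClosed_le (map S T).continuous.norm (continuous_const.mul continuous_norm)
  | h x =>
    rw [map_ofAlg, LinearIsometry.norm_map, LinearIsometry.norm_map]
    exact (ContinuousLinearMap.le_opNorm _ _).trans
      (mul_le_mul_of_nonneg_right (TensorProduct.norm_mapL_le S T) (norm_nonneg _))

lemma map_mul_map (S S' : E →L[ℂ] E) (T T' : F →L[ℂ] F) :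
    map (S * S') (T * T') = map S T * map S' T' :=
  ext fun x y => by
    rw [mul_apply_eq_comp, map_tmul, map_tmul, map_tmul]; rfl

lemma map_one_one : map (1 : E →L[ℂ] E) (1 : F →L[ℂ] F) = 1 :=
  ext fun x y => by rw [map_tmul]; rfl

lemma map_star_star [CompleteSpace E] [CompleteSpace F] (S : E →L[ℂ] E) (T : F →L[ℂ] F) :
    map (star S) (star T) = star (map S T) := by
  rw [ContinuousLinearMap.star_eq_adjoint (map S T), ContinuousLinearMap.eq_adjoint_iff]
  have key : ∀ (x y : E ⊗[ℂ] F), inner ℂ (map (star S) (star T) (ofAlg x)) (ofAlg y) = inner ℂ (ofAlg x) (map S T (ofAlg y)) := by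
    intro x y
    induction x using TensorProduct.induction_on with
    | zero =>
      rw [LinearIsometry.map_zero, map_zero, inner_zero_left, inner_zero_left]
    | add x x' hx hx' =>
      rw [LinearIsometry.map_add, map_add, inner_add_left, inner_add_left, hx, hx']
    | tmul a b =>
      induction y using TensorProduct.induction_on with
      | zero =>
        rw [LinearIsometry.map_zero, map_zero, inner_zero_right, inner_zero_right]
      | add y y' hy hy' =>
        rw [LinearIsometry.map_add, map_add, inner_add_right, inner_add_right, hy, hy']
      | tmul c d =>
        change inner ℂ (map (star S) (star T) (tmul a b)) (tmul c d) =
          inner ℂ (tmul a b) (map S T (tmul c d))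
        rw [map_tmul, map_tmul, inner_tmul, inner_tmul, ContinuousLinearMap.star_eq_adjoint,
          ContinuousLinearMap.star_eq_adjoint, ContinuousLinearMap.adjoint_inner_left,
          ContinuousLinearMap.adjoint_inner_left]
  intro x y
  induction x, y using induction_on₂ with
  | hc =>
    exact isClosed_eq (((map (star S) (star T)).continuous.comp continuous_fst).inner
      continuous_snd) (continuous_fst.inner ((map S T).continuous.comp continuous_snd))
  | h x y => exact key x y

/-- A linear isometry with dense range extends to a unitary between the completions. -/
def unitaryOfDense (f : E →ₗᵢ[ℂ] F) (hf : DenseRange f) :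
    UniformSpace.Completion E ≃ₗᵢ[ℂ] UniformSpace.Completion F :=
  let g : UniformSpace.Completion E →ₗᵢ[ℂ] UniformSpace.Completion F :=
    { toLinearMap := f.toContinuousLinearMap.completion.toLinearMap
      norm_map' := fun x => by
        induction x using UniformSpace.Completion.induction_on with
        | hp =>
          exact isClosed_eq f.toContinuousLinearMap.completion.continuous.norm continuous_norm
        | ih x =>
          refine (congrArg norm
            (f.toContinuousLinearMap.completion_apply_coe x)).trans ?_
          rw [UniformSpace.Completion.norm_coe, UniformSpace.Completion.norm_coe]
          exact f.norm_map x }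
  LinearIsometryEquiv.ofSurjective g <| by
    have hc : IsClosed (Set.range g) := g.isometry.isClosedEmbedding.isClosed_range
    have hd : DenseRange g := by
      have h1 : DenseRange fun x : E => ((f x : F) : UniformSpace.Completion F) :=
        UniformSpace.Completion.denseRange_coe.comp hf
          (UniformSpace.Completion.continuous_coe F)
      refine h1.mono ?_
      rintro _ ⟨x, rfl⟩
      exact ⟨(x : UniformSpace.Completion E), f.toContinuousLinearMap.completion_apply_coe x⟩
    exact Set.range_eq_univ.mp (hc.closure_eq ▸ hd.closure_range)

lemma unitaryOfDense_coe (f : E →ₗᵢ[ℂ] F) (hf : DenseRange f) (x : E) :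
    unitaryOfDense f hf (x : UniformSpace.Completion E) =
      ((f x : F) : UniformSpace.Completion F) :=
  f.toContinuousLinearMap.completion_apply_coe x

/-- The flip unitary `x ⊗ y ↦ y ⊗ x`. -/
def flip (H K : Type*) [NormedAddCommGroup H] [InnerProductSpace ℂ H]
    [NormedAddCommGroup K] [InnerProductSpace ℂ K] : HTensor H K ≃ₗᵢ[ℂ] HTensor K H :=
  unitaryOfDense (TensorProduct.commIsometry ℂ H K).toLinearIsometry
    (TensorProduct.commIsometry ℂ H K).surjective.denseRange

@[simp] lemma flip_tmul (x : H) (y : K) : flip H K (tmul x y) = tmul y x :=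
  unitaryOfDense_coe _ _ _

lemma denseRange_tensor (f : E →ₗᵢ[ℂ] F) (hf : DenseRange f) (g : G →ₗᵢ[ℂ] H)
    (hg : DenseRange g) : DenseRange (TensorProduct.mapIsometry f g) := by
  have hsub : closure (Set.range (TensorProduct.mapIsometry f g)) =
      ((LinearMap.range (TensorProduct.mapIsometry f g).toLinearMap).topologicalClosure : Set _) :=
    rfl
  intro x
  rw [hsub, SetLike.mem_coe]
  induction x using TensorProduct.induction_on with
  | zero => exact zero_mem _
  | add x y hx hy => exact add_mem hx hy
  | tmul a b =>
    refine map_mem_closure (f := fun p : F × H => p.1 ⊗ₜ[ℂ] p.2)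
      TensorProduct.continuous_tmul ((hf.prodMap hg) (a, b)) ?_
    rintro _ ⟨⟨x, y⟩, rfl⟩
    exact ⟨x ⊗ₜ y, TensorProduct.mapIsometry_apply _ _ _⟩

/-- The unitary `f ⊗ g` for isometries `f` and `g` with dense range. -/
def unitaryTensor (f : E →ₗᵢ[ℂ] F) (hf : DenseRange f) (g : G →ₗᵢ[ℂ] H) (hg : DenseRange g) :
    HTensor E G ≃ₗᵢ[ℂ] HTensor F H :=
  unitaryOfDense (TensorProduct.mapIsometry f g) (denseRange_tensor f hf g hg)

lemma unitaryTensor_tmul (f : E →ₗᵢ[ℂ] F) (hf : DenseRange f) (g : G →ₗᵢ[ℂ] H)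
    (hg : DenseRange g) (x : E) (y : G) :
    unitaryTensor f hf g hg (tmul x y) = tmul (f x) (g y) :=
  unitaryOfDense_coe _ _ _

lemma denseRange_toCompl (E : Type*) [NormedAddCommGroup E] [InnerProductSpace ℂ E] :
    DenseRange (UniformSpace.Completion.toComplₗᵢ : E →ₗᵢ[ℂ] UniformSpace.Completion E) :=
  UniformSpace.Completion.denseRange_coe

lemma denseRange_idₗᵢ (E : Type*) [NormedAddCommGroup E] [InnerProductSpace ℂ E] :
    DenseRange (LinearIsometry.id : E →ₗᵢ[ℂ] E) :=
  Function.surjective_id.denseRange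

/-- The associativity unitary `(x ⊗ y) ⊗ z ↦ x ⊗ (y ⊗ z)`. -/
def assoc (H K L : Type*) [NormedAddCommGroup H] [InnerProductSpace ℂ H]
    [NormedAddCommGroup K] [InnerProductSpace ℂ K] [NormedAddCommGroup L]
    [InnerProductSpace ℂ L] : HTensor (HTensor H K) L ≃ₗᵢ[ℂ] HTensor H (HTensor K L) :=
  ((unitaryTensor _ (denseRange_toCompl (H ⊗[ℂ] K)) _ (denseRange_idₗᵢ L)).symm.trans
    (unitaryOfDense (TensorProduct.assocIsometry ℂ H K L).toLinearIsometry
      (TensorProduct.assocIsometry ℂ H K L).surjective.denseRange)).trans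
    (unitaryTensor _ (denseRange_idₗᵢ H) _ (denseRange_toCompl (K ⊗[ℂ] L)))

@[simp] lemma assoc_tmul (x : H) (y : K) (z : L) :
    assoc H K L (tmul (tmul x y) z) = tmul x (tmul y z) := by
  have h1 : (unitaryTensor _ (denseRange_toCompl (H ⊗[ℂ] K)) _ (denseRange_idₗᵢ L)).symm
      (tmul (tmul x y) z) = tmul (x ⊗ₜ[ℂ] y) z := by
    rw [LinearIsometryEquiv.symm_apply_eq]
    exact (unitaryTensor_tmul _ (denseRange_toCompl (H ⊗[ℂ] K)) _ (denseRange_idₗᵢ L)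
      (x ⊗ₜ[ℂ] y) z).symm
  have h2 : unitaryOfDense (TensorProduct.assocIsometry ℂ H K L).toLinearIsometry
      (TensorProduct.assocIsometry ℂ H K L).surjective.denseRange (tmul (x ⊗ₜ[ℂ] y) z) =
      tmul x (y ⊗ₜ[ℂ] z) :=
    unitaryOfDense_coe _ _ _
  refine (congrArg (unitaryTensor _ (denseRange_idₗᵢ H) _ (denseRange_toCompl (K ⊗[ℂ] L)))
    ((congrArg _ h1).trans h2)).trans ?_
  exact unitaryTensor_tmul _ _ _ _ _ _

end HTensor

end HilbertTensor

/-! ### The minimal C⋆-tensor product -/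

section MinTensor

open scoped TensorProduct

section Algebraic

variable {A B C D : Type*} [NonUnitalCStarAlgebra A] [NonUnitalCStarAlgebra B]
  [NonUnitalCStarAlgebra C] [NonUnitalCStarAlgebra D]
  {H K : Type*} [NormedAddCommGroup H] [InnerProductSpace ℂ H] [CompleteSpace H]
  [NormedAddCommGroup K] [InnerProductSpace ℂ K] [CompleteSpace K]

/-- The linear map `x ⊗ y ↦ π x ⊗ σ y`. -/
def algTensorRepLin (π : A →⋆ₙₐ[ℂ] (H →L[ℂ] H)) (σ : B →⋆ₙₐ[ℂ] (K →L[ℂ] K)) :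
    A ⊗[ℂ] B →ₗ[ℂ] (HTensor H K →L[ℂ] HTensor H K) :=
  TensorProduct.lift <| LinearMap.mk₂ ℂ (fun a b => HTensor.map (π a) (σ b))
    (fun a a' b => HTensor.ext fun x y => by
      simp [HTensor.add_tmul])
    (fun c a b => HTensor.ext fun x y => by
      simp [HTensor.smul_tmul])
    (fun a b b' => HTensor.ext fun x y => by
      simp [HTensor.tmul_add])
    (fun c a b => HTensor.ext fun x y => by
      simp [HTensor.tmul_smul])

lemma algTensorRepLin_tmul (π : A →⋆ₙₐ[ℂ] (H →L[ℂ] H)) (σ : B →⋆ₙₐ[ℂ] (K →L[ℂ] K)) (a : A)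
    (b : B) : algTensorRepLin π σ (a ⊗ₜ b) = HTensor.map (π a) (σ b) :=
  TensorProduct.lift.tmul _ _

/-- The tensor product `x ⊗ y ↦ π x ⊗ σ y` of `*`-representations, on the algebraic tensor
product of the algebras. -/
def algTensorRep (π : A →⋆ₙₐ[ℂ] (H →L[ℂ] H)) (σ : B →⋆ₙₐ[ℂ] (K →L[ℂ] K)) :
    A ⊗[ℂ] B →⋆ₙₐ[ℂ] (HTensor H K →L[ℂ] HTensor H K) where
  __ := algTensorRepLin π σ
  map_zero' := map_zero (algTensorRepLin π σ)
  map_mul' x y := by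
    change algTensorRepLin π σ (x * y) = algTensorRepLin π σ x * algTensorRepLin π σ y
    induction x using TensorProduct.induction_on with
    | zero => rw [zero_mul, map_zero, zero_mul]
    | add x x' hx hx' => rw [add_mul, map_add, map_add, hx, hx', add_mul]
    | tmul a b =>
      induction y using TensorProduct.induction_on with
      | zero => rw [mul_zero, map_zero, mul_zero]
      | add y y' hy hy' => rw [mul_add, map_add, map_add, hy, hy', mul_add]
      | tmul c d =>
        rw [Algebra.TensorProduct.tmul_mul_tmul, algTensorRepLin_tmul, algTensorRepLin_tmul,
          algTensorRepLin_tmul, map_mul, map_mul, HTensor.map_mul_map]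
  map_star' x := by
    change algTensorRepLin π σ (star x) = star (algTensorRepLin π σ x)
    induction x using TensorProduct.induction_on with
    | zero => rw [star_zero, map_zero, star_zero]
    | add x x' hx hx' => rw [star_add, map_add, map_add, hx, hx', star_add]
    | tmul a b =>
      rw [TensorProduct.star_tmul, algTensorRepLin_tmul, algTensorRepLin_tmul, map_star, map_star,
        HTensor.map_star_star]

lemma algTensorRep_tmul (π : A →⋆ₙₐ[ℂ] (H →L[ℂ] H)) (σ : B →⋆ₙₐ[ℂ] (K →L[ℂ] K)) (a : A)
    (b : B) : algTensorRep π σ (a ⊗ₜ b) = HTensor.map (π a) (σ b) :=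
  algTensorRepLin_tmul π σ a b

/-- The `*`-homomorphism `f ⊗ g` of algebraic tensor products. -/
def algTensorMap (f : A →⋆ₙₐ[ℂ] C) (g : B →⋆ₙₐ[ℂ] D) : A ⊗[ℂ] B →⋆ₙₐ[ℂ] C ⊗[ℂ] D where
  __ := TensorProduct.map (f : A →ₗ[ℂ] C) (g : B →ₗ[ℂ] D)
  map_zero' := map_zero (TensorProduct.map (f : A →ₗ[ℂ] C) (g : B →ₗ[ℂ] D))
  map_mul' x y := by
    change TensorProduct.map (f : A →ₗ[ℂ] C) (g : B →ₗ[ℂ] D) (x * y) =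
      TensorProduct.map (f : A →ₗ[ℂ] C) (g : B →ₗ[ℂ] D) x *
        TensorProduct.map (f : A →ₗ[ℂ] C) (g : B →ₗ[ℂ] D) y
    induction x using TensorProduct.induction_on with
    | zero => rw [zero_mul, map_zero, zero_mul]
    | add x x' hx hx' => rw [add_mul, map_add, map_add, hx, hx', add_mul]
    | tmul a b =>
      induction y using TensorProduct.induction_on with
      | zero => rw [mul_zero, map_zero, mul_zero]
      | add y y' hy hy' => rw [mul_add, map_add, map_add, hy, hy', mul_add]
      | tmul c d => simp
  map_star' x := by
    change TensorProduct.map (f : A →ₗ[ℂ] C) (g : B →ₗ[ℂ] D) (star x) =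
      star (TensorProduct.map (f : A →ₗ[ℂ] C) (g : B →ₗ[ℂ] D) x)
    induction x using TensorProduct.induction_on with
    | zero => rw [star_zero, map_zero, star_zero]
    | add x x' hx hx' => rw [star_add, map_add, map_add, hx, hx', star_add]
    | tmul a b => simp [map_star]

lemma algTensorMap_tmul (f : A →⋆ₙₐ[ℂ] C) (g : B →⋆ₙₐ[ℂ] D) (a : A) (b : B) :
    algTensorMap f g (a ⊗ₜ b) = f a ⊗ₜ g b := rfl

lemma algTensorRep_algTensorMap (π : C →⋆ₙₐ[ℂ] (H →L[ℂ] H)) (σ : D →⋆ₙₐ[ℂ] (K →L[ℂ] K))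
    (f : A →⋆ₙₐ[ℂ] C) (g : B →⋆ₙₐ[ℂ] D) (x : A ⊗[ℂ] B) :
    algTensorRep π σ (algTensorMap f g x) = algTensorRep (π.comp f) (σ.comp g) x := by
  induction x using TensorProduct.induction_on with
  | zero => rw [map_zero, map_zero, map_zero]
  | add x x' hx hx' => rw [map_add, map_add, map_add, hx, hx']
  | tmul a b => rw [algTensorMap_tmul, algTensorRep_tmul, algTensorRep_tmul]; rfl

end Algebraic

/-- A pair of `*`-representations of `A` and of `B` on Hilbert spaces. -/
structure RepPair (A B : Type) [NonUnitalCStarAlgebra A] [NonUnitalCStarAlgebra B] where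
  (H K : Type)
  [normedH : NormedAddCommGroup H]
  [innerH : InnerProductSpace ℂ H]
  [completeH : CompleteSpace H]
  [normedK : NormedAddCommGroup K]
  [innerK : InnerProductSpace ℂ K]
  [completeK : CompleteSpace K]
  π : A →⋆ₙₐ[ℂ] (H →L[ℂ] H)
  σ : B →⋆ₙₐ[ℂ] (K →L[ℂ] K)

attribute [instance] RepPair.normedH RepPair.innerH RepPair.completeH RepPair.normedK
  RepPair.innerK RepPair.completeK

section

variable (A B : Type) [NonUnitalCStarAlgebra A] [NonUnitalCStarAlgebra B]

lemma minTensor_bound (x : A ⊗[ℂ] B) :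
    ∃ M : ℝ, ∀ R : RepPair A B, ‖algTensorRep R.π R.σ x‖ ≤ M := by
  induction x using TensorProduct.induction_on with
  | zero => exact ⟨0, fun R => by rw [map_zero, norm_zero]⟩
  | add x y hx hy =>
    obtain ⟨M, hM⟩ := hx
    obtain ⟨N, hN⟩ := hy
    exact ⟨M + N, fun R => by
      rw [map_add]; exact (norm_add_le _ _).trans (add_le_add (hM R) (hN R))⟩
  | tmul a b =>
    refine ⟨‖a‖ * ‖b‖, fun R => ?_⟩
    rw [algTensorRep_tmul]
    exact (HTensor.norm_map_le _ _).trans (mul_le_mul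
      (NonUnitalStarAlgHom.norm_apply_le R.π a) (NonUnitalStarAlgHom.norm_apply_le R.σ b)
      (norm_nonneg _) (norm_nonneg _))

/-- The minimal (spatial) C⋆-norm on the algebraic tensor product:
`‖x‖ = sup ‖(π ⊗ σ) x‖` over all `*`-representations `π` of `A` and `σ` of `B`. -/
def minTensorSeminorm : CStarSeminorm (A ⊗[ℂ] B) :=
  CStarSeminorm.ofHoms (fun R : RepPair A B => algTensorRep R.π R.σ) (minTensor_bound A B)

/-- The minimal C⋆-tensor product `A ⊗ B`. -/
def MinTensor : Type := (minTensorSeminorm A B).Completion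

instance : NonUnitalCStarAlgebra (MinTensor A B) :=
  inferInstanceAs (NonUnitalCStarAlgebra (minTensorSeminorm A B).Completion)

end

namespace MinTensor

section NonUnital

variable {A B C D : Type} [NonUnitalCStarAlgebra A] [NonUnitalCStarAlgebra B]
  [NonUnitalCStarAlgebra C] [NonUnitalCStarAlgebra D]

/-- The canonical map of the algebraic tensor product into the minimal one. -/
def ofAlg : A ⊗[ℂ] B →⋆ₙₐ[ℂ] MinTensor A B := (minTensorSeminorm A B).coeHom

lemma denseRange_ofAlg : DenseRange (ofAlg : A ⊗[ℂ] B →⋆ₙₐ[ℂ] MinTensor A B) :=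
  (minTensorSeminorm A B).denseRange_coe

/-- The elementary tensor `a ⊗ b`. -/
def tmul (a : A) (b : B) : MinTensor A B := ofAlg (a ⊗ₜ b)

section Rep

variable {H K : Type} [NormedAddCommGroup H] [InnerProductSpace ℂ H] [CompleteSpace H]
  [NormedAddCommGroup K] [InnerProductSpace ℂ K] [CompleteSpace K]

lemma norm_algTensorRep_le (π : A →⋆ₙₐ[ℂ] (H →L[ℂ] H)) (σ : B →⋆ₙₐ[ℂ] (K →L[ℂ] K))
    (x : A ⊗[ℂ] B) : ‖algTensorRep π σ x‖ ≤ (minTensorSeminorm A B).toFun x :=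
  CStarSeminorm.le_ofHoms (fun R : RepPair A B => algTensorRep R.π R.σ) (minTensor_bound A B)
    (RepPair.mk H K π σ) x

/-- The tensor product `π ⊗ σ` of `*`-representations, as a representation of the minimal
tensor product on the Hilbert space tensor product. -/
def rep (π : A →⋆ₙₐ[ℂ] (H →L[ℂ] H)) (σ : B →⋆ₙₐ[ℂ] (K →L[ℂ] K)) :
    MinTensor A B →⋆ₙₐ[ℂ] (HTensor H K →L[ℂ] HTensor H K) :=
  (minTensorSeminorm A B).extend (algTensorRep π σ) (norm_algTensorRep_le π σ)

lemma rep_ofAlg (π : A →⋆ₙₐ[ℂ] (H →L[ℂ] H)) (σ : B →⋆ₙₐ[ℂ] (K →L[ℂ] K)) (x : A ⊗[ℂ] B) :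
    rep π σ (ofAlg x) = algTensorRep π σ x :=
  (minTensorSeminorm A B).extend_coe _ _ _

@[simp] lemma rep_tmul (π : A →⋆ₙₐ[ℂ] (H →L[ℂ] H)) (σ : B →⋆ₙₐ[ℂ] (K →L[ℂ] K)) (a : A)
    (b : B) : rep π σ (tmul a b) = HTensor.map (π a) (σ b) := by
  rw [tmul, rep_ofAlg, algTensorRep_tmul]

end Rep

lemma norm_algTensorMap_le (f : A →⋆ₙₐ[ℂ] C) (g : B →⋆ₙₐ[ℂ] D) (x : A ⊗[ℂ] B) :
    ‖ofAlg.comp (algTensorMap f g) x‖ ≤ (minTensorSeminorm A B).toFun x := by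
  refine ((minTensorSeminorm C D).norm_coe _).trans_le ?_
  refine Real.iSup_le (fun R => ?_) ((minTensorSeminorm A B).nonneg x)
  change ‖algTensorRep R.π R.σ (algTensorMap f g x)‖ ≤ _
  rw [algTensorRep_algTensorMap]
  exact norm_algTensorRep_le _ _ x

/-- The `*`-homomorphism `f ⊗ g` of minimal tensor products. -/
def map (f : A →⋆ₙₐ[ℂ] C) (g : B →⋆ₙₐ[ℂ] D) : MinTensor A B →⋆ₙₐ[ℂ] MinTensor C D :=
  (minTensorSeminorm A B).extend (ofAlg.comp (algTensorMap f g)) (norm_algTensorMap_le f g)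

lemma map_ofAlg (f : A →⋆ₙₐ[ℂ] C) (g : B →⋆ₙₐ[ℂ] D) (x : A ⊗[ℂ] B) :
    map f g (ofAlg x) = ofAlg (algTensorMap f g x) :=
  (minTensorSeminorm A B).extend_coe _ _ _

@[simp] lemma map_tmul (f : A →⋆ₙₐ[ℂ] C) (g : B →⋆ₙₐ[ℂ] D) (a : A) (b : B) :
    map f g (tmul a b) = tmul (f a) (g b) :=
  map_ofAlg f g _

lemma tmul_mul_tmul (a a' : A) (b b' : B) :
    tmul a b * tmul a' b' = tmul (a * a') (b * b') := by
  rw [tmul, tmul, ← map_mul, Algebra.TensorProduct.tmul_mul_tmul, tmul]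

lemma star_tmul (a : A) (b : B) : star (tmul a b) = tmul (star a) (star b) := by
  rw [tmul, ← map_star, TensorProduct.star_tmul, tmul]

end NonUnital

section Unital

variable {A B : Type} [CStarAlgebra A] [CStarAlgebra B]

instance : CStarAlgebra (MinTensor A B) :=
  inferInstanceAs (CStarAlgebra (minTensorSeminorm A B).Completion)

lemma one_def : (1 : MinTensor A B) = tmul 1 1 := rfl


end Unital

end MinTensor

end MinTensor

/-! ### `c₀`-direct sums of C⋆-algebras -/

section C0

open scoped ENNReal
open Filter Topology

/-- The `c₀`-direct sum of C⋆-algebras: the bounded families `(x_i)` such that `‖x_i‖ → 0`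
along the complements of finite sets, with the supremum norm and pointwise operations. -/
def c0Subalgebra {I : Type} (A : I → Type) [∀ i, NonUnitalCStarAlgebra (A i)] :
    NonUnitalStarSubalgebra ℂ (lp A ∞) where
  carrier := {x | Tendsto (fun i => ‖x i‖) cofinite (𝓝 0)}
  zero_mem' := by
    refine tendsto_const_nhds.congr fun i => ?_
    exact norm_zero.symm
  add_mem' {x y} hx hy := by
    have h : Tendsto (fun i => ‖x i‖ + ‖y i‖) cofinite (𝓝 0) := by
      simpa using Tendsto.add hx hy
    exact squeeze_zero (fun i => norm_nonneg _) (fun i => norm_add_le (x i) (y i)) h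
  mul_mem' {x y} hx hy := by
    have h : Tendsto (fun i => ‖x i‖ * ‖y i‖) cofinite (𝓝 0) := by
      simpa using Tendsto.mul hx hy
    exact squeeze_zero (fun i => norm_nonneg _) (fun i => norm_mul_le (x i) (y i)) h
  smul_mem' c x hx := by
    have h : Tendsto (fun i => ‖c‖ * ‖x i‖) cofinite (𝓝 0) := by
      simpa using Tendsto.const_mul ‖c‖ hx
    exact squeeze_zero (fun i => norm_nonneg _) (fun i => (norm_smul_le c (x i))) h
  star_mem' {x} hx := by
    have h : (fun i => ‖(star x : lp A ∞) i‖) = fun i => ‖x i‖ := by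
      funext i
      rw [lp.star_apply, norm_star]
    change Tendsto (fun i => ‖(star x : lp A ∞) i‖) cofinite (𝓝 0)
    rw [h]
    exact hx

lemma isClosed_c0Subalgebra {I : Type} (A : I → Type) [∀ i, NonUnitalCStarAlgebra (A i)] :
    IsClosed (c0Subalgebra A : Set (lp A ∞)) := by
  refine isClosed_of_closure_subset fun x hx => ?_
  change Tendsto (fun i => ‖x i‖) cofinite (𝓝 0)
  rw [Metric.mem_closure_iff] at hx
  rw [Metric.tendsto_nhds]
  intro ε hε
  obtain ⟨y, hy, hxy⟩ := hx (ε / 2) (half_pos hε)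
  have hy' : Tendsto (fun i => ‖y i‖) cofinite (𝓝 0) := hy
  rw [Metric.tendsto_nhds] at hy'
  filter_upwards [hy' (ε / 2) (half_pos hε)] with i hi
  rw [dist_zero_right, norm_norm] at hi ⊢
  have h1 : ‖x i - y i‖ < ε / 2 :=
    (lp.norm_apply_le_norm ENNReal.top_ne_zero (x - y) i).trans_lt (by rwa [← dist_eq_norm])
  calc ‖x i‖ = ‖(x i - y i) + y i‖ := by rw [sub_add_cancel]
    _ ≤ ‖x i - y i‖ + ‖y i‖ := norm_add_le _ _
    _ < ε := by linarith

/-- The `c₀`-direct sum of a family of C⋆-algebras. -/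
def C0Sum {I : Type} (A : I → Type) [∀ i, NonUnitalCStarAlgebra (A i)] : Type :=
  c0Subalgebra A

namespace C0Sum

variable {I : Type} {A : I → Type} [∀ i, NonUnitalCStarAlgebra (A i)]

instance : NonUnitalCStarAlgebra (C0Sum A) :=
  NonUnitalStarSubalgebra.nonUnitalCStarAlgebra (S := NonUnitalStarSubalgebra ℂ (lp A ∞))
    (c0Subalgebra A) (h_closed := isClosed_c0Subalgebra A)

/-- The `i`-th component of an element of the direct sum. -/
def comp (x : C0Sum A) (i : I) : A i := x.1 i

/-- The element of the direct sum with given components. -/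
def mk (x : ∀ i, A i) (hx : Tendsto (fun i => ‖x i‖) cofinite (𝓝 0)) : C0Sum A :=
  ⟨⟨x, memℓp_infty (by
    obtain ⟨s, hs⟩ : ∃ s : Finset I, ∀ i ∉ s, ‖x i‖ ≤ 1 := by
      have h := hx.eventually (Iic_mem_nhds zero_lt_one)
      rw [eventually_cofinite] at h
      exact ⟨h.toFinset, fun i hi => by simpa using hi⟩
    refine ⟨1 + ∑ i ∈ s, ‖x i‖, ?_⟩
    rintro _ ⟨i, rfl⟩
    have h0 : 0 ≤ ∑ i ∈ s, ‖x i‖ := Finset.sum_nonneg fun i _ => norm_nonneg _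
    by_cases hi : i ∈ s
    · have := Finset.single_le_sum (f := fun i => ‖x i‖) (fun i _ => norm_nonneg _) hi
      dsimp only at this ⊢
      linarith
    · have := hs i hi
      dsimp only
      linarith)⟩, hx⟩

@[simp] lemma comp_mk (x : ∀ i, A i) (hx : Tendsto (fun i => ‖x i‖) cofinite (𝓝 0)) (i : I) :
    (mk x hx).comp i = x i := rfl

@[ext] lemma ext {x y : C0Sum A} (h : ∀ i, x.comp i = y.comp i) : x = y :=
  Subtype.ext (Subtype.ext (funext h))

@[simp] lemma comp_add (x y : C0Sum A) (i : I) : (x + y).comp i = x.comp i + y.comp i := rfl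
@[simp] lemma comp_mul (x y : C0Sum A) (i : I) : (x * y).comp i = x.comp i * y.comp i := rfl
@[simp] lemma comp_zero (i : I) : (0 : C0Sum A).comp i = 0 := rfl
@[simp] lemma comp_star (x : C0Sum A) (i : I) : (star x).comp i = star (x.comp i) := rfl
@[simp] lemma comp_smul (c : ℂ) (x : C0Sum A) (i : I) : (c • x).comp i = c • x.comp i := rfl

lemma tendsto_comp (x : C0Sum A) : Tendsto (fun i => ‖x.comp i‖) cofinite (𝓝 0) := x.2

lemma norm_comp_le (x : C0Sum A) (i : I) : ‖x.comp i‖ ≤ ‖x‖ :=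
  lp.norm_apply_le_norm ENNReal.top_ne_zero x.1 i

lemma tendsto_single [DecidableEq I] (i : I) (a : A i) :
    Tendsto (fun j => ‖(Pi.single i a : ∀ j, A j) j‖) cofinite (𝓝 0) := by
  refine tendsto_const_nhds.congr' ?_
  rw [EventuallyEq, eventually_cofinite]
  refine (Set.finite_singleton i).subset fun j hj => ?_
  by_contra hji
  exact hj (by rw [Pi.single_eq_of_ne hji, norm_zero])

/-- The inclusion of the `i`-th summand. -/
def ι [DecidableEq I] (i : I) : A i →⋆ₙₐ[ℂ] C0Sum A where
  toFun a := mk (Pi.single i a) (tendsto_single i a)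
  map_smul' c a := by ext j; exact congrFun (Pi.single_smul i c a) j
  map_zero' := by ext j; exact congrFun (Pi.single_zero i) j
  map_add' a b := by ext j; exact congrFun (Pi.single_add i a b) j
  map_mul' a b := by ext j; exact congrFun (Pi.single_mul i a b) j
  map_star' a := by ext j; exact congrFun (Pi.single_star i a) j

lemma comp_ι [DecidableEq I] (i : I) (a : A i) (j : I) :
    (ι i a).comp j = (Pi.single i a : ∀ j, A j) j := rfl

lemma ι_mul_ι_of_ne [DecidableEq I] {i j : I} (hij : i ≠ j) (a : A i) (b : A j) :
    ι i a * ι j b = 0 := by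
  ext k
  rw [comp_mul, comp_ι, comp_ι, comp_zero]
  by_cases hk : k = i
  · subst hk
    rw [Pi.single_eq_of_ne hij, mul_zero]
  · rw [Pi.single_eq_of_ne hk, zero_mul]

section Lift

variable {B : Type} [NonUnitalCStarAlgebra B] (f : ∀ i, A i →⋆ₙₐ[ℂ] B)

lemma norm_sum_le (hf : ∀ i j, i ≠ j → ∀ a b, f i a * f j b = 0)
    (S : Finset I) (x : ∀ i, A i) {C : ℝ} (hC : 0 ≤ C)
    (hx : ∀ i ∈ S, ‖x i‖ ≤ C) : ‖∑ i ∈ S, f i (x i)‖ ≤ C := by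
  classical
  let g : (∀ i : S, A i) →⋆ₙₐ[ℂ] B :=
    { toFun := fun y => ∑ i : S, f i (y i)
      map_smul' := fun c y => by simp [Finset.smul_sum]
      map_zero' := by simp
      map_add' := fun y z => by simp [Finset.sum_add_distrib]
      map_mul' := fun y z => by
        rw [Finset.sum_mul_sum]
        refine Finset.sum_congr rfl fun i _ => ?_
        rw [Finset.sum_eq_single i (fun j _ hj =>
          hf i j (fun h => hj (Subtype.ext h.symm)) _ _) (by simp)]
        exact map_mul (f i) _ _
      map_star' := fun y => by
        rw [star_sum]
        exact Finset.sum_congr rfl fun i _ => map_star (f i) _ }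
  have h1 : ∑ i ∈ S, f i (x i) = g fun i => x i := (Finset.sum_coe_sort S _).symm
  rw [h1]
  exact (NonUnitalStarAlgHom.norm_apply_le g _).trans
    ((pi_norm_le_iff_of_nonneg hC).mpr fun i => hx i i.2)

lemma summable_lift (hf : ∀ i j, i ≠ j → ∀ a b, f i a * f j b = 0)
    (x : C0Sum A) : Summable fun i => f i (x.comp i) := by
  rw [summable_iff_vanishing_norm]
  intro ε hε
  have h := x.tendsto_comp.eventually (Iic_mem_nhds (half_pos hε))
  rw [eventually_cofinite] at h
  refine ⟨h.toFinset, fun t ht => ?_⟩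
  refine (norm_sum_le f hf t x.comp (half_pos hε).le fun i hi => ?_).trans_lt (half_lt_self hε)
  by_contra hc
  exact Finset.disjoint_left.mp ht hi (by simpa using hc)

/-- The `*`-homomorphism `(x_i) ↦ ∑ f_i x_i` given by `*`-homomorphisms with mutually orthogonal
ranges. -/
def lift (hf : ∀ i j, i ≠ j → ∀ a b, f i a * f j b = 0) :
    C0Sum A →⋆ₙₐ[ℂ] B where
  toFun x := ∑' i, f i (x.comp i)
  map_smul' c x := by
    simp_rw [comp_smul, map_smul]
    exact (summable_lift f hf x).tsum_const_smul c
  map_zero' := by simp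
  map_add' x y := by
    simp_rw [comp_add, map_add]
    exact (summable_lift f hf x).tsum_add (summable_lift f hf y)
  map_mul' x y := by
    rw [← (summable_lift f hf x).tsum_mul_right]
    refine tsum_congr fun i => ?_
    rw [← (summable_lift f hf y).tsum_mul_left, comp_mul, map_mul]
    exact (tsum_eq_single i fun j hj => hf i j hj.symm _ _).symm
  map_star' x := by
    simp_rw [comp_star, map_star]
    exact tsum_star.symm

end Lift

/-- The `*`-homomorphism `(x_i) ↦ (x_{r j})_j` given by a finite-to-one map `r` of index sets. -/
def pullback {J : Type} (r : J → I) (hr : Tendsto r cofinite cofinite) :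
    C0Sum A →⋆ₙₐ[ℂ] C0Sum fun j => A (r j) where
  toFun x := mk (fun j => x.comp (r j)) (x.tendsto_comp.comp hr)
  map_smul' _ _ := rfl
  map_zero' := rfl
  map_add' _ _ := rfl
  map_mul' _ _ := rfl
  map_star' _ := rfl

end C0Sum

end C0

/-! ### The bialgebra of Cuntz algebras -/

section Bialgebra

open CuntzAlg

lemma MinTensor.add_tmul {A B : Type} [NonUnitalCStarAlgebra A] [NonUnitalCStarAlgebra B]
    (a a' : A) (b : B) : tmul (a + a') b = tmul a b + tmul a' b := by
  rw [tmul, TensorProduct.add_tmul, _root_.map_add, tmul, tmul]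

lemma MinTensor.tmul_add {A B : Type} [NonUnitalCStarAlgebra A] [NonUnitalCStarAlgebra B]
    (a : A) (b b' : B) : tmul a (b + b') = tmul a b + tmul a b' := by
  rw [tmul, TensorProduct.tmul_add, _root_.map_add, tmul, tmul]

lemma MinTensor.zero_tmul {A B : Type} [NonUnitalCStarAlgebra A] [NonUnitalCStarAlgebra B]
    (b : B) : tmul (0 : A) b = 0 := by
  rw [tmul, TensorProduct.zero_tmul, map_zero]

lemma MinTensor.tmul_zero {A B : Type} [NonUnitalCStarAlgebra A] [NonUnitalCStarAlgebra B]
    (a : A) : tmul a (0 : B) = 0 := by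
  rw [tmul, TensorProduct.tmul_zero, map_zero]

/-- Bilinear identities in minimal tensor products can be checked on elementary tensors. -/
lemma MinTensor.mul_eq_zero_of_tmul {A B C D E : Type} [NonUnitalCStarAlgebra A]
    [NonUnitalCStarAlgebra B] [NonUnitalCStarAlgebra C] [NonUnitalCStarAlgebra D]
    [NonUnitalCStarAlgebra E] (f : MinTensor A B →⋆ₙₐ[ℂ] E) (g : MinTensor C D →⋆ₙₐ[ℂ] E)
    (h : ∀ a b c d, f (tmul a b) * g (tmul c d) = 0) (x : MinTensor A B) (y : MinTensor C D) :
    f x * g y = 0 := by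
  have hfc : Continuous f := AddMonoidHomClass.continuous_of_bound f 1 fun x => by
    rw [one_mul]; exact NonUnitalStarAlgHom.norm_apply_le f x
  have hgc : Continuous g := AddMonoidHomClass.continuous_of_bound g 1 fun x => by
    rw [one_mul]; exact NonUnitalStarAlgHom.norm_apply_le g x
  have key : ∀ u v, f (ofAlg u) * g (ofAlg v) = 0 := fun u v => by
    induction u using TensorProduct.induction_on with
    | zero => rw [map_zero, map_zero, zero_mul]
    | add u u' hu hu' => rw [_root_.map_add, _root_.map_add, add_mul, hu, hu', add_zero]
    | tmul a b =>
      induction v using TensorProduct.induction_on with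
      | zero => rw [map_zero, map_zero, mul_zero]
      | add v v' hv hv' => rw [_root_.map_add, _root_.map_add, mul_add, hv, hv', add_zero]
      | tmul c d => exact h a b c d
  have hc : IsClosed {q : MinTensor A B × MinTensor C D | f q.1 * g q.2 = 0} :=
    isClosed_eq ((hfc.comp continuous_fst).mul (hgc.comp continuous_snd)) continuous_const
  exact isClosed_property (denseRange_ofAlg.prodMap denseRange_ofAlg) hc
    (fun q => key q.1 q.2) (x, y)

/-- The bijection `p ↦ (i, j)` with `p = m i + j` (indices starting at zero; with indices
starting at one this reads `p = m (i - 1) + j`). -/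
def splitIndex (n m : ℕ+) : Fin (n * m : ℕ+) ≃ Fin n × Fin m :=
  (finCongr (PNat.mul_coe n m)).trans finProdFinEquiv.symm

lemma splitIndex_spec (n m : ℕ+) (p : Fin (n * m : ℕ+)) :
    (p : ℕ) = m * ((splitIndex n m p).1 : ℕ) + ((splitIndex n m p).2 : ℕ) := by
  have h := congrArg Fin.val (finProdFinEquiv.apply_symm_apply (Fin.cast (PNat.mul_coe n m) p))
  rw [finProdFinEquiv_apply_val, Fin.val_cast] at h
  rw [← h, add_comm]
  rfl

/-- The elements `s_i ⊗ s_j`, `1 ≤ i ≤ n`, `1 ≤ j ≤ m`, of `𝒪_n ⊗ 𝒪_m`, numbered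
lexicographically, form a Cuntz family of size `n m`. -/
lemma isCuntzFamily_tmul (n m : ℕ+) :
    IsCuntzFamily fun p : Fin (n * m : ℕ+) =>
      (MinTensor.tmul (s (splitIndex n m p).1) (s (splitIndex n m p).2) :
        MinTensor (CuntzAlg n) (CuntzAlg m)) where
  star_mul p q := by
    rw [MinTensor.star_tmul, MinTensor.tmul_mul_tmul, (isCuntzFamily_s _).star_mul,
      (isCuntzFamily_s _).star_mul]
    by_cases h : p = q
    · subst h
      rw [if_pos rfl, if_pos rfl, if_pos rfl, MinTensor.one_def]
    · rw [if_neg h]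
      by_cases h1 : (splitIndex n m p).1 = (splitIndex n m q).1
      · have h2 : (splitIndex n m p).2 ≠ (splitIndex n m q).2 := fun h2 =>
          h ((splitIndex n m).injective (Prod.ext h1 h2))
        rw [if_neg h2, MinTensor.tmul_zero]
      · rw [if_neg h1, MinTensor.zero_tmul]
  sum_mul_star := by
    have h1 : ∀ p : Fin (n * m : ℕ+),
        (MinTensor.tmul (s (splitIndex n m p).1) (s (splitIndex n m p).2) :
          MinTensor (CuntzAlg n) (CuntzAlg m)) *
          star (MinTensor.tmul (s (splitIndex n m p).1) (s (splitIndex n m p).2)) =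
        (fun q : Fin n × Fin m => MinTensor.tmul (s q.1 * star (s q.1)) (s q.2 * star (s q.2)))
          (splitIndex n m p) := fun p => by
      rw [MinTensor.star_tmul, MinTensor.tmul_mul_tmul]
    rw [Finset.sum_congr rfl fun p _ => h1 p, (splitIndex n m).sum_comp (fun q : Fin n × Fin m =>
      (MinTensor.tmul (s q.1 * star (s q.1)) (s q.2 * star (s q.2)) :
        MinTensor (CuntzAlg n) (CuntzAlg m))), Fintype.sum_prod_type]
    let L : ∀ _ : CuntzAlg n, CuntzAlg m →+ MinTensor (CuntzAlg n) (CuntzAlg m) := fun a =>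
      AddMonoidHom.mk' (fun b => MinTensor.tmul a b) (MinTensor.tmul_add a)
    let R : CuntzAlg n →+ MinTensor (CuntzAlg n) (CuntzAlg m) :=
      AddMonoidHom.mk' (fun a => MinTensor.tmul a 1) fun a a' => MinTensor.add_tmul a a' 1
    have h2 : ∀ a : CuntzAlg n, ∑ j : Fin m, MinTensor.tmul a (s j * star (s j)) =
        R a := fun a => by
      have := map_sum (L a) (fun j : Fin m => s j * star (s j)) Finset.univ
      rw [(isCuntzFamily_s m).sum_mul_star] at this
      exact this.symm
    dsimp only
    simp_rw [h2]
    rw [← map_sum, (isCuntzFamily_s n).sum_mul_star, MinTensor.one_def]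
    rfl
  eq_one h p := by
    have h' : (n : ℕ) * m = 1 := h
    have hn : (n : ℕ) = 1 := Nat.eq_one_of_mul_eq_one_right h'
    have hm : (m : ℕ) = 1 := Nat.eq_one_of_mul_eq_one_left h'
    rw [(isCuntzFamily_s n).eq_one hn, (isCuntzFamily_s m).eq_one hm, MinTensor.one_def]

/-- The unital `*`-homomorphism `φ_{n,m} : 𝒪_{nm} → 𝒪_n ⊗ 𝒪_m` with
`φ_{n,m} (s_{m(i-1)+j}) = s_i ⊗ s_j`. -/
def phi (n m : ℕ+) : CuntzAlg (n * m : ℕ+) →⋆ₐ[ℂ] MinTensor (CuntzAlg n) (CuntzAlg m) :=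
  CuntzAlg.lift _ (isCuntzFamily_tmul n m)

lemma phi_s (n m : ℕ+) (p : Fin (n * m : ℕ+)) :
    phi n m (s p) = MinTensor.tmul (s (splitIndex n m p).1) (s (splitIndex n m p).2) :=
  CuntzAlg.lift_s _ (isCuntzFamily_tmul n m) p

/-- The C⋆-algebra `𝒪_*`, the `c₀`-direct sum of the Cuntz algebras `𝒪_n`, `n = 1, 2, 3, …`. -/
abbrev OStar : Type := C0Sum fun n : ℕ+ => CuntzAlg n

/-- The `*`-homomorphism `𝒪_{nm} → 𝒪_n ⊗ 𝒪_m ⊆ 𝒪_* ⊗ 𝒪_*` given by `φ_{n,m}`. -/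
def phiStar (p : ℕ+ × ℕ+) : CuntzAlg (p.1 * p.2 : ℕ+) →⋆ₙₐ[ℂ] MinTensor OStar OStar :=
  (MinTensor.map (C0Sum.ι (A := fun n : ℕ+ => CuntzAlg n) p.1)
    (C0Sum.ι (A := fun n : ℕ+ => CuntzAlg n) p.2)).comp
    (phi p.1 p.2 : CuntzAlg (p.1 * p.2 : ℕ+) →⋆ₙₐ[ℂ] MinTensor (CuntzAlg p.1) (CuntzAlg p.2))

lemma map_ι_orthogonal {p q : ℕ+ × ℕ+} (hpq : p ≠ q)
    (x : MinTensor (CuntzAlg p.1) (CuntzAlg p.2)) (y : MinTensor (CuntzAlg q.1) (CuntzAlg q.2)) :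
    MinTensor.map (C0Sum.ι (A := fun n : ℕ+ => CuntzAlg n) p.1)
        (C0Sum.ι (A := fun n : ℕ+ => CuntzAlg n) p.2) x *
      MinTensor.map (C0Sum.ι (A := fun n : ℕ+ => CuntzAlg n) q.1)
        (C0Sum.ι (A := fun n : ℕ+ => CuntzAlg n) q.2) y = 0 := by
  refine MinTensor.mul_eq_zero_of_tmul _ _ (fun a b c d => ?_) x y
  rw [MinTensor.map_tmul, MinTensor.map_tmul, MinTensor.tmul_mul_tmul]
  by_cases h1 : p.1 = q.1
  · rw [C0Sum.ι_mul_ι_of_ne (fun h2 => hpq (Prod.ext h1 h2)), MinTensor.tmul_zero]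
  · rw [C0Sum.ι_mul_ι_of_ne h1, MinTensor.zero_tmul]

lemma tendsto_mul_cofinite :
    Filter.Tendsto (fun p : ℕ+ × ℕ+ => p.1 * p.2) Filter.cofinite Filter.cofinite := by
  refine Filter.Tendsto.cofinite_of_finite_preimage_singleton fun k => ?_
  refine ((Set.finite_Iic k).prod (Set.finite_Iic k)).subset ?_
  rintro ⟨a, b⟩ h
  have h' : a * b = k := h
  subst h'
  exact ⟨PNat.coe_le_coe _ _ |>.mp (Nat.le_mul_of_pos_right _ b.pos),
    PNat.coe_le_coe _ _ |>.mp (Nat.le_mul_of_pos_left _ a.pos)⟩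

/-- The comultiplication `Δ_φ` of `𝒪_*`: the direct sum over `k` of the maps
`Δ^{(k)} (x) = ∑_{nm = k} φ_{n,m} (x)` on `𝒪_k`.  In other words
`Δ_φ (x) = ∑_{(n,m)} φ_{n,m} (x_{nm})`. -/
def comult : OStar →⋆ₙₐ[ℂ] MinTensor OStar OStar :=
  (C0Sum.lift phiStar fun _ _ hpq _ _ => map_ι_orthogonal hpq _ _).comp
    (C0Sum.pullback (fun p : ℕ+ × ℕ+ => p.1 * p.2) tendsto_mul_cofinite)

lemma comult_apply (x : OStar) : comult x = ∑' p : ℕ+ × ℕ+, phiStar p (x.comp (p.1 * p.2)) :=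
  rfl

end Bialgebra

/-! ### Representations, covariant representations and the pentagon equation -/

section Covariant

section General

variable {A : Type} [NonUnitalCStarAlgebra A]
  {H : Type} [NormedAddCommGroup H] [InnerProductSpace ℂ H] [CompleteSpace H]
  {K : Type} [NormedAddCommGroup K] [InnerProductSpace ℂ K] [CompleteSpace K]

/-- Unitary equivalence of `*`-representations. -/
def UnitarilyEquivalent (π : A →⋆ₙₐ[ℂ] (H →L[ℂ] H)) (σ : A →⋆ₙₐ[ℂ] (K →L[ℂ] K)) : Prop :=
  ∃ U : H ≃ₗᵢ[ℂ] K, ∀ a ξ, U (π a ξ) = σ a (U ξ)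

/-- A quasi-covariant representation `(H, π, W)` of a C⋆-algebra `A` with comultiplication `Δ`:
`W` is a nonzero partial isometry on `H ⊗ H` with `W (π(a) ⊗ I) = ((π ⊗ π) ∘ Δ)(a) W`. -/
structure IsQuasiCovariantRep (Δ : A →⋆ₙₐ[ℂ] MinTensor A A) (π : A →⋆ₙₐ[ℂ] (H →L[ℂ] H))
    (W : HTensor H H →L[ℂ] HTensor H H) : Prop where
  ne_zero : W ≠ 0
  partialIsometry : W * star W * W = W
  covariance : ∀ a : A, W * HTensor.map (π a) 1 = MinTensor.rep π π (Δ a) * W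

/-- A covariant representation: a quasi-covariant one for which `W^*` is an isometry. -/
structure IsCovariantRep (Δ : A →⋆ₙₐ[ℂ] MinTensor A A) (π : A →⋆ₙₐ[ℂ] (H →L[ℂ] H))
    (W : HTensor H H →L[ℂ] HTensor H H) : Prop extends IsQuasiCovariantRep Δ π W where
  isometry_star : Isometry (star W : HTensor H H →L[ℂ] HTensor H H)

end General

section Legs

variable {H : Type} [NormedAddCommGroup H] [InnerProductSpace ℂ H]

/-- `W_{23} = I ⊗ W` on `H ⊗ H ⊗ H`. -/
def leg23 (W : HTensor H H →L[ℂ] HTensor H H) :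
    HTensor H (HTensor H H) →L[ℂ] HTensor H (HTensor H H) :=
  HTensor.map 1 W

/-- `W_{12} = W ⊗ I` on `H ⊗ H ⊗ H`. -/
def leg12 (W : HTensor H H →L[ℂ] HTensor H H) :
    HTensor H (HTensor H H) →L[ℂ] HTensor H (HTensor H H) :=
  ((HTensor.assoc H H H : HTensor (HTensor H H) H →L[ℂ] HTensor H (HTensor H H)).comp
    (HTensor.map W 1)).comp
    ((HTensor.assoc H H H).symm : HTensor H (HTensor H H) →L[ℂ] HTensor (HTensor H H) H)

/-- `W_{13}`, which acts as `W` on the first and third factor of `H ⊗ H ⊗ H`: it is `W_{12}`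
conjugated by the flip of the last two factors. -/
def leg13 (W : HTensor H H →L[ℂ] HTensor H H) :
    HTensor H (HTensor H H) →L[ℂ] HTensor H (HTensor H H) :=
  (leg23 (HTensor.flip H H : HTensor H H →L[ℂ] HTensor H H) * leg12 W) *
    leg23 (HTensor.flip H H : HTensor H H →L[ℂ] HTensor H H)

/-- The pentagon equation `W_{12} W_{13} W_{23} = W_{23} W_{12}`. -/
def IsPentagonal (W : HTensor H H →L[ℂ] HTensor H H) : Prop :=
  leg12 W * leg13 W * leg23 W = leg23 W * leg12 W

lemma leg23_tmul (W : HTensor H H →L[ℂ] HTensor H H) (x : H) (ζ : HTensor H H) :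
    leg23 W (HTensor.tmul x ζ) = HTensor.tmul x (W ζ) :=
  HTensor.map_tmul _ _ _ _

lemma leg12_assoc_tmul (W : HTensor H H →L[ℂ] HTensor H H) (ζ : HTensor H H) (z : H) :
    leg12 W (HTensor.assoc H H H (HTensor.tmul ζ z)) =
      HTensor.assoc H H H (HTensor.tmul (W ζ) z) := by
  change HTensor.assoc H H H (HTensor.map W 1 ((HTensor.assoc H H H).symm _)) = _
  rw [LinearIsometryEquiv.symm_apply_apply, HTensor.map_tmul]
  rfl

end Legs

end Covariant

/-! ### Direct sums of representations -/

section DirectSum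

open scoped ENNReal

variable {I : Type} {A : I → Type} [∀ i, NonUnitalCStarAlgebra (A i)]
  {H : I → Type} [∀ i, NormedAddCommGroup (H i)] [∀ i, InnerProductSpace ℂ (H i)]

variable [∀ i, CompleteSpace (H i)]

lemma norm_rep_le (π : ∀ i, A i →⋆ₙₐ[ℂ] (H i →L[ℂ] H i)) (x : C0Sum A) (i : I) :
    ‖π i (x.comp i)‖ ≤ ‖x‖ :=
  (NonUnitalStarAlgHom.norm_apply_le (π i) _).trans (x.norm_comp_le i)

/-- The operator `(ξ_i) ↦ (π_i(x_i) ξ_i)`. -/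
def directSumOp (π : ∀ i, A i →⋆ₙₐ[ℂ] (H i →L[ℂ] H i)) (x : C0Sum A) : lp H 2 →L[ℂ] lp H 2 :=
  lp.mapCLM 2 (fun i => π i (x.comp i)) (norm_nonneg x) (norm_rep_le π x)

lemma directSumOp_apply (π : ∀ i, A i →⋆ₙₐ[ℂ] (H i →L[ℂ] H i)) (x : C0Sum A) (ξ : lp H 2)
    (i : I) : directSumOp π x ξ i = π i (x.comp i) (ξ i) := rfl

/-- The direct sum `π = ⨁ π_i` of `*`-representations `π_i` of `A_i` on `H_i`, as a representation
of the `c₀`-direct sum of the `A_i` on the Hilbert space direct sum of the `H_i`. -/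
def directSumRep (π : ∀ i, A i →⋆ₙₐ[ℂ] (H i →L[ℂ] H i)) :
    C0Sum A →⋆ₙₐ[ℂ] (lp H 2 →L[ℂ] lp H 2) where
  toFun := directSumOp π
  map_smul' c x := by
    ext ξ i
    exact congrFun (congrArg DFunLike.coe (map_smul (π i) c (x.comp i))) (ξ i)
  map_zero' := by
    ext ξ i
    exact congrFun (congrArg DFunLike.coe (map_zero (π i))) (ξ i)
  map_add' x y := by
    ext ξ i
    exact congrFun (congrArg DFunLike.coe (map_add (π i) (x.comp i) (y.comp i))) (ξ i)
  map_mul' x y := by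
    ext ξ i
    exact congrFun (congrArg DFunLike.coe (map_mul (π i) (x.comp i) (y.comp i))) (ξ i)
  map_star' x := by
    rw [ContinuousLinearMap.star_eq_adjoint, ContinuousLinearMap.eq_adjoint_iff]
    intro ξ η
    rw [lp.inner_eq_tsum, lp.inner_eq_tsum]
    refine tsum_congr fun i => ?_
    rw [directSumOp_apply, directSumOp_apply, C0Sum.comp_star, map_star,
      ContinuousLinearMap.star_eq_adjoint, ContinuousLinearMap.adjoint_inner_left]

lemma directSumRep_apply (π : ∀ i, A i →⋆ₙₐ[ℂ] (H i →L[ℂ] H i)) (x : C0Sum A) (ξ : lp H 2)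
    (i : I) : directSumRep π x ξ i = π i (x.comp i) (ξ i) := rfl

end DirectSum

/-! ### Cuntz states and multiplicative sequences of unit vectors -/

section CuntzStates

open CuntzAlg
open scoped ENNReal ComplexOrder

/-- A state of a unital C⋆-algebra. -/
structure IsState {A : Type} [CStarAlgebra A] (ω : A →L[ℂ] ℂ) : Prop where
  map_one : ω 1 = 1
  nonneg : ∀ a, 0 ≤ ω (star a * a)

/-- `ω` is the Cuntz state `ϱ_z` of `𝒪_n` given by the vector `z`: the state with
`ω (s_{j_1} ⋯ s_{j_a} s_{k_b}^* ⋯ s_{k_1}^*) = conj z_{j_1} ⋯ conj z_{j_a} z_{k_b} ⋯ z_{k_1}` for all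
`a, b ≥ 1` and all indices. -/
structure IsCuntzState {n : ℕ} (z : EuclideanSpace ℂ (Fin n)) (ω : CuntzAlg n →L[ℂ] ℂ) : Prop
    extends IsState ω where
  map_word : ∀ J K : List (Fin n), J ≠ [] → K ≠ [] →
    ω ((J.map s).prod * star (K.map s).prod) =
      (J.map fun j => (starRingEnd ℂ) (z j)).prod * (K.map fun k => z k).prod

/-- The vector `z ⊠ y ∈ ℂ^{nm}` with `(z ⊠ y)_{m(i-1)+j} = z_i y_j`. -/
def boxTimes {n m : ℕ+} (z : EuclideanSpace ℂ (Fin n)) (y : EuclideanSpace ℂ (Fin m)) :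
    EuclideanSpace ℂ (Fin (n * m : ℕ+)) :=
  WithLp.toLp 2 fun p => z (splitIndex n m p).1 * y (splitIndex n m p).2

/-- A sequence of unit vectors `z^{(n)} ∈ ℂ^n`, `n ≥ 1`, with `z^{(n)} ⊠ z^{(m)} = z^{(nm)}`. -/
structure IsMultiplicativeSeq (z : ∀ n : ℕ+, EuclideanSpace ℂ (Fin n)) : Prop where
  norm_eq_one : ∀ n, ‖z n‖ = 1
  boxTimes_eq : ∀ n m, boxTimes (z n) (z m) = z (n * m)

/-- A choice of GNS triples `(H_n, π_n, Ω_n)` of the Cuntz states `ϱ_{z^{(n)}}`, `n ≥ 1`. -/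
structure CuntzGNS (z : ∀ n : ℕ+, EuclideanSpace ℂ (Fin n)) where
  H : ℕ+ → Type
  [normed : ∀ n, NormedAddCommGroup (H n)]
  [inner : ∀ n, InnerProductSpace ℂ (H n)]
  [complete : ∀ n, CompleteSpace (H n)]
  ω : ∀ n : ℕ+, CuntzAlg n →L[ℂ] ℂ
  isCuntzState : ∀ n, IsCuntzState (z n) (ω n)
  π : ∀ n : ℕ+, CuntzAlg n →⋆ₐ[ℂ] (H n →L[ℂ] H n)
  Ω : ∀ n, H n
  inner_Ω : ∀ n x, Inner.inner ℂ (Ω n) (π n x (Ω n)) = ω n x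
  cyclic : ∀ n, DenseRange fun x => π n x (Ω n)

namespace CuntzGNS

attribute [instance] normed inner complete

variable {z : ∀ n : ℕ+, EuclideanSpace ℂ (Fin n)} (G : CuntzGNS z)

/-- The Hilbert space `H = ⨁ H_n`. -/
abbrev HSum : Type := lp G.H 2

/-- `π_n`, as a homomorphism of non-unital `*`-algebras. -/
def rep (n : ℕ+) : CuntzAlg n →⋆ₙₐ[ℂ] (G.H n →L[ℂ] G.H n) := (G.π n : CuntzAlg n →⋆ₙₐ[ℂ] _)

/-- The representation `π = ⨁ π_n` of `𝒪_*` on `H`. -/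
def repSum : OStar →⋆ₙₐ[ℂ] (G.HSum →L[ℂ] G.HSum) := directSumRep G.rep

/-- The inclusion `H_n → H`. -/
def incl (n : ℕ+) : G.H n →L[ℂ] G.HSum := lp.singleContinuousLinearMap ℂ G.H 2 n

/-- The operator `W = ⨁ W^{(n,m)}` on `H ⊗ H`. Here `W^{(n,m)} : H_{nm} ⊗ H_m → H_n ⊗ H_m` is
`W^{(n,m)} (π_{nm}(x) Ω_{nm} ⊗ v) = (π_n ⊗ π_m)(φ_{n,m}(x)) (Ω_n ⊗ E_m v)`, where
`E_m v = ⟪Ω_m, v⟫ Ω_m` is the projection onto `ℂ Ω_m`; and `W = 0` on `H_k ⊗ H_m` if `m` does not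
divide `k`. -/
structure IsCanonicalW (W : HTensor G.HSum G.HSum →L[ℂ] HTensor G.HSum G.HSum) : Prop where
  apply_mul : ∀ (n m : ℕ+) (x : CuntzAlg (n * m : ℕ+)) (v : G.H m),
    W (HTensor.tmul (G.incl (n * m) (G.π (n * m) x (G.Ω (n * m)))) (G.incl m v)) =
      HTensor.map (G.incl n) (G.incl m)
        (MinTensor.rep (G.rep n) (G.rep m) (phi n m x)
          (HTensor.tmul (G.Ω n) ((Inner.inner ℂ (G.Ω m) v) • G.Ω m)))
  apply_of_not_dvd : ∀ (k m : ℕ+), ¬ m ∣ k → ∀ (u : G.H k) (v : G.H m),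
    W (HTensor.tmul (G.incl k u) (G.incl m v)) = 0

end CuntzGNS

end CuntzStates

end

/-! Everything rests on one description of the GNS vector: `Ω_n` is a unit vector with `s_i^* Ω_n =
z_i Ω_n` (`IsCuntzState.isCuntzVector`). Conversely, every such vector induces the state `ϱ_z`
(`IsCuntzVector.isCuntzState`), and the state is unique because the elements `s_J s_K^*` with
nonempty words span a dense subspace of `𝒪_n` (`mem_closure_wordSpan`). A vector of this kind is
found in `ℓ²(ℕ)` by rotating the Cuntz family `e_k ↦ e_{nk+i}` with a unitary matrix built from an
orthonormal basis that contains `z`. Uniqueness also makes representations comparable: if two of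
them have Cuntz vectors with the same parameter and the first vector is cyclic, then the first
representation embeds isometrically into the second (`IsCuntzVector.exists_isometry`).

Since `z^{(n)} ⊠ z^{(m)} = z^{(nm)}`, the vector `Ω_n ⊗ Ω_m` is a Cuntz vector with parameter
`z^{(nm)}` for `(π_n ⊗ π_m) ∘ φ_{n,m}`. This gives an isometric intertwiner `V_{n,m} : H_{nm} → H_n
⊗ H_m`. Its range visibly contains `s_J Ω_n ⊗ s_K Ω_m` when `J` and `K` have equal length. The
identity `s_J Ω = ∑_l z_l s_J s_l Ω` lengthens words at will, so equal length is no restriction and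
`V_{n,m}` is unitary (`IsCuntzVector.exists_unitary`).

The operator `W` is defined through its adjoint, `W^* ζ = V_{n,m}^* ζ ⊗ Ω_m` on `H_n ⊗ H_m`. These
pieces land in the distinct summands `H_{nm} ⊗ H_m`, so `W^*` is an isometry; taking adjoints gives
`W (u ⊗ v) = ⟪Ω_m, v⟫ V_{n,m} u`. Covariance is then the intertwining property of `V_{n,m}`. On
tensors of word vectors, `W` splits the word in the first leg into two words and multiplies by a
product of conjugate coordinates of `z` read off from the word in the second leg. The pentagon
equation thereby becomes associativity of the splitting of indices together with multiplicativity of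
`z` along words.

For the inequivalence, a unitary intertwiner carries `Ω_n` to a unit vector `ξ` with `s_i^* ξ = z_i
ξ`. It is concentrated in the summand `H'_n`, and it is not orthogonal to the cyclic vector `Ω'_n`.
Inserting `∑ s_i s_i^* = 1` gives `⟪ξ, Ω'_n⟫ = ⟪z, y⟫ ⟪ξ, Ω'_n⟫`, hence `⟪z, y⟫ = 1`, and unit
vectors with inner product `1` coincide. -/

noncomputable section

set_option linter.unusedSectionVars false

open UniformSpace
open scoped ComplexOrder

/-! ### Words in the generators, and dense subspaces of `𝒪_n`. -/

namespace CuntzAlg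

variable {n : ℕ}

/-- The product `s_{j_1} ⋯ s_{j_a}` of generators. -/
def word (J : List (Fin n)) : CuntzAlg n := (J.map s).prod

@[simp] lemma word_nil : word ([] : List (Fin n)) = 1 := rfl

@[simp] lemma word_cons (j : Fin n) (J : List (Fin n)) : word (j :: J) = s j * word J := by
  simp [word]

lemma word_append (J K : List (Fin n)) : word (J ++ K) = word J * word K := by
  simp [word]

lemma ofFree_smul (c : ℂ) (x : FreeStarAlg n) : ofFree n (c • x) = c • ofFree n x :=
  (cuntzSeminorm n).coe_smul c x

lemma ofFree_inr (i : Fin n) :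
    ofFree n (FreeStarAlg.word (FreeMonoid.of (Sum.inr i))) = star (s i) := by
  rw [s, ← ofFree_star, FreeStarAlg.star_word_of]
  rfl

/-- A subspace of `𝒪_n` which contains `1` and is invariant under left multiplication by the
generators and their adjoints is dense. -/
theorem mem_topologicalClosure {p : Submodule ℂ (CuntzAlg n)} (h1 : (1 : CuntzAlg n) ∈ p)
    (hs : ∀ i, ∀ x ∈ p, s i * x ∈ p) (hs' : ∀ i, ∀ x ∈ p, star (s i) * x ∈ p) (x : CuntzAlg n) :
    x ∈ p.topologicalClosure := by
  -- No closure is needed for `*`-polynomials: a word is built up from `1` by left multiplications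
  -- by letters, under which `p` is invariant.
  have key : ∀ x : FreeStarAlg n, ofFree n x ∈ p := fun x => by
    induction x using FreeStarAlg.induction_on with
    | word w =>
      induction w using FreeMonoid.inductionOn' with
      | one => rw [map_one, ofFree_one]; exact h1
      | of_mul a w ih =>
        rw [map_mul, ofFree_mul]
        cases a with
        | inl i => exact hs i _ ih
        | inr i => rw [ofFree_inr]; exact hs' i _ ih
    | add x y hx hy => rw [ofFree_add]; exact p.add_mem hx hy
    | smul c x hx => rw [ofFree_smul]; exact p.smul_mem c hx
  have hx : x ∈ closure (Set.range (ofFree n)) := denseRange_ofFree x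
  exact closure_mono (by rintro _ ⟨y, rfl⟩; exact key y) hx

/-- The span of the elements `s_J s_K^*` with nonempty words `J` and `K`. -/
def wordSpan (n : ℕ) : Submodule ℂ (CuntzAlg n) :=
  Submodule.span ℂ {x | ∃ J K : List (Fin n), J ≠ [] ∧ K ≠ [] ∧ x = word J * star (word K)}

lemma word_mul_star_mem {J K : List (Fin n)} (hJ : J ≠ []) (hK : K ≠ []) :
    word J * star (word K) ∈ wordSpan n :=
  Submodule.subset_span ⟨J, K, hJ, hK, rfl⟩

/-- Inserting `1 = ∑ s_l s_l^*` on the left supplies a missing left word. A Cuntz state has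
prescribed values only on `s_J s_K^*` with both words nonempty, so empty words have to be padded in
this way. -/
lemma star_word_eq_sum (K : List (Fin n)) :
    star (word K) = ∑ l, word [l] * star (word (K ++ [l])) := by
  have h := (isCuntzFamily_s n).sum_mul_star
  calc star (word K) = (∑ i, s i * star (s i)) * star (word K) := by rw [h, one_mul]
    _ = _ := by simp [word_append, Finset.sum_mul, mul_assoc]

lemma word_eq_sum (K : List (Fin n)) :
    word K = ∑ l, word (K ++ [l]) * star (word [l]) := by
  have := congrArg star (star_word_eq_sum K)
  simpa using this

lemma mem_closure_wordSpan (x : CuntzAlg n) : x ∈ (wordSpan n).topologicalClosure := by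
  refine mem_topologicalClosure ?_ (fun i x hx => ?_) (fun i x hx => ?_) x
  · rw [← word_nil, word_eq_sum]
    exact Submodule.sum_mem _ fun l _ => word_mul_star_mem (by simp) (by simp)
  · induction hx using Submodule.span_induction with
    | mem x hx =>
      obtain ⟨J, K, hJ, hK, rfl⟩ := hx
      rw [← mul_assoc, ← word_cons]
      exact word_mul_star_mem (by simp) hK
    | zero => simp
    | add x y _ _ hx hy => rw [mul_add]; exact Submodule.add_mem _ hx hy
    | smul c x _ hx => rw [mul_smul_comm]; exact Submodule.smul_mem _ c hx
  · induction hx using Submodule.span_induction with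
    | mem x hx =>
      obtain ⟨J, K, hJ, hK, rfl⟩ := hx
      obtain _ | ⟨j, J⟩ := J
      · exact absurd rfl hJ
      rw [word_cons, ← mul_assoc, ← mul_assoc, (isCuntzFamily_s n).star_mul]
      split_ifs
      · rw [one_mul]
        -- Cancelling the first letter of a one-letter word leaves the empty word, which is padded
        -- again.
        by_cases hJ' : J = []
        · rw [hJ', word_nil, one_mul, star_word_eq_sum]
          exact Submodule.sum_mem _ fun l _ => word_mul_star_mem (by simp) (by simp)
        · exact word_mul_star_mem hJ' hK
      · simp
    | zero => simp
    | add x y _ _ hx hy => rw [mul_add]; exact Submodule.add_mem _ hx hy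
    | smul c x _ hx => rw [mul_smul_comm]; exact Submodule.smul_mem _ c hx

end CuntzAlg

open CuntzAlg

/-- The prescribed values determine the state on a dense subspace, and states are continuous. -/
lemma IsCuntzState.unique {n : ℕ} {z : EuclideanSpace ℂ (Fin n)} {ω ω' : CuntzAlg n →L[ℂ] ℂ}
    (h : IsCuntzState z ω) (h' : IsCuntzState z ω') : ω = ω' := by
  have he : Set.EqOn ω ω' (closure (wordSpan n)) :=
    ContinuousLinearMap.eqOn_closure_span (by
      rintro _ ⟨J, K, hJ, hK, rfl⟩
      exact (h.map_word J K hJ hK).trans (h'.map_word J K hJ hK).symm)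
  exact ContinuousLinearMap.ext fun x => he (mem_closure_wordSpan x)

/-! ### Cuntz vectors: joint eigenvectors of the adjoint generators. -/

section CuntzVector

variable {n : ℕ} {H : Type} [NormedAddCommGroup H] [InnerProductSpace ℂ H] [CompleteSpace H]
  {K : Type} [NormedAddCommGroup K] [InnerProductSpace ℂ K] [CompleteSpace K]

/-- A unit vector `ψ` of a unital representation `σ` of `𝒪_n` with `σ(s_i)^* ψ = z_i ψ`. -/
structure IsCuntzVector (z : EuclideanSpace ℂ (Fin n)) (σ : CuntzAlg n →⋆ₙₐ[ℂ] (H →L[ℂ] H))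
    (ψ : H) : Prop where
  map_one : σ 1 = 1
  norm_eq_one : ‖ψ‖ = 1
  star_s : ∀ i, σ (star (s i)) ψ = z i • ψ

/-- A `*`-representation as a continuous linear map. -/
def repCLM {A : Type} [NonUnitalCStarAlgebra A] (σ : A →⋆ₙₐ[ℂ] (H →L[ℂ] H)) :
    A →L[ℂ] (H →L[ℂ] H) :=
  LinearMap.mkContinuous { toFun := σ, map_add' := map_add σ, map_smul' := map_smul σ } 1
    fun x => by rw [one_mul]; exact NonUnitalStarAlgHom.norm_apply_le σ x

/-- The vector functional `x ↦ ⟪ψ, σ(x) ψ⟫`. -/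
def vectorFunctional {A : Type} [NonUnitalCStarAlgebra A] (σ : A →⋆ₙₐ[ℂ] (H →L[ℂ] H)) (ψ : H) :
    A →L[ℂ] ℂ :=
  (innerSL ℂ ψ).comp ((ContinuousLinearMap.apply ℂ H ψ).comp (repCLM σ))

lemma vectorFunctional_apply {A : Type} [NonUnitalCStarAlgebra A]
    (σ : A →⋆ₙₐ[ℂ] (H →L[ℂ] H)) (ψ : H) (x : A) :
    vectorFunctional σ ψ x = inner ℂ ψ (σ x ψ) := rfl

lemma rep_star_inner_right {A : Type} [NonUnitalCStarAlgebra A] (σ : A →⋆ₙₐ[ℂ] (H →L[ℂ] H))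
    (x : A) (ξ η : H) : inner ℂ ξ (σ (star x) η) = inner ℂ (σ x ξ) η := by
  rw [map_star, ContinuousLinearMap.star_eq_adjoint, ContinuousLinearMap.adjoint_inner_right]

lemma rep_star_inner_left {A : Type} [NonUnitalCStarAlgebra A] (σ : A →⋆ₙₐ[ℂ] (H →L[ℂ] H))
    (x : A) (ξ η : H) : inner ℂ (σ (star x) ξ) η = inner ℂ ξ (σ x η) := by
  rw [map_star, ContinuousLinearMap.star_eq_adjoint, ContinuousLinearMap.adjoint_inner_left]

lemma rep_mul_apply {A : Type} [NonUnitalCStarAlgebra A] (σ : A →⋆ₙₐ[ℂ] (H →L[ℂ] H))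
    (x y : A) (ξ : H) : σ (x * y) ξ = σ x (σ y ξ) := by
  rw [map_mul]; rfl

namespace IsCuntzVector

variable {z : EuclideanSpace ℂ (Fin n)} {σ : CuntzAlg n →⋆ₙₐ[ℂ] (H →L[ℂ] H)} {ψ : H}

lemma map_one_apply (h : IsCuntzVector z σ ψ) (ξ : H) : σ 1 ξ = ξ := by
  rw [h.map_one]; rfl

lemma inner_self (h : IsCuntzVector z σ ψ) : inner ℂ ψ ψ = 1 := by
  rw [inner_self_eq_norm_sq_to_K, h.norm_eq_one]; simp

lemma star_word (h : IsCuntzVector z σ ψ) (J : List (Fin n)) :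
    σ (star (word J)) ψ = (J.map fun j => z j).prod • ψ := by
  induction J with
  | nil => simp [h.map_one_apply]
  | cons j J ih =>
    rw [word_cons, star_mul, rep_mul_apply, h.star_s, map_smul, ih, smul_smul]
    simp

/-- Moving the word to the other side of the inner product turns it into its eigenvalue. This number
is the scalar that `W` produces on word vectors. -/
lemma inner_word (h : IsCuntzVector z σ ψ) (J : List (Fin n)) :
    inner ℂ ψ (σ (word J) ψ) = (J.map fun j => (starRingEnd ℂ) (z j)).prod := by
  rw [← rep_star_inner_left, h.star_word, inner_smul_left, h.inner_self, mul_one,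
    map_list_prod, List.map_map]
  rfl

/-- The value at `s_J s_K^*` is `⟪s_J^* ψ, s_K^* ψ⟫`, and `ψ` is an eigenvector of both operators.
-/
theorem isCuntzState (h : IsCuntzVector z σ ψ) : IsCuntzState z (vectorFunctional σ ψ) where
  map_one := by rw [vectorFunctional_apply, h.map_one_apply, h.inner_self]
  nonneg a := by
    rw [vectorFunctional_apply, rep_mul_apply, rep_star_inner_right,
      inner_self_eq_norm_sq_to_K]
    simp
  map_word J K _ _ := by
    change vectorFunctional σ ψ (word J * star (word K)) = _
    rw [vectorFunctional_apply, rep_mul_apply, ← rep_star_inner_left, h.star_word, h.star_word,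
      inner_smul_left, inner_smul_right, h.inner_self, mul_one, map_list_prod, List.map_map]
    rfl

/-- A cyclic Cuntz vector is mapped to any other Cuntz vector with the same parameter by an
isometric intertwiner. -/
theorem exists_isometry {τ : CuntzAlg n →⋆ₙₐ[ℂ] (K →L[ℂ] K)} {η : K}
    (h : IsCuntzVector z σ ψ) (hc : DenseRange fun x => σ x ψ) (h' : IsCuntzVector z τ η) :
    ∃ V : H →ₗᵢ[ℂ] K, ∀ x, V (σ x ψ) = τ x η := by
  -- Both squared norms are the value of the unique Cuntz state at `x^* x`.
  have hn : ∀ x, ‖τ x η‖ = ‖σ x ψ‖ := fun x => by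
    have h1 := congrArg (fun ω : CuntzAlg n →L[ℂ] ℂ => ω (star x * x))
      (h.isCuntzState.unique h'.isCuntzState)
    simp only [vectorFunctional_apply, rep_mul_apply, rep_star_inner_right,
      inner_self_eq_norm_sq_to_K] at h1
    have h2 : ‖σ x ψ‖ ^ 2 = ‖τ x η‖ ^ 2 := by exact_mod_cast h1
    exact ((sq_eq_sq₀ (norm_nonneg _) (norm_nonneg _)).mp h2).symm
  let e : CuntzAlg n →ₗ[ℂ] H := ((ContinuousLinearMap.apply ℂ H ψ).comp (repCLM σ)).toLinearMap
  let f : CuntzAlg n →ₗ[ℂ] K := ((ContinuousLinearMap.apply ℂ K η).comp (repCLM τ)).toLinearMap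
  have he : DenseRange e := hc
  -- The equality of norms makes `σ x ψ ↦ τ x η` well defined, although `x ↦ σ x ψ` need not be
  -- injective.
  have hV : ∀ x, f.extendOfNorm e (σ x ψ) = τ x η := fun x =>
    f.extendOfNorm_eq he ⟨1, fun x => by rw [one_mul]; exact (hn x).le⟩ x
  refine ⟨⟨(f.extendOfNorm e).toLinearMap, fun ξ => ?_⟩, hV⟩
  refine hc.induction_on ξ ?_ fun x => ?_
  · exact isClosed_eq (f.extendOfNorm e).continuous.norm continuous_norm
  · exact (congrArg norm (hV x)).trans (hn x)

/-- The word vectors `σ(s_J) ψ` are total if `ψ` is cyclic. -/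
lemma dense_span_word (h : IsCuntzVector z σ ψ) (hc : DenseRange fun x => σ x ψ) :
    Dense (Submodule.span ℂ (Set.range fun J : List (Fin n) => σ (word J) ψ) : Set H) := by
  set M := Submodule.span ℂ (Set.range fun J : List (Fin n) => σ (word J) ψ) with hM
  have hm : ∀ J : List (Fin n), σ (word J) ψ ∈ M := fun J => Submodule.subset_span ⟨J, rfl⟩
  let e : CuntzAlg n →L[ℂ] H := (ContinuousLinearMap.apply ℂ H ψ).comp (repCLM σ)
  have key : ∀ x, σ x ψ ∈ M.topologicalClosure := fun x => by
    -- The set of `x` with `σ x ψ ∈ M` contains `1` and is invariant under the generators and their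
    -- adjoints, so it is dense.
    have hx : x ∈ (M.comap e.toLinearMap).topologicalClosure := by
      refine mem_topologicalClosure ?_ (fun i x hx => ?_) (fun i x hx => ?_) x
      · exact hm []
      · change σ x ψ ∈ M at hx
        change σ (s i * x) ψ ∈ M
        rw [rep_mul_apply]
        -- The vector is made arbitrary so that the induction runs over the span of word vectors.
        generalize σ x ψ = ξ at hx
        induction hx using Submodule.span_induction with
        | mem y hy =>
          obtain ⟨J, rfl⟩ := hy
          dsimp only
          rw [← rep_mul_apply, ← word_cons]
          exact hm _
        | zero => simp
        | add y y' _ _ hy hy' => rw [map_add]; exact M.add_mem hy hy'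
        | smul c y _ hy => rw [map_smul]; exact M.smul_mem c hy
      · change σ x ψ ∈ M at hx
        change σ (star (s i) * x) ψ ∈ M
        rw [rep_mul_apply]
        generalize σ x ψ = ξ at hx
        induction hx using Submodule.span_induction with
        | mem y hy =>
          obtain ⟨J, rfl⟩ := hy
          dsimp only
          cases J with
          -- The eigenvector equation is what keeps the span of word vectors invariant under adjoint
          -- generators: there is no letter left to cancel.
          | nil =>
            rw [word_nil, h.map_one_apply, h.star_s]
            exact M.smul_mem _ (by simpa [h.map_one_apply] using hm [])
          | cons j J =>
            rw [← rep_mul_apply, word_cons, ← mul_assoc, (isCuntzFamily_s n).star_mul]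
            split_ifs
            · rw [one_mul]; exact hm J
            · simp
        | zero => simp
        | add y y' _ _ hy hy' => rw [map_add]; exact M.add_mem hy hy'
        | smul c y _ hy => rw [map_smul]; exact M.smul_mem c hy
    exact map_mem_closure (f := e) e.continuous hx fun y hy => hy
  intro ξ
  exact closure_minimal (by rintro _ ⟨x, rfl⟩; exact key x) M.isClosed_topologicalClosure (hc ξ)

end IsCuntzVector

end CuntzVector

/-! ### Existence of Cuntz states -/

section Shift

/-- The standard basis vector `e_k` of `ℓ²(ℕ)`. -/
def ellTwoBasis (k : ℕ) : lp (fun _ : ℕ => ℂ) 2 := lp.single 2 k (1 : ℂ)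

lemma inner_ellTwoBasis (k l : ℕ) :
    inner ℂ (ellTwoBasis k) (ellTwoBasis l) = if k = l then 1 else 0 := by
  rw [ellTwoBasis, ellTwoBasis, lp.inner_single_left, lp.single_apply]
  by_cases h : k = l
  · subst h; simp
  · simp [h]

lemma norm_ellTwoBasis (k : ℕ) : ‖ellTwoBasis k‖ = 1 := by
  rw [ellTwoBasis, lp.norm_single (by simp), norm_one]

lemma ellTwo_ext {F : Type*} [NormedAddCommGroup F] [NormedSpace ℂ F]
    {S T : lp (fun _ : ℕ => ℂ) 2 →L[ℂ] F} (h : ∀ k, S (ellTwoBasis k) = T (ellTwoBasis k)) :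
    S = T := by
  refine lp.ext_continuousLinearMap (by simp) fun k => ?_
  ext
  exact h k

lemma ellTwo_ext_inner {ξ η : lp (fun _ : ℕ => ℂ) 2}
    (h : ∀ k, inner ℂ (ellTwoBasis k) ξ = inner ℂ (ellTwoBasis k) η) : ξ = η := by
  ext k
  simpa [ellTwoBasis, lp.inner_single_left] using h k

/-- The isometry `e_k ↦ e_{f k}` of `ℓ²(ℕ)` for an injective map `f`. -/
def shiftIsometry (f : ℕ → ℕ) (hf : Function.Injective f) :
    lp (fun _ : ℕ => ℂ) 2 →ₗᵢ[ℂ] lp (fun _ : ℕ => ℂ) 2 :=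
  OrthogonalFamily.linearIsometry (𝕜 := ℂ) (G := fun _ : ℕ => ℂ)
    (V := fun k => LinearIsometry.toSpanSingleton ℂ _ (norm_ellTwoBasis (f k)))
    fun k l hkl v w => by
      simp [LinearIsometry.toSpanSingleton_apply, inner_smul_left, inner_smul_right,
        inner_ellTwoBasis, hf.ne hkl]

lemma shiftIsometry_basis (f : ℕ → ℕ) (hf : Function.Injective f) (k : ℕ) :
    shiftIsometry f hf (ellTwoBasis k) = ellTwoBasis (f k) := by
  refine (OrthogonalFamily.linearIsometry_apply_single _ _).trans ?_
  simp [LinearIsometry.toSpanSingleton_apply]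

lemma shift_injective {n : ℕ} (i : Fin n) : Function.Injective fun k : ℕ => n * k + i := by
  intro k l h
  have hn : 0 < n := i.pos
  exact Nat.eq_of_mul_eq_mul_left hn (Nat.add_right_cancel h)

/-- The operator `e_k ↦ e_{nk+i}` on `ℓ²(ℕ)`. -/
def shift {n : ℕ} (i : Fin n) : lp (fun _ : ℕ => ℂ) 2 →L[ℂ] lp (fun _ : ℕ => ℂ) 2 :=
  (shiftIsometry _ (shift_injective i)).toContinuousLinearMap

lemma shift_basis {n : ℕ} (i : Fin n) (k : ℕ) :
    shift i (ellTwoBasis k) = ellTwoBasis (n * k + i) :=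
  shiftIsometry_basis _ (shift_injective i) _

/-- Division with remainder by `n` recovers both `k` and `j` from `n k + j`, so the ranges of the
`n` shifts are spanned by the residue classes. -/
lemma star_shift_basis {n : ℕ} (i j : Fin n) (k : ℕ) :
    star (shift i) (ellTwoBasis (n * k + j)) = if i = j then ellTwoBasis k else 0 := by
  refine ellTwo_ext_inner fun l => ?_
  rw [ContinuousLinearMap.star_eq_adjoint, ContinuousLinearMap.adjoint_inner_right, shift_basis,
    inner_ellTwoBasis]
  have hij : n * l + (i : ℕ) = n * k + j ↔ l = k ∧ i = j := by
    constructor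
    · intro h
      have h1 := congrArg (· / n) h
      have h2 := congrArg (· % n) h
      have hn : 0 < n := i.pos
      simp only [Nat.mul_add_div hn, Nat.div_eq_of_lt (Fin.is_lt _), Nat.mul_add_mod,
        Nat.mod_eq_of_lt (Fin.is_lt _), add_zero] at h1 h2
      exact ⟨h1, Fin.ext h2⟩
    · rintro ⟨rfl, rfl⟩; rfl
  simp only [hij]
  by_cases h : i = j
  · simp [h, inner_ellTwoBasis]
  · simp [h]

lemma star_shift_mul_shift {n : ℕ} (i j : Fin n) :
    star (shift i) * shift j = if i = j then 1 else 0 := by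
  refine ellTwo_ext fun k => ?_
  rw [mul_apply_eq_comp, shift_basis, star_shift_basis]
  split_ifs <;> rfl

/-- The residue classes modulo `n` exhaust `ℕ`. -/
lemma sum_shift_mul_star (n : ℕ+) : ∑ i : Fin n, shift i * star (shift i) = 1 := by
  refine ellTwo_ext fun k => ?_
  obtain ⟨q, j, rfl⟩ : ∃ (q : ℕ) (j : Fin n), k = n * q + j :=
    ⟨k / n, ⟨k % n, Nat.mod_lt _ n.pos⟩, (Nat.div_add_mod k n).symm⟩
  rw [_root_.sum_apply, Finset.sum_eq_single j]
  · rw [mul_apply_eq_comp, star_shift_basis, if_pos rfl, shift_basis]; rfl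
  · intro i _ hi
    rw [mul_apply_eq_comp, star_shift_basis, if_neg hi, map_zero]
  · simp

/-- Needed for the convention that the generator of `𝒪_1` is the unit. -/
lemma shift_eq_one {n : ℕ} (h : n = 1) (i : Fin n) : shift i = 1 := by
  subst h
  refine ellTwo_ext fun k => ?_
  rw [shift_basis, Subsingleton.elim i 0]
  simp

end Shift

/-! ### Rotating a Cuntz family to reach an arbitrary unit vector. -/

section Existence

variable {n : ℕ+} {B : Type} [CStarAlgebra B]

/-- The rotation of a Cuntz family by a unitary matrix, given by an orthonormal basis. -/
lemma rotate_star_mul {S : Fin n → B} (hS : ∀ i j, star (S i) * S j = if i = j then 1 else 0)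
    (b : OrthonormalBasis (Fin n) ℂ (EuclideanSpace ℂ (Fin n))) (i k : Fin n) :
    star (∑ j, (starRingEnd ℂ) (b j i) • S j) * ∑ j, (starRingEnd ℂ) (b j k) • S j =
      if i = k then 1 else 0 := by
  -- Parseval's identity for `b`, applied to two standard basis vectors: the columns of the
  -- coefficient matrix are orthonormal.
  have h := b.sum_inner_mul_inner (EuclideanSpace.single i (1 : ℂ)) (EuclideanSpace.single k 1)
  simp only [EuclideanSpace.inner_single_left, EuclideanSpace.inner_single_right, map_one,
    one_mul, PiLp.single_apply, @eq_comm _ k i] at h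
  rw [star_sum, Finset.sum_mul_sum]
  simp only [star_smul, smul_mul_smul_comm, hS, smul_ite, smul_zero, Finset.sum_ite_eq,
    Finset.mem_univ, if_true]
  rw [← Finset.sum_smul]
  simp only [RCLike.star_def, RingHomCompTriple.comp_apply, RingHom.id_apply]
  rw [h]
  split_ifs <;> simp

/-- Orthonormality of `b`, that is, of the rows of the coefficient matrix, collapses the double sum
to its diagonal. -/
lemma rotate_mul_star {S : Fin n → B} (hS : ∑ i, S i * star (S i) = 1)
    (b : OrthonormalBasis (Fin n) ℂ (EuclideanSpace ℂ (Fin n))) :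
    ∑ i, (∑ j, (starRingEnd ℂ) (b j i) • S j) * star (∑ j, (starRingEnd ℂ) (b j i) • S j) =
      1 := by
  have h : ∀ j k, ∑ i, (starRingEnd ℂ) (b j i) * b k i = if j = k then 1 else 0 := fun j k => by
    rw [← orthonormal_iff_ite.mp b.orthonormal j k, PiLp.inner_apply]
    exact Finset.sum_congr rfl fun i _ => mul_comm _ _
  simp only [star_sum, Finset.sum_mul_sum, star_smul, smul_mul_smul_comm, RCLike.star_def,
    RingHomCompTriple.comp_apply, RingHom.id_apply]
  rw [Finset.sum_comm]
  rw [← hS]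
  refine Finset.sum_congr rfl fun j _ => ?_
  rw [Finset.sum_comm]
  simp only [← Finset.sum_smul, h, ite_smul, one_smul, zero_smul, Finset.sum_ite_eq,
    Finset.mem_univ, if_true]

/-- The index `0` is chosen because the shift with this index fixes `e_0`. -/
lemma exists_basis {z : EuclideanSpace ℂ (Fin n)} (hz : ‖z‖ = 1) :
    ∃ b : OrthonormalBasis (Fin n) ℂ (EuclideanSpace ℂ (Fin n)), b ⟨0, n.pos⟩ = z := by
  obtain ⟨b, hb⟩ := Orthonormal.exists_orthonormalBasis_extension_of_card_eq (𝕜 := ℂ)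
    (E := EuclideanSpace ℂ (Fin n)) (ι := Fin n) (by simp) (v := fun _ => z)
    (s := {⟨0, n.pos⟩}) (by
      rw [orthonormal_iff_ite]
      rintro ⟨i, hi⟩ ⟨j, hj⟩
      rw [Set.mem_singleton_iff] at hi hj
      subst hi hj
      simp [inner_self_eq_norm_sq_to_K, hz])
  exact ⟨b, hb _ rfl⟩

/-- There is a Cuntz vector for every unit vector `z`. -/
theorem exists_isCuntzVector {z : EuclideanSpace ℂ (Fin n)} (hz : ‖z‖ = 1)
    (h1 : (n : ℕ) = 1 → ∀ i, z i = 1) :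
    ∃ (σ : CuntzAlg n →⋆ₙₐ[ℂ] (lp (fun _ : ℕ => ℂ) 2 →L[ℂ] lp (fun _ : ℕ => ℂ) 2))
      (ψ : lp (fun _ : ℕ => ℂ) 2), IsCuntzVector z σ ψ := by
  obtain ⟨b, hb⟩ := exists_basis hz
  -- The coefficients are conjugated so that the adjoint of the `i`-th operator carries the
  -- coefficients `b j i`, and its action on `e_0` gives the eigenvalue `b 0 i = z i`.
  have hS : IsCuntzFamily fun i : Fin n => ∑ j, (starRingEnd ℂ) (b j i) • shift j :=
    { star_mul := fun i k => rotate_star_mul star_shift_mul_shift b i k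
      sum_mul_star := rotate_mul_star (sum_shift_mul_star n) b
      eq_one := fun hn i => by
        have hu : (Finset.univ : Finset (Fin n)) = {⟨0, n.pos⟩} := by
          ext j
          simp only [Finset.mem_univ, Finset.mem_singleton, true_iff]
          exact Fin.ext (by have := j.2; simp; omega)
        rw [hu, Finset.sum_singleton, hb, h1 hn, map_one, one_smul, shift_eq_one hn] }
  refine ⟨(CuntzAlg.lift _ hS : CuntzAlg n →⋆ₙₐ[ℂ] _), ellTwoBasis 0, ?_, norm_ellTwoBasis 0,
    fun i => ?_⟩
  · exact map_one (CuntzAlg.lift _ hS)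
  · change CuntzAlg.lift _ hS (star (s i)) _ = _
    rw [map_star, lift_s, star_sum, _root_.sum_apply]
    -- Since `0 = n * 0 + 0`, the vector `e_0` lies in the range of the shift with index `0` and is
    -- killed by the other adjoints.
    have h0 : ∀ j : Fin n, star (shift j) (ellTwoBasis 0) =
        if j = ⟨0, n.pos⟩ then ellTwoBasis 0 else 0 := fun j => by
      have := star_shift_basis j ⟨0, n.pos⟩ 0
      simpa using this
    rw [Finset.sum_eq_single ⟨0, n.pos⟩]
    · rw [star_smul, _root_.smul_apply, h0, if_pos rfl, hb]
      simp
    · intro j _ hj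
      rw [star_smul, _root_.smul_apply, h0, if_neg hj, smul_zero]
    · simp

theorem existsUnique_isCuntzState {z : EuclideanSpace ℂ (Fin n)} (hz : ‖z‖ = 1)
    (h1 : (n : ℕ) = 1 → ∀ i, z i = 1) : ∃! ω : CuntzAlg n →L[ℂ] ℂ, IsCuntzState z ω := by
  obtain ⟨σ, ψ, h⟩ := exists_isCuntzVector hz h1
  exact ⟨_, h.isCuntzState, fun ω hω => hω.unique h.isCuntzState⟩

end Existence

/-- The GNS construction. -/
theorem IsState.exists_gns {A : Type} [CStarAlgebra A] {ω : A →L[ℂ] ℂ} (hω : IsState ω) :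
    ∃ (H : Type) (_ : NormedAddCommGroup H) (_ : InnerProductSpace ℂ H) (_ : CompleteSpace H)
      (π : A →⋆ₐ[ℂ] (H →L[ℂ] H)) (Ω : H),
      (∀ x, inner ℂ Ω (π x Ω) = ω x) ∧ DenseRange fun x => π x Ω := by
  -- In the spectral order the positive elements are exactly the `b^* b`, so a state is a positive
  -- functional.
  let _ := CStarAlgebra.spectralOrder A
  have := CStarAlgebra.spectralOrderedRing A
  let f : A →ₚ[ℂ] ℂ := PositiveLinearMap.mk₀ ω.toLinearMap fun x hx => by
    obtain ⟨b, rfl⟩ := CStarAlgebra.nonneg_iff_eq_star_mul_self.mp hx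
    exact hω.nonneg b
  -- With `Ω` the class of `1`, the vector `π(x) Ω` is the class of `x`. Both claims about `Ω`
  -- follow from this.
  have hπ : ∀ x : A, f.gnsStarAlgHom x ((f.toPreGNS 1 : f.PreGNS) : f.GNS) =
      ((f.toPreGNS x : f.PreGNS) : f.GNS) := fun x => by
    refine (f.gnsNonUnitalStarAlgHom_apply_coe).trans ?_
    rw [PositiveLinearMap.leftMulMapPreGNS_apply, PositiveLinearMap.ofPreGNS_toPreGNS, mul_one]
  refine ⟨f.GNS, inferInstance, inferInstance, inferInstance, f.gnsStarAlgHom,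
    ((f.toPreGNS 1 : f.PreGNS) : f.GNS), fun x => ?_, ?_⟩
  · rw [hπ, UniformSpace.Completion.inner_coe, PositiveLinearMap.preGNS_inner_def]
    simp [f]
    rfl
  · simp_rw [hπ]
    exact UniformSpace.Completion.denseRange_coe.comp f.toPreGNS.surjective.denseRange
      (UniformSpace.Completion.continuous_coe _)

/-! ### Consequences of multiplicativity of the sequence of vectors. -/

namespace IsMultiplicativeSeq

variable {z : ∀ n : ℕ+, EuclideanSpace ℂ (Fin n)}

lemma mul_apply (hz : IsMultiplicativeSeq z) (n m : ℕ+) (p : Fin (n * m : ℕ+)) :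
    z (n * m) p = z n (splitIndex n m p).1 * z m (splitIndex n m p).2 := by
  rw [← hz.boxTimes_eq]; rfl

/-- The relation `z^{(1)} ⊠ z^{(1)} = z^{(1)}` makes the only coordinate of `z^{(1)}` an idempotent
number, nonzero because the vector has norm one. -/
lemma one_apply (hz : IsMultiplicativeSeq z) {n : ℕ+} (hn : (n : ℕ) = 1) (i : Fin n) :
    z n i = 1 := by
  obtain rfl : n = 1 := PNat.coe_eq_one_iff.mp hn
  have hsub : ∀ i j : Fin (1 : ℕ+), i = j := fun i j => Fin.ext (by
    have := i.2; have := j.2; simp only [PNat.one_coe] at *; omega)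
  have h1 : z 1 i = z 1 i * z 1 i := by
    have h := hz.mul_apply 1 1 i
    rw [hsub (splitIndex 1 1 i).1 i, hsub (splitIndex 1 1 i).2 i] at h
    exact h
  have h0 : z 1 i ≠ 0 := fun h0 => by
    have h2 : z 1 = 0 := by
      ext j
      rw [hsub j i, h0]; rfl
    have := hz.norm_eq_one 1
    rw [h2, norm_zero] at this
    exact zero_ne_one this
  exact (mul_left_cancel₀ h0 (by rw [mul_one]; exact h1)).symm

theorem existsUnique_isCuntzState (hz : IsMultiplicativeSeq z) (n : ℕ+) :
    ∃! ω : CuntzAlg n →L[ℂ] ℂ, IsCuntzState (z n) ω :=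
  _root_.existsUnique_isCuntzState (hz.norm_eq_one n) fun hn => hz.one_apply hn

theorem nonempty_cuntzGNS (hz : IsMultiplicativeSeq z) : Nonempty (CuntzGNS z) := by
  choose ω hω using fun n => (hz.existsUnique_isCuntzState n).exists
  choose H i1 i2 i3 π Ω hΩ hc using fun n => (hω n).toIsState.exists_gns
  exact ⟨@CuntzGNS.mk z H i1 i2 i3 ω hω π Ω hΩ hc⟩

end IsMultiplicativeSeq

/-! ### Tools for Hilbert space tensor products -/

namespace HTensor

variable {E F G H V : Type*}
  [NormedAddCommGroup E] [InnerProductSpace ℂ E] [NormedAddCommGroup F] [InnerProductSpace ℂ F]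
  [NormedAddCommGroup G] [InnerProductSpace ℂ G] [NormedAddCommGroup H] [InnerProductSpace ℂ H]
  [NormedAddCommGroup V] [NormedSpace ℂ V]

lemma norm_tmul (x : E) (y : F) : ‖tmul x y‖ = ‖x‖ * ‖y‖ := by
  rw [tmul, LinearIsometry.norm_map, TensorProduct.norm_tmul]

/-- The map `y ↦ x ⊗ y`. -/
def tmulRight (F : Type*) [NormedAddCommGroup F] [InnerProductSpace ℂ F] (x : E) :
    F →L[ℂ] HTensor E F :=
  LinearMap.mkContinuous
    { toFun := fun y => tmul x y, map_add' := tmul_add x, map_smul' := fun c y => tmul_smul c x y }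
    ‖x‖ fun y => (norm_tmul x y).le

/-- The map `x ↦ x ⊗ y`. -/
def tmulLeft (E : Type*) [NormedAddCommGroup E] [InnerProductSpace ℂ E] (y : F) :
    E →L[ℂ] HTensor E F :=
  LinearMap.mkContinuous
    { toFun := fun x => tmul x y, map_add' := fun x x' => add_tmul x x' y,
      map_smul' := fun c x => smul_tmul c x y }
    ‖y‖ fun x => by rw [mul_comm]; exact (norm_tmul x y).le

lemma zero_tmul (y : F) : tmul (0 : E) y = 0 := map_zero (tmulLeft E y)

lemma tmul_zero (x : E) : tmul x (0 : F) = 0 := map_zero (tmulRight F x)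

/-- Bounded operators on a Hilbert tensor product agree if they agree on the tensors of the
elements of two total sets. -/
lemma ext_total {s : Set E} {t : Set F} (hs : Dense (Submodule.span ℂ s : Set E))
    (ht : Dense (Submodule.span ℂ t : Set F)) {S T : HTensor E F →L[ℂ] V}
    (h : ∀ x ∈ s, ∀ y ∈ t, S (tmul x y) = T (tmul x y)) : S = T := by
  have h1 : ∀ x ∈ s, S.comp (tmulRight F x) = T.comp (tmulRight F x) := fun x hx =>
    ContinuousLinearMap.ext_on ht fun y hy => h x hx y hy
  have h2 : ∀ y, S.comp (tmulLeft E y) = T.comp (tmulLeft E y) := fun y =>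
    ContinuousLinearMap.ext_on hs fun x hx => DFunLike.congr_fun (h1 x hx) y
  exact ext fun x y => DFunLike.congr_fun (h2 y) x

/-- A submodule which contains the tensors of the elements of two total sets is dense. -/
lemma topologicalClosure_eq_top {s : Set E} {t : Set F}
    (hs : Dense (Submodule.span ℂ s : Set E)) (ht : Dense (Submodule.span ℂ t : Set F))
    {p : Submodule ℂ (HTensor E F)} (h : ∀ x ∈ s, ∀ y ∈ t, tmul x y ∈ p) :
    p.topologicalClosure = ⊤ := by
  rw [Submodule.topologicalClosure_eq_top_iff, Submodule.eq_bot_iff]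
  intro ζ hζ
  -- The functional of a vector orthogonal to `p` vanishes on a total set of tensors, hence
  -- identically.
  have h0 : innerSL ℂ ζ = 0 := ext_total hs ht fun x hx y hy => by
    rw [innerSL_apply_apply]
    exact (Submodule.mem_orthogonal' p ζ).mp hζ _ (h x hx y hy)
  have := DFunLike.congr_fun h0 ζ
  rwa [innerSL_apply_apply, _root_.zero_apply, inner_self_eq_zero] at this

/-- Inner products of elementary tensors factor, so orthogonality in one leg is enough. This
separates the summands `H_n ⊗ H_m` of `H ⊗ H`. -/
lemma inner_map_map_eq_zero {S : E →L[ℂ] G} {T : F →L[ℂ] H} {E' F' : Type*}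
    [NormedAddCommGroup E'] [InnerProductSpace ℂ E'] [NormedAddCommGroup F']
    [InnerProductSpace ℂ F'] {S' : E' →L[ℂ] G} {T' : F' →L[ℂ] H}
    (h : (∀ x x', inner ℂ (S x) (S' x') = 0) ∨ ∀ y y', inner ℂ (T y) (T' y') = 0)
    (ζ : HTensor E F) (ζ' : HTensor E' F') : inner ℂ (map S T ζ) (map S' T' ζ') = 0 := by
  have h1 : ∀ x y x' y', inner ℂ (map S T (tmul x y)) (map S' T' (tmul x' y')) = 0 := by
    intro x y x' y'
    rw [map_tmul, map_tmul, inner_tmul]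
    rcases h with h | h <;> simp [h]
  have h2 : ∀ x' y', inner ℂ (map S T ζ) (map S' T' (tmul x' y')) = 0 := fun x' y' => by
    -- The inner product is linear only in its second argument; conjugation moves `ζ` there so that
    -- extensionality of bounded operators applies.
    rw [← inner_conj_symm]
    have : (innerSL ℂ (map S' T' (tmul x' y'))).comp (map S T) = 0 := ext fun x y => by
      rw [ContinuousLinearMap.comp_apply, innerSL_apply_apply, ← inner_conj_symm, h1]; simp
    have := DFunLike.congr_fun this ζ
    rw [ContinuousLinearMap.comp_apply, innerSL_apply_apply] at this
    rw [this]; simp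
  have : (innerSL ℂ (map S T ζ)).comp (map S' T') = 0 := ext fun x' y' => h2 x' y'
  exact DFunLike.congr_fun this ζ'

lemma norm_map_isometry (f : E →ₗᵢ[ℂ] G) (g : F →ₗᵢ[ℂ] H) (ζ : HTensor E F) :
    ‖map f.toContinuousLinearMap g.toContinuousLinearMap ζ‖ = ‖ζ‖ := by
  induction ζ using induction_on with
  | hc => exact isClosed_eq (map _ _).continuous.norm continuous_norm
  | h x =>
    rw [map_ofAlg, LinearIsometry.norm_map, LinearIsometry.norm_map]
    have hx : TensorProduct.mapL f.toContinuousLinearMap g.toContinuousLinearMap x =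
        TensorProduct.mapIsometry f g x := by
      induction x using TensorProduct.induction_on with
      | zero => rw [_root_.map_zero, _root_.map_zero]
      | add x y hx hy => rw [_root_.map_add, _root_.map_add, hx, hy]
      | tmul x y => rw [TensorProduct.mapL_tmul, TensorProduct.mapIsometry_apply]; rfl
    rw [hx, LinearIsometry.norm_map]

/-- The isometry `f ⊗ g` for isometries `f` and `g`. -/
def mapIsometry (f : E →ₗᵢ[ℂ] G) (g : F →ₗᵢ[ℂ] H) : HTensor E F →ₗᵢ[ℂ] HTensor G H where
  toLinearMap := (map f.toContinuousLinearMap g.toContinuousLinearMap).toLinearMap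
  norm_map' := norm_map_isometry f g

/-- The isometry `x ↦ x ⊗ y` for a unit vector `y`. -/
def tmulLeftIsometry (E : Type*) [NormedAddCommGroup E] [InnerProductSpace ℂ E] {y : F}
    (hy : ‖y‖ = 1) : E →ₗᵢ[ℂ] HTensor E F where
  toLinearMap := (tmulLeft E y).toLinearMap
  norm_map' x := (norm_tmul x y).trans (by rw [hy, mul_one])

end HTensor

/-! ### Tensor products of Cuntz vectors -/

section TensorVector

variable {H : Type} [NormedAddCommGroup H] [InnerProductSpace ℂ H] [CompleteSpace H]
  {K : Type} [NormedAddCommGroup K] [InnerProductSpace ℂ K] [CompleteSpace K]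

/-- The representation `(π ⊗ σ) ∘ φ_{n,m}` of `𝒪_{nm}`. -/
def tensorRep {n m : ℕ+} (π : CuntzAlg n →⋆ₙₐ[ℂ] (H →L[ℂ] H))
    (σ : CuntzAlg m →⋆ₙₐ[ℂ] (K →L[ℂ] K)) :
    CuntzAlg (n * m : ℕ+) →⋆ₙₐ[ℂ] (HTensor H K →L[ℂ] HTensor H K) :=
  (MinTensor.rep π σ).comp (phi n m : CuntzAlg (n * m : ℕ+) →⋆ₙₐ[ℂ] _)

lemma tensorRep_apply {n m : ℕ+} (π : CuntzAlg n →⋆ₙₐ[ℂ] (H →L[ℂ] H))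
    (σ : CuntzAlg m →⋆ₙₐ[ℂ] (K →L[ℂ] K)) (x : CuntzAlg (n * m : ℕ+)) :
    tensorRep π σ x = MinTensor.rep π σ (phi n m x) := rfl

/-- The word `i_1 ⋯ i_a` of first indices of a word in pairs. -/
def fstWord (n m : ℕ+) (P : List (Fin (n * m : ℕ+))) : List (Fin n) :=
  P.map fun p => (splitIndex n m p).1

/-- The word `j_1 ⋯ j_a` of second indices of a word in pairs. -/
def sndWord (n m : ℕ+) (P : List (Fin (n * m : ℕ+))) : List (Fin m) :=
  P.map fun p => (splitIndex n m p).2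

/-- Words are split letter by letter, so the two resulting words have the same length. -/
lemma phi_word (n m : ℕ+) (P : List (Fin (n * m : ℕ+))) :
    phi n m (word P) = MinTensor.tmul (word (fstWord n m P)) (word (sndWord n m P)) := by
  induction P with
  | nil => exact map_one (phi n m)
  | cons p P ih =>
    rw [word_cons, map_mul, ih, phi_s, MinTensor.tmul_mul_tmul, fstWord, fstWord, sndWord, sndWord,
      List.map_cons, List.map_cons, word_cons, word_cons]

lemma tensorRep_word {n m : ℕ+} (π : CuntzAlg n →⋆ₙₐ[ℂ] (H →L[ℂ] H))
    (σ : CuntzAlg m →⋆ₙₐ[ℂ] (K →L[ℂ] K)) (P : List (Fin (n * m : ℕ+))) (x : H) (y : K) :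
    tensorRep π σ (word P) (HTensor.tmul x y) =
      HTensor.tmul (π (word (fstWord n m P)) x) (σ (word (sndWord n m P)) y) := by
  rw [tensorRep_apply, phi_word, MinTensor.rep_tmul, HTensor.map_tmul]

/-- Equal length is the only constraint on the two halves of a word, because splitting a letter is a
bijection. -/
lemma exists_word_of_length_eq {n m : ℕ+} (J : List (Fin n)) (K : List (Fin m))
    (h : J.length = K.length) : ∃ P, fstWord n m P = J ∧ sndWord n m P = K := by
  induction J generalizing K with
  | nil =>
    obtain rfl := List.length_eq_zero_iff.mp h.symm
    exact ⟨[], rfl, rfl⟩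
  | cons i J ih =>
    obtain _ | ⟨j, K⟩ := K
    · simp at h
    · obtain ⟨P, hP⟩ := ih K (by simpa using h)
      refine ⟨(splitIndex n m).symm (i, j) :: P, ?_⟩
      rw [← hP.1, ← hP.2, fstWord, sndWord, List.map_cons, List.map_cons,
        (splitIndex n m).apply_symm_apply]
      exact ⟨rfl, rfl⟩

namespace IsCuntzVector

variable {n m : ℕ+} {z : EuclideanSpace ℂ (Fin n)} {π : CuntzAlg n →⋆ₙₐ[ℂ] (H →L[ℂ] H)} {ψ : H}
  {y : EuclideanSpace ℂ (Fin m)} {σ : CuntzAlg m →⋆ₙₐ[ℂ] (K →L[ℂ] K)} {η : K}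

/-- The eigenvalues of `s_i^* ⊗ s_j^*` on `ψ ⊗ η` are the products `z_i y_j`. -/
theorem tensor (h : IsCuntzVector z π ψ) (h' : IsCuntzVector y σ η) :
    IsCuntzVector (boxTimes z y) (tensorRep π σ) (HTensor.tmul ψ η) where
  map_one := by
    rw [tensorRep_apply, _root_.map_one, MinTensor.one_def, MinTensor.rep_tmul, h.map_one,
      h'.map_one, HTensor.map_one_one]
  norm_eq_one := by rw [HTensor.norm_tmul, h.norm_eq_one, h'.norm_eq_one, mul_one]
  star_s p := by
    rw [tensorRep_apply, map_star, phi_s, MinTensor.star_tmul, MinTensor.rep_tmul,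
      HTensor.map_tmul, h.star_s, h'.star_s, HTensor.smul_tmul, HTensor.tmul_smul, smul_smul]
    rfl

/-- Inserting `∑ s_l s_l^*` between the word and `ψ` appends a letter, at the cost of the eigenvalue
of `s_l^*`. -/
lemma word_eq_sum (h : IsCuntzVector z π ψ) (J : List (Fin n)) :
    π (word J) ψ = ∑ l, z l • π (word (J ++ [l])) ψ := by
  conv_lhs => rw [CuntzAlg.word_eq_sum, map_sum, _root_.sum_apply]
  refine Finset.sum_congr rfl fun l _ => ?_
  rw [rep_mul_apply, h.star_word, map_smul]
  simp

/-- Appending letters repeatedly lets a word be replaced by words of any prescribed greater length.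
This removes the equal-length constraint in the surjectivity argument. -/
lemma word_mem_span (h : IsCuntzVector z π ψ) (J : List (Fin n)) {N : ℕ} (hN : J.length ≤ N) :
    π (word J) ψ ∈ Submodule.span ℂ ((fun J => π (word J) ψ) '' {J | J.length = N}) := by
  obtain ⟨k, rfl⟩ := Nat.exists_eq_add_of_le hN
  induction k generalizing J with
  | zero => exact Submodule.subset_span ⟨J, rfl, rfl⟩
  | succ k ih =>
    rw [h.word_eq_sum]
    refine Submodule.sum_mem _ fun l _ => Submodule.smul_mem _ _ ?_
    have := ih (J ++ [l]) (by simp)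
    rwa [List.length_append, List.length_singleton, add_assoc, add_comm 1 k] at this

/-- If `ψ` and `η` are cyclic Cuntz vectors, then `ψ ⊗ η` is cyclic for `(π ⊗ σ) ∘ φ_{n,m}`. -/
theorem exists_unitary (h : IsCuntzVector z π ψ) (h' : IsCuntzVector y σ η)
    (hc : DenseRange fun x => π x ψ) (hc' : DenseRange fun x => σ x η) {L : Type}
    [NormedAddCommGroup L] [InnerProductSpace ℂ L] [CompleteSpace L]
    {τ : CuntzAlg (n * m : ℕ+) →⋆ₙₐ[ℂ] (L →L[ℂ] L)} {ξ : L}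
    (hτ : IsCuntzVector (boxTimes z y) τ ξ) (hcτ : DenseRange fun x => τ x ξ) :
    ∃ V : L ≃ₗᵢ[ℂ] HTensor H K, ∀ x, V (τ x ξ) = tensorRep π σ x (HTensor.tmul ψ η) := by
  obtain ⟨V, hV⟩ := hτ.exists_isometry hcτ (h.tensor h')
  refine ⟨LinearIsometryEquiv.ofSurjective V ?_, hV⟩
  have hcl : IsClosed (LinearMap.range V.toLinearMap : Set (HTensor H K)) :=
    V.isometry.isClosedEmbedding.isClosed_range
  -- Words of equal length are the two halves of a single word `P`, whose vector maps to their
  -- tensor.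
  have h1 : ∀ J K, J.length = K.length →
      HTensor.tmul (π (word J) ψ) (σ (word K) η) ∈ LinearMap.range V.toLinearMap := by
    intro J K hJK
    obtain ⟨P, rfl, rfl⟩ := exists_word_of_length_eq J K hJK
    exact ⟨τ (word P) ξ, (hV _).trans (tensorRep_word _ _ _ _ _)⟩
  have h2 : ∀ J K, HTensor.tmul (π (word J) ψ) (σ (word K) η) ∈
      LinearMap.range V.toLinearMap := by
    intro J K
    -- The common length `J.length + K.length` is at least both lengths. The word `J` is lengthened
    -- first, against a fixed `K'` of that length, and `K` afterwards.
    have a1 : ∀ K', K'.length = J.length + K.length →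
        HTensor.tmul (π (word J) ψ) (σ (word K') η) ∈ LinearMap.range V.toLinearMap := by
      intro K' hK'
      have hle : Submodule.span ℂ ((fun J => π (word J) ψ) '' {J' | J'.length = K'.length}) ≤
          (LinearMap.range V.toLinearMap).comap
            (HTensor.tmulLeft H (σ (word K') η)).toLinearMap := by
        rw [Submodule.span_le]
        rintro _ ⟨J', hJ', rfl⟩
        exact h1 J' K' hJ'
      exact hle (h.word_mem_span J (by omega))
    have hle : Submodule.span ℂ
        ((fun J => σ (word J) η) '' {K' | K'.length = J.length + K.length}) ≤
          (LinearMap.range V.toLinearMap).comap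
            (HTensor.tmulRight _ (π (word J) ψ)).toLinearMap := by
      rw [Submodule.span_le]
      rintro _ ⟨K', hK', rfl⟩
      exact a1 K' hK'
    exact hle (h'.word_mem_span K (by omega))
  have h3 := HTensor.topologicalClosure_eq_top (h.dense_span_word hc) (h'.dense_span_word hc')
    (p := LinearMap.range V.toLinearMap) (by
      rintro _ ⟨J, rfl⟩ _ ⟨K, rfl⟩
      exact h2 J K)
  -- The range of an isometry on a complete space is closed, so density gives surjectivity.
  rw [hcl.submodule_topologicalClosure_eq] at h3
  exact LinearMap.range_eq_top.mp h3

end IsCuntzVector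

end TensorVector

/-! ### The operator `W` -/

namespace IsCuntzState

variable {n : ℕ} {z : EuclideanSpace ℂ (Fin n)} {ω : CuntzAlg n →L[ℂ] ℂ}
  {H : Type} [NormedAddCommGroup H] [InnerProductSpace ℂ H] [CompleteSpace H]

/-- A single generator is not among the elements with prescribed value. Writing it as `∑_l s_i s_l
s_l^*` reduces to those, and the sum over `l` is `‖z‖² = 1`. -/
lemma map_s (h : IsCuntzState z ω) (hz : ‖z‖ = 1) (i : Fin n) :
    ω (s i) = (starRingEnd ℂ) (z i) := by
  have h1 : s i = ∑ l, word [i, l] * star (word [l]) := by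
    have := CuntzAlg.word_eq_sum [i]
    simpa using this
  have h2 : ∀ l, ω (word [i, l] * star (word [l])) =
      (starRingEnd ℂ) (z i) * ((starRingEnd ℂ) (z l) * z l) := fun l => by
    refine (h.map_word [i, l] [l] (by simp) (by simp)).trans ?_
    simp [mul_assoc]
  have h3 : ∑ l, (starRingEnd ℂ) (z l) * z l = 1 := by
    have := inner_self_eq_norm_sq_to_K (𝕜 := ℂ) z
    rw [hz, PiLp.inner_apply] at this
    simp_rw [mul_comm]
    exact this.trans (by simp)
  rw [h1, map_sum, Finset.sum_congr rfl fun l _ => h2 l, ← Finset.mul_sum, h3, mul_one]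

/-- The GNS vector of a Cuntz state is a Cuntz vector. -/
theorem isCuntzVector (h : IsCuntzState z ω) (hz : ‖z‖ = 1)
    {π : CuntzAlg n →⋆ₙₐ[ℂ] (H →L[ℂ] H)} {Ω : H} (h1 : π 1 = 1)
    (hω : ∀ x, inner ℂ Ω (π x Ω) = ω x) : IsCuntzVector z π Ω where
  map_one := h1
  norm_eq_one := by
    have h0 := hω 1
    rw [h1, h.map_one, one_apply_eq_self, inner_self_eq_norm_sq_to_K] at h0
    rw [← RCLike.ofReal_pow] at h0
    exact (pow_eq_one_iff_of_nonneg (norm_nonneg Ω) two_ne_zero).mp (Complex.ofReal_eq_one.mp h0)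
  star_s i := by
    have a1 : inner ℂ (π (star (s i)) Ω) (π (star (s i)) Ω) = (starRingEnd ℂ) (z i) * z i := by
      rw [rep_star_inner_left, ← rep_mul_apply, hω]
      have := h.map_word [i] [i] (by simp) (by simp)
      simpa using this
    have a2 : inner ℂ (π (star (s i)) Ω) Ω = (starRingEnd ℂ) (z i) := by
      rw [rep_star_inner_left, hω, h.map_s hz]
    have a3 : inner ℂ Ω (π (star (s i)) Ω) = z i := by
      rw [← inner_conj_symm, a2, Complex.conj_conj]
    have a4 : inner ℂ Ω Ω = (1 : ℂ) := by
      have := hω 1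
      rwa [h1, h.map_one, one_apply_eq_self] at this
    -- All four terms in the expansion of `‖s_i^* Ω - z_i Ω‖²` equal `|z_i|²` up to sign, and they
    -- cancel.
    rw [← sub_eq_zero, ← inner_self_eq_zero (𝕜 := ℂ), inner_sub_sub_self, inner_smul_left,
      inner_smul_right, inner_smul_right, inner_smul_left, a1, a2, a3, a4]
    ring

end IsCuntzState

/-! ### The unitaries `V_{n,m}` and the construction of `W` from its adjoint. -/

namespace CuntzGNS

variable {z : ∀ n : ℕ+, EuclideanSpace ℂ (Fin n)} (G : CuntzGNS z)

lemma isCuntzVector (hz : IsMultiplicativeSeq z) (n : ℕ+) :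
    IsCuntzVector (z n) (G.rep n) (G.Ω n) :=
  (G.isCuntzState n).isCuntzVector (hz.norm_eq_one n) (map_one (G.π n)) (G.inner_Ω n)

lemma cyclic_rep (n : ℕ+) : DenseRange fun x => G.rep n x (G.Ω n) := G.cyclic n

/-- The vector `π_n(s_J) Ω_n`. -/
def wordVec (n : ℕ+) (J : List (Fin n)) : G.H n := G.rep n (word J) (G.Ω n)

lemma dense_span_wordVec (hz : IsMultiplicativeSeq z) (n : ℕ+) :
    Dense (Submodule.span ℂ (Set.range (G.wordVec n)) : Set (G.H n)) :=
  (G.isCuntzVector hz n).dense_span_word (G.cyclic_rep n)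

lemma exists_unitary (hz : IsMultiplicativeSeq z) (n m : ℕ+) :
    ∃ V : G.H (n * m) ≃ₗᵢ[ℂ] HTensor (G.H n) (G.H m), ∀ x, V (G.rep (n * m) x (G.Ω (n * m))) =
      tensorRep (G.rep n) (G.rep m) x (HTensor.tmul (G.Ω n) (G.Ω m)) := by
  refine (G.isCuntzVector hz n).exists_unitary (G.isCuntzVector hz m) (G.cyclic_rep n)
    (G.cyclic_rep m) ?_ (G.cyclic_rep (n * m))
  rw [hz.boxTimes_eq]
  exact G.isCuntzVector hz (n * m)

/-- The unitary `V_{n,m} : H_{nm} → H_n ⊗ H_m` with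
`V_{n,m} π_{nm}(x) Ω_{nm} = (π_n ⊗ π_m)(φ_{n,m}(x)) (Ω_n ⊗ Ω_m)`. -/
def unitary (hz : IsMultiplicativeSeq z) (n m : ℕ+) :
    G.H (n * m) ≃ₗᵢ[ℂ] HTensor (G.H n) (G.H m) :=
  (G.exists_unitary hz n m).choose

lemma unitary_apply (hz : IsMultiplicativeSeq z) (n m : ℕ+) (x : CuntzAlg (n * m : ℕ+)) :
    G.unitary hz n m (G.rep (n * m) x (G.Ω (n * m))) =
      tensorRep (G.rep n) (G.rep m) x (HTensor.tmul (G.Ω n) (G.Ω m)) :=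
  (G.exists_unitary hz n m).choose_spec x

lemma unitary_wordVec (hz : IsMultiplicativeSeq z) (n m : ℕ+) (P : List (Fin (n * m : ℕ+))) :
    G.unitary hz n m (G.wordVec (n * m) P) =
      HTensor.tmul (G.wordVec n (fstWord n m P)) (G.wordVec m (sndWord n m P)) := by
  rw [wordVec, unitary_apply, tensorRep_word]; rfl

/-- The intertwining relation holds on the dense orbit of `Ω_{nm}`. -/
lemma unitary_rep (hz : IsMultiplicativeSeq z) (n m : ℕ+) (x : CuntzAlg (n * m : ℕ+))
    (u : G.H (n * m)) : G.unitary hz n m (G.rep (n * m) x u) =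
      tensorRep (G.rep n) (G.rep m) x (G.unitary hz n m u) := by
  refine (G.cyclic_rep (n * m)).induction_on u ?_ fun y => ?_
  · exact isClosed_eq ((G.unitary hz n m).continuous.comp (G.rep (n * m) x).continuous)
      ((tensorRep (G.rep n) (G.rep m) x).continuous.comp (G.unitary hz n m).continuous)
  · rw [← rep_mul_apply, unitary_apply, unitary_apply, rep_mul_apply]

/-- The inclusion `H_n → H` as an isometry. -/
def inclIsometry (n : ℕ+) : G.H n →ₗᵢ[ℂ] G.HSum where
  toLinearMap := (G.incl n).toLinearMap
  norm_map' := lp.norm_single (by simp) n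

lemma inner_incl_incl_of_ne {n m : ℕ+} (h : n ≠ m) (u : G.H n) (v : G.H m) :
    Inner.inner ℂ (G.incl n u) (G.incl m v) = 0 := by
  refine (lp.inner_single_left n u _).trans ?_
  have : (G.incl m v) n = 0 := by
    refine (lp.single_apply 2 m v n).trans ?_
    exact Pi.single_eq_of_ne h v
  rw [this, inner_zero_right]

lemma inner_incl_incl {n : ℕ+} (u v : G.H n) :
    Inner.inner ℂ (G.incl n u) (G.incl n v) = Inner.inner ℂ u v :=
  (G.inclIsometry n).inner_map_map u v

/-- The isometric inclusion `H_n ⊗ H_m → H ⊗ H`. -/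
def inclTensor (p : ℕ+ × ℕ+) :
    HTensor (G.H p.1) (G.H p.2) →ₗᵢ[ℂ] HTensor G.HSum G.HSum :=
  HTensor.mapIsometry (G.inclIsometry p.1) (G.inclIsometry p.2)

lemma inclTensor_apply (p : ℕ+ × ℕ+) (ζ : HTensor (G.H p.1) (G.H p.2)) :
    G.inclTensor p ζ = HTensor.map (G.incl p.1) (G.incl p.2) ζ := rfl

lemma inclTensor_tmul (p : ℕ+ × ℕ+) (u : G.H p.1) (v : G.H p.2) :
    G.inclTensor p (HTensor.tmul u v) = HTensor.tmul (G.incl p.1 u) (G.incl p.2 v) :=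
  HTensor.map_tmul _ _ _ _

lemma orthogonalFamily_inclTensor :
    OrthogonalFamily ℂ (fun p : ℕ+ × ℕ+ => HTensor (G.H p.1) (G.H p.2)) G.inclTensor := by
  intro p q hpq ζ ζ'
  rw [inclTensor_apply, inclTensor_apply]
  refine HTensor.inner_map_map_eq_zero ?_ ζ ζ'
  by_cases h : p.1 = q.1
  · exact Or.inr fun u v => G.inner_incl_incl_of_ne (fun h' => hpq (Prod.ext h h')) u v
  · exact Or.inl fun u v => G.inner_incl_incl_of_ne h u v

lemma dense_span_incl {t : ∀ n, Set (G.H n)}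
    (ht : ∀ n, Dense (Submodule.span ℂ (t n) : Set (G.H n))) :
    Dense (Submodule.span ℂ (⋃ n, G.incl n '' t n) : Set G.HSum) := by
  rw [Submodule.dense_iff_topologicalClosure_eq_top,
    Submodule.topologicalClosure_eq_top_iff, Submodule.eq_bot_iff]
  intro ξ hξ
  have h0 : innerSL ℂ ξ = 0 := by
    refine lp.ext_continuousLinearMap (by simp) fun n => ?_
    refine ContinuousLinearMap.ext_on (ht n) fun u hu => ?_
    exact (Submodule.mem_orthogonal' _ ξ).mp hξ _
      (Submodule.subset_span (Set.mem_iUnion.mpr ⟨n, u, hu, rfl⟩))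
  have := DFunLike.congr_fun h0 ξ
  rwa [innerSL_apply_apply, _root_.zero_apply, inner_self_eq_zero] at this

/-- The elements of the summands are total in `H`. -/
lemma dense_span_range_incl :
    Dense (Submodule.span ℂ (⋃ n, Set.range (G.incl n)) : Set G.HSum) := by
  have := G.dense_span_incl (t := fun n => Set.univ) fun n => by simp
  simpa only [Set.image_univ] using this

/-- Tensors of vectors taken from summands are total in `H ⊗ H`. This allows `W^*` to be prescribed
separately on each `H_n ⊗ H_m`. -/
lemma isHilbertSum_inclTensor :
    IsHilbertSum ℂ (fun p : ℕ+ × ℕ+ => HTensor (G.H p.1) (G.H p.2)) G.inclTensor := by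
  refine IsHilbertSum.mk G.orthogonalFamily_inclTensor (top_le_iff.mpr ?_)
  refine HTensor.topologicalClosure_eq_top G.dense_span_range_incl G.dense_span_range_incl ?_
  intro x hx y hy
  obtain ⟨n, u, rfl⟩ := Set.mem_iUnion.mp hx
  obtain ⟨m, v, rfl⟩ := Set.mem_iUnion.mp hy
  exact Submodule.mem_iSup_of_mem (n, m) ⟨HTensor.tmul u v, G.inclTensor_tmul (n, m) u v⟩

variable {G} in
lemma norm_incl_Ω (hz : IsMultiplicativeSeq z) (m : ℕ+) : ‖G.incl m (G.Ω m)‖ = 1 :=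
  ((G.inclIsometry m).norm_map (G.Ω m)).trans (G.isCuntzVector hz m).norm_eq_one

/-- The isometry `ζ ↦ V_{n,m}^* ζ ⊗ Ω_m` from `H_n ⊗ H_m` into `H ⊗ H`. -/
def adjointPiece (hz : IsMultiplicativeSeq z) (p : ℕ+ × ℕ+) :
    HTensor (G.H p.1) (G.H p.2) →ₗᵢ[ℂ] HTensor G.HSum G.HSum :=
  (HTensor.tmulLeftIsometry G.HSum (norm_incl_Ω hz p.2)).comp
    ((G.inclIsometry (p.1 * p.2)).comp (G.unitary hz p.1 p.2).symm.toLinearIsometry)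

lemma adjointPiece_apply (hz : IsMultiplicativeSeq z) (p : ℕ+ × ℕ+)
    (ζ : HTensor (G.H p.1) (G.H p.2)) : G.adjointPiece hz p ζ =
      HTensor.tmul (G.incl (p.1 * p.2) ((G.unitary hz p.1 p.2).symm ζ)) (G.incl p.2 (G.Ω p.2)) :=
  rfl

/-- The piece for `(n, m)` takes values in `H_{nm} ⊗ H_m`, and `(nm, m)` determines `(n, m)` by
cancellation. -/
lemma orthogonalFamily_adjointPiece (hz : IsMultiplicativeSeq z) :
    OrthogonalFamily ℂ (fun p : ℕ+ × ℕ+ => HTensor (G.H p.1) (G.H p.2)) (G.adjointPiece hz) := by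
  intro p q hpq ζ ζ'
  rw [adjointPiece_apply, adjointPiece_apply, HTensor.inner_tmul]
  by_cases h : p.2 = q.2
  · have h1 : p.1 * p.2 ≠ q.1 * q.2 := fun h' =>
      hpq (Prod.ext (mul_right_cancel (h ▸ h' : p.1 * p.2 = q.1 * p.2)) h)
    rw [G.inner_incl_incl_of_ne h1, zero_mul]
  · rw [G.inner_incl_incl_of_ne h, mul_zero]

/-- The isometry `W^*`. -/
def adjointW (hz : IsMultiplicativeSeq z) : HTensor G.HSum G.HSum →ₗᵢ[ℂ] HTensor G.HSum G.HSum :=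
  (G.orthogonalFamily_adjointPiece hz).linearIsometry.comp
    G.isHilbertSum_inclTensor.linearIsometryEquiv.toLinearIsometry

lemma adjointW_apply (hz : IsMultiplicativeSeq z) (p : ℕ+ × ℕ+)
    (ζ : HTensor (G.H p.1) (G.H p.2)) :
    G.adjointW hz (G.inclTensor p ζ) = G.adjointPiece hz p ζ := by
  have h : G.isHilbertSum_inclTensor.linearIsometryEquiv (G.inclTensor p ζ) =
      lp.single 2 p ζ := by
    rw [← LinearIsometryEquiv.eq_symm_apply]
    exact (G.isHilbertSum_inclTensor.linearIsometryEquiv_symm_apply_single ζ).symm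
  change (G.orthogonalFamily_adjointPiece hz).linearIsometry
    (G.isHilbertSum_inclTensor.linearIsometryEquiv (G.inclTensor p ζ)) = _
  rw [h, OrthogonalFamily.linearIsometry_apply_single]

/-- The operator `W`. -/
def canonicalW (hz : IsMultiplicativeSeq z) : HTensor G.HSum G.HSum →L[ℂ] HTensor G.HSum G.HSum :=
  star (G.adjointW hz).toContinuousLinearMap

lemma star_canonicalW (hz : IsMultiplicativeSeq z) :
    star (G.canonicalW hz) = (G.adjointW hz).toContinuousLinearMap := star_star _

lemma inner_canonicalW (hz : IsMultiplicativeSeq z) (ζ η : HTensor G.HSum G.HSum) :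
    Inner.inner ℂ ζ (G.canonicalW hz η) = Inner.inner ℂ (G.adjointW hz ζ) η := by
  rw [canonicalW, ContinuousLinearMap.star_eq_adjoint, ContinuousLinearMap.adjoint_inner_right]
  rfl

lemma eq_of_inner_inclTensor {ζ η : HTensor G.HSum G.HSum}
    (h : ∀ p ξ, Inner.inner ℂ (G.inclTensor p ξ) ζ = Inner.inner ℂ (G.inclTensor p ξ) η) : ζ = η := by
  refine ext_inner_left ℂ fun ξ => ?_
  rw [← inner_conj_symm, ← inner_conj_symm ξ]
  congr 1
  have : innerSL ℂ ζ = innerSL ℂ η := by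
    refine HTensor.ext_total G.dense_span_range_incl G.dense_span_range_incl ?_
    intro x hx y hy
    obtain ⟨n, u, rfl⟩ := Set.mem_iUnion.mp hx
    obtain ⟨m, v, rfl⟩ := Set.mem_iUnion.mp hy
    rw [innerSL_apply_apply, innerSL_apply_apply, ← inner_conj_symm,
      ← inner_conj_symm η]
    congr 1
    have := h (n, m) (HTensor.tmul u v)
    rwa [inclTensor_tmul] at this
  exact DFunLike.congr_fun this ξ

/-- Paired with a vector of `H_a ⊗ H_b`, the left side meets `H_{ab} ⊗ H_b`, which is orthogonal to
`H_{nm} ⊗ H_m` unless `(a, b) = (n, m)`. In that case the second leg contributes `⟪Ω_m, v⟫`. -/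
lemma canonicalW_apply (hz : IsMultiplicativeSeq z) (n m : ℕ+) (u : G.H (n * m)) (v : G.H m) :
    G.canonicalW hz (HTensor.tmul (G.incl (n * m) u) (G.incl m v)) =
      (Inner.inner ℂ (G.Ω m) v : ℂ) • G.inclTensor (n, m) (G.unitary hz n m u) := by
  refine G.eq_of_inner_inclTensor fun p ξ => ?_
  rw [inner_canonicalW, adjointW_apply, adjointPiece_apply, HTensor.inner_tmul, inner_smul_right]
  by_cases h : p = (n, m)
  · subst h
    rw [inner_incl_incl, inner_incl_incl, LinearIsometry.inner_map_map, mul_comm]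
    congr 1
    rw [← LinearIsometryEquiv.inner_map_map (G.unitary hz n m),
      LinearIsometryEquiv.apply_symm_apply]
  · rw [G.orthogonalFamily_inclTensor h, mul_zero]
    by_cases h2 : p.2 = m
    · have h1 : p.1 * p.2 ≠ n * m := fun h' =>
        h (Prod.ext (mul_right_cancel (h2 ▸ h' : p.1 * p.2 = n * p.2)) h2)
      rw [G.inner_incl_incl_of_ne h1, zero_mul]
    · rw [G.inner_incl_incl_of_ne h2, mul_zero]

/-- The range of `W^*` lies in the closed sum of the `H_{ab} ⊗ H_b`, and `H_k ⊗ H_m` is none of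
these. -/
lemma canonicalW_apply_of_not_dvd (hz : IsMultiplicativeSeq z) {k m : ℕ+} (h : ¬ m ∣ k)
    (u : G.H k) (v : G.H m) :
    G.canonicalW hz (HTensor.tmul (G.incl k u) (G.incl m v)) = 0 := by
  refine G.eq_of_inner_inclTensor fun p ξ => ?_
  rw [inner_canonicalW, adjointW_apply, adjointPiece_apply, HTensor.inner_tmul, inner_zero_right]
  by_cases h2 : p.2 = m
  · have h1 : p.1 * p.2 ≠ k := fun h' => h ⟨p.1, by rw [← h', h2, mul_comm]⟩
    rw [G.inner_incl_incl_of_ne h1, zero_mul]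
  · rw [G.inner_incl_incl_of_ne h2, mul_zero]

theorem isCanonicalW_canonicalW (hz : IsMultiplicativeSeq z) :
    G.IsCanonicalW (G.canonicalW hz) where
  apply_mul n m x v := by
    rw [HTensor.tmul_smul, map_smul, map_smul]
    refine (G.canonicalW_apply hz n m _ v).trans ?_
    congr 1
    exact congrArg (G.inclTensor (n, m)) (G.unitary_apply hz n m x)
  apply_of_not_dvd k m h u v := G.canonicalW_apply_of_not_dvd hz h u v

/-- A restatement of the fact that `W^*` is an isometry; it makes `W` a partial isometry and, as `H
⊗ H` is not zero, a nonzero one. -/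
lemma canonicalW_mul_star (hz : IsMultiplicativeSeq z) :
    G.canonicalW hz * star (G.canonicalW hz) = 1 := by
  rw [star_canonicalW]
  ext ζ
  refine ext_inner_left ℂ fun η => ?_
  rw [mul_apply_eq_comp, inner_canonicalW]
  exact (G.adjointW hz).inner_map_map η ζ

end CuntzGNS

/-! ### Covariance -/

namespace CuntzGNS

variable {z : ∀ n : ℕ+, EuclideanSpace ℂ (Fin n)} (G : CuntzGNS z)

lemma repSum_incl (x : OStar) (n : ℕ+) (u : G.H n) :
    G.repSum x (G.incl n u) = G.incl n (G.rep n (x.comp n) u) := by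
  ext k
  refine (directSumRep_apply G.rep x _ k).trans ?_
  by_cases h : k = n
  · subst h
    exact (congrArg (G.rep k (x.comp k)) (lp.single_apply_self 2 k u)).trans
      (lp.single_apply_self 2 k _).symm
  · have h1 : ∀ v : G.H n, (G.incl n v) k = 0 := fun v =>
      (lp.single_apply 2 n v k).trans (Pi.single_eq_of_ne h v)
    rw [h1, h1, map_zero]

lemma repSum_ι_incl (n : ℕ+) (a : CuntzAlg n) (u : G.H n) :
    G.repSum (C0Sum.ι (A := fun n : ℕ+ => CuntzAlg n) n a) (G.incl n u) =
      G.incl n (G.rep n a u) := by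
  rw [repSum_incl, C0Sum.comp_ι, Pi.single_eq_same]

lemma repSum_ι_incl_of_ne {n m : ℕ+} (h : n ≠ m) (a : CuntzAlg n) (u : G.H m) :
    G.repSum (C0Sum.ι (A := fun n : ℕ+ => CuntzAlg n) n a) (G.incl m u) = 0 := by
  rw [repSum_incl, C0Sum.comp_ι, Pi.single_eq_of_ne h.symm, map_zero, _root_.zero_apply, map_zero]

/-- At a fixed vector both sides are continuous and linear in `y`, so elementary tensors of the
algebras suffice. -/
lemma rep_map_ι_induction {p : ℕ+ × ℕ+}
    {L : MinTensor (CuntzAlg p.1) (CuntzAlg p.2) →L[ℂ] HTensor G.HSum G.HSum}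
    {ξ : HTensor G.HSum G.HSum}
    (h : ∀ a b, HTensor.map (G.repSum (C0Sum.ι (A := fun n : ℕ+ => CuntzAlg n) p.1 a))
      (G.repSum (C0Sum.ι (A := fun n : ℕ+ => CuntzAlg n) p.2 b)) ξ = L (MinTensor.tmul a b))
    (y : MinTensor (CuntzAlg p.1) (CuntzAlg p.2)) :
    MinTensor.rep G.repSum G.repSum (MinTensor.map (C0Sum.ι (A := fun n : ℕ+ => CuntzAlg n) p.1)
      (C0Sum.ι (A := fun n : ℕ+ => CuntzAlg n) p.2) y) ξ = L y := by
  let R := (MinTensor.rep G.repSum G.repSum).comp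
    (MinTensor.map (C0Sum.ι (A := fun n : ℕ+ => CuntzAlg n) p.1)
      (C0Sum.ι (A := fun n : ℕ+ => CuntzAlg n) p.2))
  change (ContinuousLinearMap.apply ℂ _ ξ).comp (repCLM R) y = L y
  refine MinTensor.denseRange_ofAlg.induction_on y ?_ fun t => ?_
  · exact isClosed_eq (ContinuousLinearMap.continuous _) L.continuous
  · induction t using TensorProduct.induction_on with
    | zero => rw [map_zero, map_zero, map_zero]
    | add t t' ht ht' => rw [map_add, map_add, map_add, ht, ht']
    | tmul a b =>
      change MinTensor.rep G.repSum G.repSum (MinTensor.map _ _ (MinTensor.tmul a b)) ξ = _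
      rw [MinTensor.map_tmul, MinTensor.rep_tmul]
      exact h a b

lemma rep_map_ι_inclTensor (p : ℕ+ × ℕ+) (y : MinTensor (CuntzAlg p.1) (CuntzAlg p.2))
    (ζ : HTensor (G.H p.1) (G.H p.2)) :
    MinTensor.rep G.repSum G.repSum (MinTensor.map (C0Sum.ι (A := fun n : ℕ+ => CuntzAlg n) p.1)
      (C0Sum.ι (A := fun n : ℕ+ => CuntzAlg n) p.2) y) (G.inclTensor p ζ) =
    G.inclTensor p (MinTensor.rep (G.rep p.1) (G.rep p.2) y ζ) := by
  refine G.rep_map_ι_induction (L := (G.inclTensor p).toContinuousLinearMap.comp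
    ((ContinuousLinearMap.apply ℂ _ ζ).comp (repCLM (MinTensor.rep (G.rep p.1) (G.rep p.2)))))
    (fun a b => ?_) y
  change _ = G.inclTensor p (MinTensor.rep (G.rep p.1) (G.rep p.2) (MinTensor.tmul a b) ζ)
  rw [MinTensor.rep_tmul]
  have : (HTensor.map (G.repSum (C0Sum.ι (A := fun n : ℕ+ => CuntzAlg n) p.1 a))
      (G.repSum (C0Sum.ι (A := fun n : ℕ+ => CuntzAlg n) p.2 b))).comp
      (G.inclTensor p).toContinuousLinearMap = (G.inclTensor p).toContinuousLinearMap.comp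
      (HTensor.map (G.rep p.1 a) (G.rep p.2 b)) := HTensor.ext fun u v => by
    change HTensor.map _ _ (G.inclTensor p (HTensor.tmul u v)) =
      G.inclTensor p (HTensor.map _ _ (HTensor.tmul u v))
    rw [inclTensor_tmul, HTensor.map_tmul, HTensor.map_tmul, inclTensor_tmul, repSum_ι_incl,
      repSum_ι_incl]
  exact DFunLike.congr_fun this ζ

/-- The pairs differ in some leg, and in that leg the algebra element acts by zero. -/
lemma rep_map_ι_inclTensor_of_ne {p q : ℕ+ × ℕ+} (hpq : p ≠ q)
    (y : MinTensor (CuntzAlg p.1) (CuntzAlg p.2)) (ζ : HTensor (G.H q.1) (G.H q.2)) :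
    MinTensor.rep G.repSum G.repSum (MinTensor.map (C0Sum.ι (A := fun n : ℕ+ => CuntzAlg n) p.1)
      (C0Sum.ι (A := fun n : ℕ+ => CuntzAlg n) p.2) y) (G.inclTensor q ζ) = 0 := by
  refine (G.rep_map_ι_induction (L := 0) (fun a b => ?_) y)
  have : (HTensor.map (G.repSum (C0Sum.ι (A := fun n : ℕ+ => CuntzAlg n) p.1 a))
      (G.repSum (C0Sum.ι (A := fun n : ℕ+ => CuntzAlg n) p.2 b))).comp
      (G.inclTensor q).toContinuousLinearMap = 0 := HTensor.ext fun u v => by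
    change HTensor.map _ _ (G.inclTensor q (HTensor.tmul u v)) = 0
    rw [inclTensor_tmul, HTensor.map_tmul]
    by_cases h : p.1 = q.1
    · rw [G.repSum_ι_incl_of_ne (fun h' => hpq (Prod.ext h h')), HTensor.tmul_zero]
    · rw [G.repSum_ι_incl_of_ne h, HTensor.zero_tmul]
  exact DFunLike.congr_fun this ζ

/-- Only the term with index `q` of the series for `Δ_φ(x)` acts nontrivially on `H_{q.1} ⊗
H_{q.2}`. -/
lemma rep_comult_inclTensor (x : OStar) (q : ℕ+ × ℕ+) (ζ : HTensor (G.H q.1) (G.H q.2)) :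
    MinTensor.rep G.repSum G.repSum (comult x) (G.inclTensor q ζ) =
      G.inclTensor q (tensorRep (G.rep q.1) (G.rep q.2) (x.comp (q.1 * q.2)) ζ) := by
  let L : MinTensor OStar OStar →L[ℂ] HTensor G.HSum G.HSum :=
    (ContinuousLinearMap.apply ℂ _ (G.inclTensor q ζ)).comp
      (repCLM (MinTensor.rep G.repSum G.repSum))
  -- Norm convergence of the series permits evaluation at the vector term by term.
  have hs : Summable fun p : ℕ+ × ℕ+ => phiStar p (x.comp (p.1 * p.2)) :=
    C0Sum.summable_lift phiStar (fun _ _ hpq _ _ => map_ι_orthogonal hpq _ _)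
      (C0Sum.pullback (fun p : ℕ+ × ℕ+ => p.1 * p.2) tendsto_mul_cofinite x)
  change L (comult x) = _
  rw [comult_apply, L.map_tsum hs, tsum_eq_single q]
  · exact G.rep_map_ι_inclTensor q (phi q.1 q.2 (x.comp (q.1 * q.2))) ζ
  · intro p hp
    exact G.rep_map_ι_inclTensor_of_ne hp (phi p.1 p.2 (x.comp (p.1 * p.2))) ζ

theorem isCovariantRep_canonicalW (hz : IsMultiplicativeSeq z) :
    IsCovariantRep comult G.repSum (G.canonicalW hz) where
  -- If `W` vanished, `W W^* = 1` would annihilate the unit vector `Ω_1 ⊗ Ω_1`.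
  ne_zero h := by
    have h1 := G.canonicalW_mul_star hz
    rw [h, zero_mul] at h1
    have h2 := DFunLike.congr_fun h1
      (HTensor.tmul (G.incl 1 (G.Ω 1)) (G.incl 1 (G.Ω 1)))
    have h3 := congrArg norm h2
    rw [_root_.zero_apply, one_apply_eq_self, HTensor.norm_tmul, norm_incl_Ω hz, norm_zero] at h3
    norm_num at h3
  partialIsometry := by rw [canonicalW_mul_star, one_mul]
  isometry_star := by
    rw [star_canonicalW]
    exact (G.adjointW hz).isometry
  covariance a := by
    refine HTensor.ext_total G.dense_span_range_incl G.dense_span_range_incl ?_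
    intro x hx y hy
    obtain ⟨k, u, rfl⟩ := Set.mem_iUnion.mp hx
    obtain ⟨m, v, rfl⟩ := Set.mem_iUnion.mp hy
    rw [mul_apply_eq_comp, mul_apply_eq_comp, HTensor.map_tmul, repSum_incl,
      one_apply_eq_self]
    -- The operator `π(a)` preserves `H_k`, so divisibility decides both sides at once: either both
    -- vanish, or both are `⟪Ω_m, v⟫` times the image of `u` under `V` and `a`.
    by_cases h : m ∣ k
    · obtain ⟨n, hn⟩ := h
      obtain rfl : k = n * m := hn.trans (mul_comm m n)
      rw [canonicalW_apply, canonicalW_apply, map_smul, rep_comult_inclTensor, unitary_rep]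
    · rw [G.canonicalW_apply_of_not_dvd hz h, G.canonicalW_apply_of_not_dvd hz h, map_zero]

end CuntzGNS

/-! ### The pentagon equation -/

section Legs

variable {H : Type} [NormedAddCommGroup H] [InnerProductSpace ℂ H]
  {W : HTensor H H →L[ℂ] HTensor H H} {c : ℂ} {x y x' y' : H}

/-- This lemma and its analogues for the other legs assume that `W` sends one given elementary
tensor to a multiple of another. Word vectors have this property. -/
lemma leg23_of_apply (h : W (HTensor.tmul x y) = c • HTensor.tmul x' y') (a : H) :
    leg23 W (HTensor.tmul a (HTensor.tmul x y)) = c • HTensor.tmul a (HTensor.tmul x' y') := by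
  rw [leg23_tmul, h, HTensor.tmul_smul]

lemma leg12_of_apply (h : W (HTensor.tmul x y) = c • HTensor.tmul x' y') (a : H) :
    leg12 W (HTensor.tmul x (HTensor.tmul y a)) = c • HTensor.tmul x' (HTensor.tmul y' a) := by
  rw [← HTensor.assoc_tmul, leg12_assoc_tmul, h, HTensor.smul_tmul, map_smul, HTensor.assoc_tmul]

lemma leg23_flip (a x y : H) :
    leg23 (HTensor.flip H H : HTensor H H →L[ℂ] HTensor H H)
      (HTensor.tmul a (HTensor.tmul x y)) = HTensor.tmul a (HTensor.tmul y x) := by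
  rw [leg23_tmul]
  exact congrArg (HTensor.tmul a) (HTensor.flip_tmul x y)

lemma leg13_of_apply (h : W (HTensor.tmul x y) = c • HTensor.tmul x' y') (a : H) :
    leg13 W (HTensor.tmul x (HTensor.tmul a y)) = c • HTensor.tmul x' (HTensor.tmul a y') := by
  rw [leg13, mul_apply_eq_comp, mul_apply_eq_comp, leg23_flip, leg12_of_apply h, map_smul,
    leg23_flip]

end Legs

lemma splitIndex_eq {n m : ℕ+} {p : Fin (n * m : ℕ+)} {i : Fin n} {j : Fin m}
    (h : (p : ℕ) = m * i + j) : splitIndex n m p = (i, j) := by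
  have h0 := (splitIndex_spec n m p).symm.trans h
  have h1 := congrArg (· / (m : ℕ)) h0
  have h2 := congrArg (· % (m : ℕ)) h0
  simp only [Nat.mul_add_div m.pos, Nat.div_eq_of_lt (Fin.is_lt _), Nat.mul_add_mod,
    Nat.mod_eq_of_lt (Fin.is_lt _), add_zero] at h1 h2
  exact Prod.ext (Fin.ext h1) (Fin.ext h2)

/-- Transport of words along an equality of numbers of letters. -/
def castWord {k l : ℕ+} (h : k = l) (J : List (Fin k)) : List (Fin l) :=
  J.map (Fin.cast (congrArg PNat.val h))

/-! ### Associativity of the splitting of indices and words. -/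

section SplitAssoc

variable (n m l : ℕ+)

/-- With `p = l (m i + j) + k = (m l) i + (l j + k)`, both ways of splitting lead to the triple `(i,
j, k)`. This is coassociativity on the level of indices. -/
lemma splitIndex_assoc (p : Fin (n * m * l : ℕ+)) :
    splitIndex n (m * l) (Fin.cast (congrArg PNat.val (mul_assoc n m l)) p) =
      ((splitIndex n m (splitIndex (n * m) l p).1).1, (splitIndex m l).symm
        ((splitIndex n m (splitIndex (n * m) l p).1).2, (splitIndex (n * m) l p).2)) := by
  refine splitIndex_eq ?_
  have h1 := splitIndex_spec (n * m) l p
  have h2 := splitIndex_spec n m (splitIndex (n * m) l p).1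
  have h3 := splitIndex_spec m l ((splitIndex m l).symm
    ((splitIndex n m (splitIndex (n * m) l p).1).2, (splitIndex (n * m) l p).2))
  rw [Equiv.apply_symm_apply] at h3
  rw [Fin.val_cast, h3, h1, h2, PNat.mul_coe m l]
  ring

variable (R : List (Fin (n * m * l : ℕ+)))

lemma fstWord_castWord :
    fstWord n (m * l) (castWord (mul_assoc n m l) R) = fstWord n m (fstWord (n * m) l R) := by
  simp only [fstWord, castWord, List.map_map]
  refine List.map_congr_left fun p _ => ?_
  simp only [Function.comp_apply, splitIndex_assoc]

lemma fstWord_sndWord_castWord :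
    fstWord m l (sndWord n (m * l) (castWord (mul_assoc n m l) R)) =
      sndWord n m (fstWord (n * m) l R) := by
  simp only [fstWord, sndWord, castWord, List.map_map]
  refine List.map_congr_left fun p _ => ?_
  simp only [Function.comp_apply, splitIndex_assoc, Equiv.apply_symm_apply]

lemma sndWord_sndWord_castWord :
    sndWord m l (sndWord n (m * l) (castWord (mul_assoc n m l) R)) = sndWord (n * m) l R := by
  simp only [sndWord, castWord, List.map_map]
  refine List.map_congr_left fun p _ => ?_
  simp only [Function.comp_apply, splitIndex_assoc, Equiv.apply_symm_apply]

end SplitAssoc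

namespace CuntzGNS

variable {z : ∀ n : ℕ+, EuclideanSpace ℂ (Fin n)} (G : CuntzGNS z)

/-- The word vector `π_n(s_J) Ω_n`, as an element of `H`. -/
def wordSum (n : ℕ+) (J : List (Fin n)) : G.HSum := G.incl n (G.wordVec n J)

/-- Inside `H` the summands with indices `n * m * l` and `n * (m * l)` are the same, so a word
vector may be read in either form. -/
lemma wordSum_castWord {k l : ℕ+} (h : k = l) (J : List (Fin k)) :
    G.wordSum l (castWord h J) = G.wordSum k J := by
  subst h
  simp [castWord]

/-- The unitary `V_{n,m}` splits the word `P`, and the scalar is `⟪Ω_m, s_J Ω_m⟫`. -/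
lemma canonicalW_wordSum (hz : IsMultiplicativeSeq z) (n m : ℕ+) (P : List (Fin (n * m : ℕ+)))
    (J : List (Fin m)) : G.canonicalW hz (HTensor.tmul (G.wordSum (n * m) P) (G.wordSum m J)) =
      (J.map fun j => (starRingEnd ℂ) (z m j)).prod •
        HTensor.tmul (G.wordSum n (fstWord n m P)) (G.wordSum m (sndWord n m P)) := by
  rw [wordSum, wordSum, canonicalW_apply, unitary_wordVec, inclTensor_tmul,
    ← (G.isCuntzVector hz m).inner_word]
  rfl

/-- Zero is written as a multiple of an elementary tensor so that the lemmas on legs apply in this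
case too. -/
lemma canonicalW_wordSum_of_not_dvd (hz : IsMultiplicativeSeq z) {k m : ℕ+} (h : ¬ m ∣ k)
    (P : List (Fin k)) (J : List (Fin m)) :
    G.canonicalW hz (HTensor.tmul (G.wordSum k P) (G.wordSum m J)) =
      (0 : ℂ) • HTensor.tmul (G.wordSum k P) (G.wordSum m J) := by
  rw [zero_smul]
  exact G.canonicalW_apply_of_not_dvd hz h _ _

lemma dense_span_wordSum (hz : IsMultiplicativeSeq z) :
    Dense (Submodule.span ℂ (Set.range fun q : Σ n : ℕ+, List (Fin n) => G.wordSum q.1 q.2) :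
      Set G.HSum) := by
  refine (G.dense_span_incl (G.dense_span_wordVec hz)).mono (Submodule.span_mono ?_)
  intro x hx
  obtain ⟨n, _, ⟨J, rfl⟩, rfl⟩ := Set.mem_iUnion.mp hx
  exact ⟨⟨n, J⟩, rfl⟩

lemma ext_wordSum (hz : IsMultiplicativeSeq z) {V : Type*} [NormedAddCommGroup V]
    [NormedSpace ℂ V] {S T : HTensor G.HSum (HTensor G.HSum G.HSum) →L[ℂ] V}
    (h : ∀ j R k P l Q,
      S (HTensor.tmul (G.wordSum j R) (HTensor.tmul (G.wordSum k P) (G.wordSum l Q))) =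
        T (HTensor.tmul (G.wordSum j R) (HTensor.tmul (G.wordSum k P) (G.wordSum l Q)))) :
    S = T := by
  have hd := G.dense_span_wordSum hz
  have h2 : ∀ x, S.comp (HTensor.tmulRight _ x) = T.comp (HTensor.tmulRight _ x) := fun x => by
    refine HTensor.ext_total hd hd ?_
    rintro _ ⟨⟨k, P⟩, rfl⟩ _ ⟨⟨l, Q⟩, rfl⟩
    have : S.comp (HTensor.tmulLeft _ (HTensor.tmul (G.wordSum k P) (G.wordSum l Q))) =
        T.comp (HTensor.tmulLeft _ (HTensor.tmul (G.wordSum k P) (G.wordSum l Q))) := by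
      refine ContinuousLinearMap.ext_on hd ?_
      rintro _ ⟨⟨j, R⟩, rfl⟩
      exact h j R k P l Q
    exact DFunLike.congr_fun this x
  exact HTensor.ext fun x ζ => DFunLike.congr_fun (h2 x) ζ

/-- Multiplicativity of `z`, letter by letter. In the pentagon equation it matches the scalar that
`W_{12}` takes from `P` on the right with the two scalars taken from its halves by `W_{12}` and
`W_{13}` on the left. -/
lemma prod_conj_mul (hz : IsMultiplicativeSeq z) (m l : ℕ+) (P : List (Fin (m * l : ℕ+))) :
    (P.map fun p => (starRingEnd ℂ) (z (m * l) p)).prod =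
      ((fstWord m l P).map fun p => (starRingEnd ℂ) (z m p)).prod *
        ((sndWord m l P).map fun p => (starRingEnd ℂ) (z l p)).prod := by
  simp only [fstWord, sndWord, List.map_map, ← List.prod_map_mul]
  congr 1
  refine List.map_congr_left fun p _ => ?_
  rw [hz.mul_apply, map_mul]
  rfl

theorem isPentagonal_canonicalW (hz : IsMultiplicativeSeq z) :
    IsPentagonal (G.canonicalW hz) := by
  refine G.ext_wordSum hz fun j R k P l Q => ?_
  simp only [mul_apply_eq_comp]
  by_cases hlk : l ∣ k
  · obtain ⟨m, hm⟩ := hlk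
    obtain rfl : k = m * l := hm.trans (mul_comm l m)
    rw [leg23_of_apply (G.canonicalW_wordSum hz m l P Q), map_smul, map_smul]
    by_cases hlj : l ∣ j
    · obtain ⟨n', hn'⟩ := hlj
      obtain rfl : j = n' * l := hn'.trans (mul_comm l n')
      rw [leg13_of_apply (G.canonicalW_wordSum hz n' l R (sndWord m l P)), map_smul]
      by_cases hmn : m ∣ n'
      · obtain ⟨n, hn⟩ := hmn
        obtain rfl : n' = n * m := hn.trans (mul_comm m n)
        rw [leg12_of_apply (G.canonicalW_wordSum hz n m _ _),
          -- On the right-hand side `W_{12}` divides out `m * l` in one step, so `R` has to be read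
          -- as a word for `n * (m * l)`.
          ← G.wordSum_castWord (mul_assoc n m l) R,
          leg12_of_apply (G.canonicalW_wordSum hz n (m * l) _ _), map_smul,
          leg23_of_apply (G.canonicalW_wordSum hz m l _ _), fstWord_castWord,
          fstWord_sndWord_castWord, sndWord_sndWord_castWord, prod_conj_mul hz]
        simp only [smul_smul]
        congr 1
        ring
      -- Here `W_{12}` kills both sides: after `l` has been split off on the left, and at once on
      -- the right.
      · have hd : ¬ m * l ∣ n' * l := fun h => hmn (by
          rw [PNat.dvd_iff] at h ⊢
          rw [PNat.mul_coe, PNat.mul_coe] at h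
          exact Nat.dvd_of_mul_dvd_mul_right l.pos h)
        rw [leg12_of_apply (G.canonicalW_wordSum_of_not_dvd hz hmn _ _),
          leg12_of_apply (G.canonicalW_wordSum_of_not_dvd hz hd _ _)]
        simp
    · have hd : ¬ m * l ∣ j := fun h => hlj ((Dvd.intro_left m rfl).trans h)
      rw [leg13_of_apply (G.canonicalW_wordSum_of_not_dvd hz hlj _ _),
        leg12_of_apply (G.canonicalW_wordSum_of_not_dvd hz hd _ _)]
      simp
  · rw [leg23_of_apply (G.canonicalW_wordSum_of_not_dvd hz hlk _ _)]
    -- The left side is already zero. On the right, if `W_{12}` does not give zero, it leaves the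
    -- second leg in `H_k`, where `W_{23}` vanishes because `l` does not divide `k`.
    by_cases hkj : k ∣ j
    · obtain ⟨n, hn⟩ := hkj
      obtain rfl : j = n * k := hn.trans (mul_comm k n)
      rw [leg12_of_apply (G.canonicalW_wordSum hz n k _ _), map_smul, map_smul, map_smul,
        leg23_of_apply (G.canonicalW_wordSum_of_not_dvd hz hlk _ _)]
      simp
    · rw [leg12_of_apply (G.canonicalW_wordSum_of_not_dvd hz hkj _ _)]
      simp

/-! ### Inequivalence -/

/-- The joint eigenvalues of the `s_i^*` survive a unitary equivalence, and two joint eigenvectors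
that are not orthogonal must have the same unit vector of eigenvalues. -/
theorem eq_of_unitarilyEquivalent (hz : IsMultiplicativeSeq z)
    {y : ∀ n : ℕ+, EuclideanSpace ℂ (Fin n)} (hy : IsMultiplicativeSeq y) (G' : CuntzGNS y)
    (h : UnitarilyEquivalent G.repSum G'.repSum) : z = y := by
  obtain ⟨U, hU⟩ := h
  funext n
  set ξ := U (G.incl n (G.Ω n)) with hξ
  have hs : ∀ i : Fin n, G'.repSum (C0Sum.ι (A := fun n : ℕ+ => CuntzAlg n) n (star (s i))) ξ =
      z n i • ξ := fun i => by
    rw [hξ, ← hU, repSum_ι_incl, (G.isCuntzVector hz n).star_s, map_smul, map_smul]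
  have hcomp : ∀ (i : Fin n) (k : ℕ+), G'.rep k
      ((C0Sum.ι (A := fun n : ℕ+ => CuntzAlg n) n (star (s i))).comp k) (ξ k) =
      z n i • ξ k := fun i k =>
    (directSumRep_apply G'.rep _ ξ k).symm.trans (congrArg (fun η : G'.HSum => η k) (hs i))
  have hn : ∀ i : Fin n, G'.rep n (star (s i)) (ξ n) = z n i • ξ n := fun i => by
    have := hcomp i n
    rwa [C0Sum.comp_ι, Pi.single_eq_same] at this
  obtain ⟨i, hi⟩ : ∃ i, z n i ≠ 0 := by
    by_contra! h0
    have h1 : z n = 0 := by ext i; exact h0 i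
    have h2 := hz.norm_eq_one n
    rw [h1, norm_zero] at h2
    exact zero_ne_one h2
  -- The summand `𝒪_n` acts by zero on `H'_k`, so the eigenvector equation with a nonzero `z_i`
  -- forces the component to vanish.
  have hk : ∀ k, k ≠ n → ξ k = 0 := fun k hkn => by
    have := hcomp i k
    rw [C0Sum.comp_ι, Pi.single_eq_of_ne hkn, map_zero, _root_.zero_apply] at this
    exact (smul_eq_zero.mp this.symm).resolve_left hi
  have hΩ := G'.isCuntzVector hy n
  -- Every `s_J^*` multiplies `ξ n` by a scalar. If `ξ n` were orthogonal to `Ω'_n`, it would be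
  -- orthogonal to all word vectors, hence zero, whereas `ξ` is a unit vector.
  have hne : Inner.inner ℂ (ξ n) (G'.Ω n) ≠ 0 := fun h0 => by
    have hstar : ∀ J : List (Fin n), ∃ c : ℂ, G'.rep n (star (word J)) (ξ n) = c • ξ n := by
      intro J
      induction J with
      | nil => exact ⟨1, by rw [word_nil, star_one, hΩ.map_one_apply, one_smul]⟩
      | cons j J ih =>
        obtain ⟨c, hc⟩ := ih
        exact ⟨z n j * c, by
          rw [word_cons, star_mul, rep_mul_apply, hn, map_smul, hc, smul_smul]⟩
    have h1 : innerSL ℂ (ξ n) = 0 := by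
      refine ContinuousLinearMap.ext_on (G'.dense_span_wordVec hy n) ?_
      rintro _ ⟨J, rfl⟩
      obtain ⟨c, hc⟩ := hstar J
      rw [innerSL_apply_apply, wordVec, ← rep_star_inner_left, hc, inner_smul_left, h0, mul_zero]
      rfl
    have h2 : ξ n = 0 := by
      have := DFunLike.congr_fun h1 (ξ n)
      rwa [innerSL_apply_apply, _root_.zero_apply, inner_self_eq_zero] at this
    have h3 : ξ = 0 := by
      ext k
      by_cases hkn : k = n
      · subst hkn; exact h2
      · exact hk k hkn
    have h4 : ‖ξ‖ = 1 := (U.norm_map _).trans (norm_incl_Ω hz n)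
    rw [h3, norm_zero] at h4
    exact zero_ne_one h4
  -- Inserting `∑ s_i s_i^* = 1` and moving each `s_i` to the left produces the eigenvalues of both
  -- vectors.
  have hsum : Inner.inner ℂ (ξ n) (G'.Ω n) =
      Inner.inner ℂ (z n) (y n) * Inner.inner ℂ (ξ n) (G'.Ω n) := by
    conv_lhs => rw [← hΩ.map_one_apply (G'.Ω n), ← (isCuntzFamily_s n).sum_mul_star, map_sum,
      _root_.sum_apply, inner_sum]
    rw [PiLp.inner_apply, Finset.sum_mul]
    refine Finset.sum_congr rfl fun i _ => ?_
    rw [rep_mul_apply, ← rep_star_inner_left, hn, hΩ.star_s, inner_smul_left, inner_smul_right,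
      ← mul_assoc]
    congr 1
    exact mul_comm _ _
  have h1 : Inner.inner ℂ (z n) (y n) = (1 : ℂ) :=
    (mul_right_cancel₀ hne (by rw [one_mul]; exact hsum)).symm
  exact (inner_eq_one_iff_of_norm_eq_one (hz.norm_eq_one n) (hy.norm_eq_one n)).mp h1

end CuntzGNS

end

theorem theorem3p3 :
    (∀ z : ∀ n : ℕ+, EuclideanSpace ℂ (Fin n), IsMultiplicativeSeq z →
      (∀ n : ℕ+, ∃! ω : CuntzAlg n →L[ℂ] ℂ, IsCuntzState (z n) ω) ∧
      Nonempty (CuntzGNS z) ∧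
      ∀ G : CuntzGNS z, ∃ W : HTensor G.HSum G.HSum →L[ℂ] HTensor G.HSum G.HSum,
        G.IsCanonicalW W ∧ IsCovariantRep comult G.repSum W ∧ IsPentagonal W) ∧
    (∀ z y : ∀ n : ℕ+, EuclideanSpace ℂ (Fin n), IsMultiplicativeSeq z → IsMultiplicativeSeq y →
      z ≠ y → ∀ (G : CuntzGNS z) (G' : CuntzGNS y),
        ¬ UnitarilyEquivalent G.repSum G'.repSum) := by
  refine ⟨fun z hz => ⟨hz.existsUnique_isCuntzState, hz.nonempty_cuntzGNS, fun G =>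
    ⟨G.canonicalW hz, G.isCanonicalW_canonicalW hz, G.isCovariantRep_canonicalW hz,
      G.isPentagonal_canonicalW hz⟩⟩, fun z y hz hy hzy G G' h => ?_⟩
  exact hzy (G.eq_of_unitarilyEquivalent hz hy G' h)
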